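/- Let $P\subset\mathbb{C}$ be a finite set of points in general position (no three distinct points of $P$ are collinear). For finite $A\subset\mathbb C$ let $\mathrm{Conv}(A)$ be its convex hull; a point of $A$ is called internal to $A$ if it lies in the topological interior of $\mathrm{Conv}(A)$, and $A$ is called convex if it has no internal points. Assume that $P$ satisfies Property $\Delta_2$: for every convex subset $A\subseteq P$ with $|A|\ge 3$, the interior of $\mathrm{Conv}(A)$ contains at most $(|A|-3)+2$ points of $P$. A partition of a finite set $Q\subset\mathbb C$ is noncrossing if the convex hulls of its blocks are pairwise disjoint. Let $\mathrm{NC}(Q)$ be the set of noncrossing partitions of $Q$, partially ordered by refinement, with minimum $\hat 0$ (all blocks are singletons), maximum $\hat 1$ (at most one block), and rank function $\rho(\pi)=|Q|-(\text{number of blocks of }\pi)$. An interval $[\alpha,\beta]$ of $\mathrm{NC}(Q)$ is called rank-symmetric if, with $r=\rho(\beta)-\rho(\alpha)$, for every $0\le k\le r$ the number of $\pi\in[\alpha,\beta]$ with $\rho(\pi)-\rho(\alpha)=k$ equals the number of those with $\rho(\pi)-\rho(\alpha)=r-k$; and $\mathrm{NC}(Q)$ is called rank-symmetric if this holds for $[\hat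 0,\hat 1]$. Let $\ell$ be a boundary line of $P$, that is, the line through two distinct points $u,v\in P$ such that the segment from $u$ to $v$ is an edge of the boundary of $\mathrm{Conv}(P)$, and let $\pi_\ell\in \mathrm{NC}(P)$ be the partition in which $\{u,v\}$ is a block and all other blocks are singletons. Suppose that 1. $P$ satisfies Property $\Delta_1$ relative to $\ell$: every subset $B\subseteq P$ with $u,v\in B$ has at most $\left\lfloor \frac{|B|-2}{2}\right\rfloor$ internal points; and 2. $\mathrm{NC}(Q)$ is rank-symmetric for every proper subset $Q\subsetneq P$. Then the interval $\mathrm{NC}_\ell(P)=[\pi_\ell,\hat 1]$ of $\mathrm{NC}(P)$ is rank-symmetric. -/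

import Mathlib

/-! Noncrossing partitions of finite planar configurations `P ⊂ ℂ`.
Partitions of `P` are `Finpartition P`, ordered by refinement (`⊥` is the partition into
singletons, `⊤` the partition with a single block). -/

noncomputable section

namespace NCConfig

/-- `P` is in general position: no three distinct points of `P` are collinear. -/
def GeneralPosition (P : Finset ℂ) : Prop :=
  ∀ a ∈ P, ∀ b ∈ P, ∀ c ∈ P, a ≠ b → a ≠ c → b ≠ c → ¬ Collinear ℝ ({a, b, c} : Set ℂ)

open Classical in
/-- `int(A)` relative to `P`: the points of `P` in the topological interior of `Conv(A)`. -/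
def interiorPoints (P A : Finset ℂ) : Finset ℂ :=
  P.filter (fun p => p ∈ interior (convexHull ℝ (A : Set ℂ)))

/-- A finite set `A` is convex if no point of `A` lies in the interior of `Conv(A)`. -/
def IsConvexSubset (A : Finset ℂ) : Prop := interiorPoints A A = ∅

/-- Property `Δ_k`: `P` is in general position, and every convex subset `A` of `P` has at most
`(|A| - 3) + k` points of `P` in its interior. Only the `A` with at least three points
matter: the convex hull of a smaller set has empty interior, and no condition is meant there. -/
def PropertyDelta (k : ℕ) (P : Finset ℂ) : Prop :=
  GeneralPosition P ∧
    ∀ A : Finset ℂ, A ⊆ P → 3 ≤ A.card → IsConvexSubset A →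
      (interiorPoints P A).card ≤ (A.card - 3) + k

/-- The line through `u` and `v` is a boundary line of `P`: `u` and `v` are distinct points of
`P`, and the segment between them is an edge of the boundary of `Conv(P)`. -/
structure IsBoundaryLine (P : Finset ℂ) (u v : ℂ) : Prop where
  left_mem : u ∈ P
  right_mem : v ∈ P
  ne : u ≠ v
  edge : segment ℝ u v ⊆ frontier (convexHull ℝ (P : Set ℂ))

/-- Property `Δ₁` relative to the line through `u` and `v`: each `B ⊆ P` that contains `u`
and `v` has at most `⌊(|B| - 2) / 2⌋` internal points. -/
def PropertyDeltaOneRel (P : Finset ℂ) (u v : ℂ) : Prop :=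
  ∀ B : Finset ℂ, B ⊆ P → u ∈ B → v ∈ B → (interiorPoints B B).card ≤ (B.card - 2) / 2

/-- A partition is noncrossing if the convex hulls of distinct blocks are disjoint. -/
def IsNoncrossing {P : Finset ℂ} (π : Finpartition P) : Prop :=
  ∀ A ∈ π.parts, ∀ B ∈ π.parts, A ≠ B →
    Disjoint (convexHull ℝ (A : Set ℂ)) (convexHull ℝ (B : Set ℂ))

/-- `NC(P)`, as a subset of the lattice of all partitions of `P`. -/
def NC (P : Finset ℂ) : Set (Finpartition P) := {π | IsNoncrossing π}

/-- The interval `[a, b]` of `NC(P)`. -/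
def NCIcc {P : Finset ℂ} (a b : Finpartition P) : Set (Finpartition P) := NC P ∩ Set.Icc a b

/-- The rank function `ρ(π) = |P| - bl(π)`. -/
def rank {P : Finset ℂ} (π : Finpartition P) : ℕ := P.card - π.parts.card

/-- The number of elements of rank `k` in the interval `[a, b]` of `NC(P)`, ranks within the
interval being counted from its minimum `a`. -/
def rankNumber {P : Finset ℂ} (a b : Finpartition P) (k : ℕ) : ℕ :=
  {π ∈ NCIcc a b | rank π = rank a + k}.ncard

/-- The interval `[a, b]` of `NC(P)`, which has rank `r = ρ(b) - ρ(a)`, is rank-symmetric: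
for all `k ≤ r` it has as many elements of rank `k` as of rank `r - k`. -/
def IntervalRankSymmetric {P : Finset ℂ} (a b : Finpartition P) : Prop :=
  ∀ k ≤ rank b - rank a, rankNumber a b k = rankNumber a b (rank b - rank a - k)

/-- `NC(P) = [0̂, 1̂]` is rank-symmetric. -/
def NCRankSymmetric (P : Finset ℂ) : Prop :=
  IntervalRankSymmetric (⊥ : Finpartition P) ⊤

/-- The partition `π_ℓ` for the line `ℓ` through the points `u`, `v` of `P`: one block is
`{u, v}`, and all other blocks are singletons. -/
def linePartition {P : Finset ℂ} {u v : ℂ} (hu : u ∈ P) (hv : v ∈ P) : Finpartition P :=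
  (⊥ : Finpartition (P \ {u, v})).extend (b := {u, v}) (c := P)
    (Finset.insert_ne_empty u {v}) Finset.sdiff_disjoint
    (Finset.sdiff_union_of_subset
      (Finset.insert_subset hu (Finset.singleton_subset_iff.mpr hv)))

theorem mem_linePartition {P : Finset ℂ} {u v : ℂ} (hu : u ∈ P) (hv : v ∈ P) (A : Finset ℂ) :
    A ∈ (linePartition hu hv).parts ↔ A = {u, v} ∨ ∃ w ∈ P, w ≠ u ∧ w ≠ v ∧ A = {w} := by
  simp only [linePartition, Finpartition.extend_parts, Finset.mem_insert,
    Finpartition.mem_bot_iff, Finset.mem_sdiff, Finset.mem_singleton, not_or]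
  grind

/-- In general position `π_ℓ` is noncrossing, so that `[π_ℓ, 1̂]` is an interval of `NC(P)`. -/
theorem linePartition_mem_NC {P : Finset ℂ} {u v : ℂ} (hP : GeneralPosition P) (huv : u ≠ v)
    (hu : u ∈ P) (hv : v ∈ P) : linePartition hu hv ∈ NC P := by
  have key : ∀ w ∈ P, w ≠ u → w ≠ v → w ∉ convexHull ℝ ({u, v} : Set ℂ) := by
    intro w hw hwu hwv h
    rw [convexHull_pair] at h
    refine hP u hu w hw v hv hwu.symm huv hwv ?_
    exact (mem_segment_iff_wbtw.mp h).collinear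
  intro A hA B hB hAB
  rw [mem_linePartition] at hA hB
  rcases hA with rfl | ⟨w, hw, hwu, hwv, rfl⟩ <;> rcases hB with rfl | ⟨x, hx, hxu, hxv, rfl⟩
  · exact absurd rfl hAB
  · simpa using key x hx hxu hxv
  · simpa using key w hw hwu hwv
  · simpa using fun h => hAB (by rw [h])

end NCConfig

end

/-! Send the line `uv` to infinity by a projective map, with `v` the point at infinity below the
vertical lines, so that convex hulls in the half-plane to the left of `uv` become convex hulls in
the chart. Call `B ∋ u, v` saturated if it has as many internal points as Property `Δ₁` allows. When
a segment `pq` passes above a vertex `e` of a saturated `B`, then `p`, `q` lie outside `B`, and `e`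
is the only new internal point of `B ∪ {p, q}`, which is saturated again: the bound has grown by
just one. This forces the positions of all points near `pq`.

Erasing `u` identifies the partitions that join `u` and `v` with those noncrossing partitions of
`P ∖ {u}` whose block of `v` can absorb `u`. In the other ones, the block of `v` has an edge `vw`
for which the triangle `uvw` contains a point of `P`, and the configuration splits along `vw`. Since
the distribution of block numbers on `NC(P ∖ {u})` is symmetric by hypothesis, it suffices to treat
the families pinned at such edges. There, either no block meets both sides, and the family is a
product, or the lowest connection between the two sides passes above their common vertex, and the
part above it can be moved across, leaving a smaller instance. -/

noncomputable section

namespace NCConfig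

/-- The orientation determinant of `p, q, r`: twice the signed area of the triangle `pqr`, positive
when `r` lies to the left of the line from `p` to `q`. -/
def orient (p q r : ℂ) : ℝ :=
  (q.re - p.re) * (r.im - p.im) - (q.im - p.im) * (r.re - p.re)

theorem orient_rotate (p q r : ℂ) : orient q r p = orient p q r := by
  unfold orient; ring

theorem orient_swap_right (p q r : ℂ) : orient p r q = -orient p q r := by
  unfold orient; ring

theorem orient_swap_left (p q r : ℂ) : orient q p r = -orient p q r := by
  unfold orient; ring

@[simp] theorem orient_self_right (p r : ℂ) : orient p r r = 0 := by
  unfold orient; ring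

@[simp] theorem orient_self_outer (p r : ℂ) : orient p r p = 0 := by
  unfold orient; ring

theorem orient_combo (p q x y : ℂ) {s t : ℝ} (h : s + t = 1) :
    orient p q (s • x + t • y) = s * orient p q x + t * orient p q y := by
  obtain rfl : s = 1 - t := by linarith
  simp only [orient, Complex.add_re, Complex.add_im, Complex.real_smul, Complex.mul_re,
    Complex.mul_im, Complex.ofReal_re, Complex.ofReal_im]
  ring

theorem orient_add_orient_add_orient (p q r z : ℂ) :
    orient q r z + orient r p z + orient p q z = orient p q r := by
  unfold orient; ring

/-- The affine function `orient x y` in barycentric coordinates with respect to `p, q, r`. -/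
theorem orient_mul_orient (x y p q r z : ℂ) :
    orient p q r * orient x y z =
      orient q r z * orient x y p + orient r p z * orient x y q + orient p q z * orient x y r := by
  unfold orient; ring

@[fun_prop] theorem continuous_orient (p q : ℂ) : Continuous (orient p q) := by
  unfold orient; fun_prop

theorem isOpen_setOf_orient_pos (p q : ℂ) : IsOpen {z | 0 < orient p q z} :=
  isOpen_lt continuous_const (continuous_orient p q)

theorem convex_preimage_orient (p q : ℂ) {s : Set ℝ} (hs : Convex ℝ s) :
    Convex ℝ (orient p q ⁻¹' s) := by
  intro x hx y hy a b ha hb hab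
  rw [Set.mem_preimage, orient_combo _ _ _ _ hab]
  exact hs hx hy ha hb hab

theorem disjoint_convexHull_of_orient {p q : ℂ} {s t : Set ℂ}
    (hs : ∀ z ∈ s, 0 ≤ orient p q z) (ht : ∀ z ∈ t, orient p q z < 0) :
    Disjoint (convexHull ℝ s) (convexHull ℝ t) := by
  have hst : Disjoint (orient p q ⁻¹' Set.Ici 0) (orient p q ⁻¹' Set.Iio 0) :=
    (Set.Iio_disjoint_Ici le_rfl).symm.preimage _
  exact hst.mono (convexHull_min hs (convex_preimage_orient p q (convex_Ici 0)))
    (convexHull_min ht (convex_preimage_orient p q (convex_Iio 0)))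

theorem mem_convexHull_triangle {p q r z : ℂ} {s : Set ℂ} (hp : p ∈ s) (hq : q ∈ s) (hr : r ∈ s)
    (h : 0 < orient p q r) (h₁ : 0 ≤ orient p q z) (h₂ : 0 ≤ orient q r z)
    (h₃ : 0 ≤ orient r p z) : z ∈ convexHull ℝ s := by
  have hz : (orient q r z / orient p q r) • p + (orient r p z / orient p q r) • q +
      (orient p q z / orient p q r) • r = z := by
    apply Complex.ext <;>
      simp only [Complex.add_re, Complex.add_im, Complex.real_smul, Complex.mul_re,
        Complex.mul_im, Complex.ofReal_re, Complex.ofReal_im] <;> field_simp <;>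
      unfold orient <;> ring
  have hw := (convex_convexHull ℝ s).sum_mem (t := Finset.univ)
    (w := ![orient q r z / orient p q r, orient r p z / orient p q r, orient p q z / orient p q r])
    (z := ![p, q, r])
    (by simp only [Finset.mem_univ, forall_const, Fin.forall_fin_succ]
        exact ⟨div_nonneg h₂ h.le, div_nonneg h₃ h.le, div_nonneg h₁ h.le, fun i => i.elim0⟩)
    (by rw [Fin.sum_univ_three]
        simp only [Matrix.cons_val]
        rw [← add_div, ← add_div, orient_add_orient_add_orient, div_self h.ne'])
    (by simp only [Finset.mem_univ, forall_const, Fin.forall_fin_succ]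
        exact ⟨subset_convexHull ℝ s hp, subset_convexHull ℝ s hq, subset_convexHull ℝ s hr,
          fun i => i.elim0⟩)
  rw [Fin.sum_univ_three] at hw
  exact hz ▸ hw

theorem mem_interior_triangle {p q r z : ℂ} {s : Set ℂ} (hp : p ∈ s) (hq : q ∈ s) (hr : r ∈ s)
    (h₁ : 0 < orient p q z) (h₂ : 0 < orient q r z) (h₃ : 0 < orient r p z) :
    z ∈ interior (convexHull ℝ s) := by
  refine interior_maximal ?_ (((isOpen_setOf_orient_pos p q).inter
    (isOpen_setOf_orient_pos q r)).inter (isOpen_setOf_orient_pos r p)) ⟨⟨h₁, h₂⟩, h₃⟩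
  rintro y ⟨⟨h₁, h₂⟩, h₃⟩
  simp only [Set.mem_ofPred_eq] at h₁ h₂ h₃
  refine mem_convexHull_triangle hp hq hr ?_ h₁.le h₂.le h₃.le
  linarith [orient_add_orient_add_orient p q r y]

/-- The segment from `r` to `s` crosses the one from `p` to `q`, from right to left. -/
def Crosses (p q r s : ℂ) : Prop :=
  orient p q r < 0 ∧ 0 < orient p q s ∧ orient r s p * orient r s q < 0

theorem Crosses.not_disjoint_convexHull {p q r s : ℂ} (h : Crosses p q r s) {A B : Set ℂ}
    (hp : p ∈ A) (hq : q ∈ A) (hr : r ∈ B) (hs : s ∈ B) :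
    ¬ Disjoint (convexHull ℝ A) (convexHull ℝ B) := by
  obtain ⟨hneg, hpos, hmul⟩ := h
  set d := orient p q s - orient p q r with hd
  have hd0 : 0 < d := by linarith
  have hd' : orient r s p - orient r s q = d := by
    simp only [hd, orient]; ring
  obtain ⟨hp', hq'⟩ : 0 < orient r s p ∧ orient r s q < 0 := by
    constructor <;> nlinarith
  have hmeet : (-orient r s q / d) • p + (orient r s p / d) • q =
      (orient p q s / d) • r + (-orient p q r / d) • s := by
    apply Complex.ext <;>
      simp only [Complex.add_re, Complex.add_im, Complex.real_smul, Complex.mul_re,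
        Complex.mul_im, Complex.ofReal_re, Complex.ofReal_im] <;> field_simp <;>
      simp only [orient] <;> ring
  refine Set.not_disjoint_iff.2 ⟨_, convex_convexHull ℝ A (subset_convexHull ℝ A hp)
    (subset_convexHull ℝ A hq) (div_nonneg (by linarith) hd0.le) (div_nonneg hp'.le hd0.le)
    (by field_simp; linarith), hmeet ▸ convex_convexHull ℝ B (subset_convexHull ℝ B hr)
    (subset_convexHull ℝ B hs) (div_nonneg hpos.le hd0.le) (div_nonneg (by linarith) hd0.le)
    (by field_simp; linarith)⟩

theorem collinear_of_orient_eq_zero {p q r : ℂ} (hpq : p ≠ q) (h : orient p q r = 0) :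
    Collinear ℝ {p, q, r} := by
  have hqp : q - p ≠ 0 := sub_ne_zero.2 hpq.symm
  have him : ((r - p) / (q - p)).im = 0 := by
    have := Complex.normSq_pos.2 hqp
    rw [Complex.div_im]
    simp only [Complex.sub_re, Complex.sub_im]
    field_simp
    unfold orient at h
    linear_combination h
  have hr : r = (((r - p) / (q - p)).re : ℂ) * (q - p) + p := by
    have hre : (((r - p) / (q - p)).re : ℂ) = (r - p) / (q - p) :=
      Complex.ext rfl (by simp only [Complex.ofReal_im, him])
    rw [hre, div_mul_cancel₀ _ hqp, sub_add_cancel]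
  rw [collinear_iff_of_mem (p₀ := p) (by simp)]
  refine ⟨q - p, ?_⟩
  rintro x (rfl | rfl | rfl)
  · exact ⟨0, by simp⟩
  · exact ⟨1, by simp⟩
  · exact ⟨_, by simpa only [vadd_eq_add, Complex.real_smul] using hr⟩

theorem GeneralPosition.mono {P Q : Finset ℂ} (hP : GeneralPosition P) (h : Q ⊆ P) :
    GeneralPosition Q :=
  fun a ha b hb c hc => hP a (h ha) b (h hb) c (h hc)

theorem GeneralPosition.orient_ne_zero {P : Finset ℂ} (hP : GeneralPosition P) {p q r : ℂ}
    (hp : p ∈ P) (hq : q ∈ P) (hr : r ∈ P) (hpq : p ≠ q) (hpr : p ≠ r) (hqr : q ≠ r) :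
    orient p q r ≠ 0 :=
  fun h => hP p hp q hq r hr hpq hpr hqr (collinear_of_orient_eq_zero hpq h)

theorem GeneralPosition.orient_pos {P : Finset ℂ} (hP : GeneralPosition P) {p q r : ℂ}
    (hp : p ∈ P) (hq : q ∈ P) (hr : r ∈ P) (hpq : p ≠ q) (hpr : p ≠ r) (hqr : q ≠ r)
    (h : 0 ≤ orient p q r) : 0 < orient p q r :=
  h.lt_of_ne' (hP.orient_ne_zero hp hq hr hpq hpr hqr)

section Chart

/-- The cotangent of the angle at `v` from the continuation of `uv` beyond `v` to the ray towards
`z`, negated. On the half-plane to the left of `uv` it is the abscissa in a projective chart that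
sends the line `uv` to infinity and `v` to the point at infinity below the vertical lines. -/
def absc (u v z : ℂ) : ℝ :=
  ((v.re - u.re) * (z.re - v.re) + (v.im - u.im) * (z.im - v.im)) / orient u v z

/-- In the chart of `absc u v`, how much higher than `e` the line `pq` passes over `e`, up to a
positive factor that depends on `e` only. -/
def heightAbove (v e p q : ℂ) : ℝ := orient p q e / orient p q v

variable {u v p q r s e x y z : ℂ}

local notation "α" => absc u v

theorem orient_right_neg_iff (hp : 0 < orient u v p) (hq : 0 < orient u v q) :
    orient p q v < 0 ↔ α p < α q := by
  have huv : 0 < (v.re - u.re) ^ 2 + (v.im - u.im) ^ 2 := by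
    by_contra! h
    have hre : v.re - u.re = 0 := by nlinarith [sq_nonneg (v.im - u.im)]
    have him : v.im - u.im = 0 := by nlinarith [sq_nonneg (v.re - u.re)]
    simp [orient, hre, him] at hp
  have hdiff : α q - α p = ((v.re - u.re) ^ 2 + (v.im - u.im) ^ 2) * -orient p q v /
      (orient u v p * orient u v q) := by
    unfold absc
    field_simp
    unfold orient
    ring
  rw [← sub_pos (b := α p), hdiff, div_pos_iff_of_pos_right (mul_pos hp hq),
    mul_pos_iff_of_pos_left huv, neg_pos]

theorem mem_interior_of_below (hp : 0 < orient u v p) (hq : 0 < orient u v q)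
    (hz : 0 < orient u v z) (hpz : α p < α z) (hzq : α z < α q) (h : orient p q z < 0)
    {A : Set ℂ} (hpA : p ∈ A) (hqA : q ∈ A) (hvA : v ∈ A) : z ∈ interior (convexHull ℝ A) := by
  refine mem_interior_triangle hqA hpA hvA ?_ ?_ ?_
  · rwa [orient_swap_left, neg_pos]
  · rwa [orient_swap_right, neg_pos, orient_right_neg_iff hp hz]
  · rwa [← orient_rotate, orient_swap_left, neg_pos, orient_right_neg_iff hz hq]

theorem heightAbove_pos_iff (hp : 0 < orient u v p) (hq : 0 < orient u v q) (hpq : α p < α q) :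
    0 < heightAbove v z p q ↔ orient p q z < 0 := by
  have hv := (orient_right_neg_iff hp hq).2 hpq
  rw [heightAbove, div_pos_iff]
  grind

theorem heightAbove_neg_iff (hp : 0 < orient u v p) (hq : 0 < orient u v q) (hpq : α p < α q) :
    heightAbove v z p q < 0 ↔ 0 < orient p q z := by
  have hv := (orient_right_neg_iff hp hq).2 hpq
  rw [heightAbove, div_neg_iff]
  grind

@[simp] theorem heightAbove_left (v p q : ℂ) : heightAbove v p p q = 0 := by
  simp [heightAbove]

@[simp] theorem heightAbove_right (v p q : ℂ) : heightAbove v q p q = 0 := by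
  simp [heightAbove]

theorem orient_mul_orient_neg_iff (hp : 0 < orient u v p) (hq : 0 < orient u v q)
    (hpq : α p < α q) :
    orient p q x * orient p q y < 0 ↔ heightAbove v x p q * heightAbove v y p q < 0 := by
  have hv := (orient_right_neg_iff hp hq).2 hpq
  rw [heightAbove, heightAbove, div_mul_div_comm,
    div_lt_iff₀ (mul_pos_of_neg_of_neg hv hv), zero_mul]

/-- Linear interpolation between the abscissae of `r` and `s`. -/
theorem exists_heightAbove_eq (hr : 0 < orient u v r) (hs : 0 < orient u v s)
    (he : 0 < orient u v e) (hre : α r < α e) (hes : α e < α s) :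
    ∃ l m : ℝ, 0 < l ∧ 0 < m ∧ ∀ p q, 0 < orient u v p → 0 < orient u v q → α p < α q →
      heightAbove v e p q = heightAbove v e r s + l * heightAbove v r p q +
        m * heightAbove v s p q := by
  have hrs := (orient_right_neg_iff hr hs).2 (hre.trans hes)
  have hre := (orient_right_neg_iff hr he).2 hre
  have hes := (orient_right_neg_iff he hs).2 hes
  refine ⟨orient e s v / orient r s v, orient r e v / orient r s v, div_pos_of_neg_of_neg hes hrs,
    div_pos_of_neg_of_neg hre hrs, fun p q hp hq hpq => ?_⟩
  have hpq := (orient_right_neg_iff hp hq).2 hpq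
  have h := orient_mul_orient p q r s v e
  rw [orient_rotate e s v, ← orient_rotate v r e] at h
  unfold heightAbove
  field_simp [hrs.ne, hpq.ne]
  linear_combination h

theorem orient_mul_orient_neg_of_heightAbove_lt (hp : 0 < orient u v p) (hq : 0 < orient u v q)
    (hr : 0 < orient u v r) (hs : 0 < orient u v s) (hx : 0 < orient u v x)
    (hy : 0 < orient u v y) (hrs : α r < α s) (hpx : α p < α x) (hxq : α x < α q)
    (hpy : α p < α y) (hyq : α y < α q) (hrx : heightAbove v x r s < heightAbove v x p q)
    (hry : heightAbove v y p q < heightAbove v y r s) : orient r s p * orient r s q < 0 := by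
  obtain ⟨l, m, hl, hm, hlm⟩ := exists_heightAbove_eq hp hq hx hpx hxq
  obtain ⟨l', m', hl', hm', hlm'⟩ := exists_heightAbove_eq hp hq hy hpy hyq
  rw [hlm r s hr hs hrs] at hrx
  rw [hlm' r s hr hs hrs] at hry
  rw [orient_mul_orient_neg_iff hr hs hrs]
  by_contra! h
  rcases mul_nonneg_iff.1 h with ⟨hp', hq'⟩ | ⟨hp', hq'⟩
  · linarith [mul_nonneg hl.le hp', mul_nonneg hm.le hq']
  · linarith [mul_nonpos_of_nonneg_of_nonpos hl'.le hp', mul_nonpos_of_nonneg_of_nonpos hm'.le hq']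

theorem crosses_of_between (hp : 0 < orient u v p) (hq : 0 < orient u v q)
    (hr : 0 < orient u v r) (hs : 0 < orient u v s) (hpr : α p < α r) (hrq : α r < α q)
    (hps : α p < α s) (hsq : α s < α q) (hne : α r ≠ α s) (hbr : orient p q r < 0)
    (has : 0 < orient p q s) : Crosses p q r s := by
  refine ⟨hbr, has, ?_⟩
  have hpq := hpr.trans hrq
  rw [← heightAbove_pos_iff hp hq hpq] at hbr
  rw [← heightAbove_neg_iff hp hq hpq] at has
  rcases lt_or_gt_of_ne hne with h | h
  · exact orient_mul_orient_neg_of_heightAbove_lt hp hq hr hs hr hs h hpr hrq hps hsq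
      (by simpa using hbr) (by simpa using has)
  · rw [orient_swap_left s r p, orient_swap_left s r q, neg_mul_neg]
    exact orient_mul_orient_neg_of_heightAbove_lt hp hq hs hr hr hs h hpr hrq hps hsq
      (by simpa using hbr) (by simpa using has)

theorem crosses_of_above_vertex (hp : 0 < orient u v p) (hq : 0 < orient u v q)
    (hr : 0 < orient u v r) (hs : 0 < orient u v s) (he : 0 < orient u v e) (hpe : α p < α e)
    (hre : α r ≤ α e) (hes : α e < α s) (hsq : α s < α q) (hae : 0 ≤ orient r s e)
    (hbe : orient p q e < 0) (hbr : orient p q r < 0) (has : 0 < orient p q s) :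
    Crosses p q r s := by
  refine ⟨hbr, has, ?_⟩
  have hpq := hpe.trans (hes.trans hsq)
  have hrs := hre.trans_lt hes
  rw [← heightAbove_pos_iff hp hq hpq] at hbe
  rw [← heightAbove_neg_iff hp hq hpq] at has
  rw [← not_lt, ← heightAbove_pos_iff hr hs hrs, not_lt] at hae
  exact orient_mul_orient_neg_of_heightAbove_lt hp hq hr hs he hs hrs hpe (hes.trans hsq)
    (hpe.trans hes) hsq (hae.trans_lt hbe) (by simpa using has)

theorem crosses_of_left (hp : 0 < orient u v p) (hq : 0 < orient u v q)
    (hr : 0 < orient u v r) (hs : 0 < orient u v s) (hrp : α r < α p) (hps : α p < α s)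
    (hsq : α s < α q) (hbr : orient p q r < 0) (has : 0 < orient p q s)
    (hap : 0 < orient r s p) : Crosses p q r s := by
  refine ⟨hbr, has, mul_neg_of_pos_of_neg hap ?_⟩
  obtain ⟨l, m, hl, hm, h⟩ := exists_heightAbove_eq hp hq hs hps hsq
  have hrs := hrp.trans hps
  replace h := h r s hr hs hrs
  rw [← heightAbove_neg_iff hp hq (hps.trans hsq)] at has
  rw [← heightAbove_neg_iff hr hs hrs] at hap
  rw [← heightAbove_pos_iff hr hs hrs, ← mul_pos_iff_of_pos_left hm]
  linarith [mul_neg_of_pos_of_neg hl hap, heightAbove_right v r s]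

theorem crosses_of_right (hp : 0 < orient u v p) (hq : 0 < orient u v q)
    (hr : 0 < orient u v r) (hs : 0 < orient u v s) (hps : α p < α s) (hsq : α s < α q)
    (hqr : α q < α r) (hbr : orient p q r < 0) (has : 0 < orient p q s)
    (haq : 0 < orient s r q) : Crosses p q r s := by
  refine ⟨hbr, has, ?_⟩
  rw [orient_swap_left s r p, orient_swap_left s r q, neg_mul_neg]
  refine mul_neg_of_neg_of_pos ?_ haq
  obtain ⟨l, m, hl, hm, h⟩ := exists_heightAbove_eq hp hq hs hps hsq
  have hsr := hsq.trans hqr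
  replace h := h s r hs hr hsr
  rw [← heightAbove_neg_iff hp hq (hps.trans hsq)] at has
  rw [← heightAbove_neg_iff hs hr hsr] at haq
  rw [← heightAbove_pos_iff hs hr hsr, ← mul_pos_iff_of_pos_left hl]
  linarith [mul_neg_of_pos_of_neg hm haq, heightAbove_left v s r]

theorem crosses_of_heightAbove_le (hp : 0 < orient u v p) (hq : 0 < orient u v q)
    (hr : 0 < orient u v r) (hs : 0 < orient u v s) (he : 0 < orient u v e) (hpe : α p < α e)
    (heq : α e < α q) (hre : α r < α e) (hqs : α q < α s) (hbs : orient p q s < 0)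
    (haq : 0 < orient r s q) (hh : heightAbove v e p q ≤ heightAbove v e r s) :
    Crosses p q s r := by
  have hpq := hpe.trans heq
  have hrs := hre.trans (heq.trans hqs)
  have haq' := haq
  rw [← heightAbove_neg_iff hr hs hrs] at haq
  have hrp : orient r s p < 0 := by
    obtain ⟨l, m, hl, hm, h⟩ := exists_heightAbove_eq hp hq he hpe heq
    rw [← heightAbove_pos_iff hr hs hrs, ← mul_pos_iff_of_pos_left hl]
    linarith [h r s hr hs hrs, mul_neg_of_pos_of_neg hm haq]
  refine ⟨hbs, ?_, ?_⟩
  · obtain ⟨l, m, hl, hm, h⟩ := exists_heightAbove_eq hr hq he hre heq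
    rw [← heightAbove_neg_iff hp hq hpq]
    refine neg_of_mul_neg_right ?_ hl.le
    linarith [h p q hp hq hpq, h r s hr hs hrs, mul_neg_of_pos_of_neg hm haq,
      mul_eq_zero_of_right m (heightAbove_right v p q),
      mul_eq_zero_of_right l (heightAbove_left v r s)]
  · rw [orient_swap_left r s p, orient_swap_left r s q, neg_mul_neg]
    exact mul_neg_of_neg_of_pos hrp haq'

theorem below_of_ends_above (hp : 0 < orient u v p) (hq : 0 < orient u v q)
    (hr : 0 < orient u v r) (hs : 0 < orient u v s) (he : 0 < orient u v e) (hpq : α p < α q)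
    (hre : α r < α e) (hes : α e < α s) (har : 0 ≤ orient p q r) (has : 0 ≤ orient p q s)
    (hbe : orient p q e < 0) : orient r s e < 0 := by
  obtain ⟨l, m, hl, hm, h⟩ := exists_heightAbove_eq hr hs he hre hes
  rw [← not_lt, ← heightAbove_pos_iff hp hq hpq, not_lt] at har has
  rw [← heightAbove_pos_iff hp hq hpq] at hbe
  rw [← heightAbove_pos_iff hr hs (hre.trans hes)]
  linarith [h p q hp hq hpq, mul_nonpos_of_nonneg_of_nonpos hl.le har,
    mul_nonpos_of_nonneg_of_nonpos hm.le has]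

theorem below_of_line_above (hp : 0 < orient u v p) (hq : 0 < orient u v q)
    (hr : 0 < orient u v r) (hs : 0 < orient u v s) (he : 0 < orient u v e)
    (hrp : α r < α p) (hpe : α p < α e) (hes : α e < α s) (hpq : α p < α q)
    (hbp : orient r s p < 0) (has : 0 < orient p q s) (hbe : orient p q e < 0) :
    orient r s e < 0 := by
  have hrs := hrp.trans (hpe.trans hes)
  obtain ⟨l, m, hl, hm, h⟩ := exists_heightAbove_eq hp hs he hpe hes
  rw [← heightAbove_pos_iff hr hs hrs] at hbp ⊢
  rw [← heightAbove_neg_iff hp hq hpq] at has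
  rw [← heightAbove_pos_iff hp hq hpq] at hbe
  linarith [h p q hp hq hpq, h r s hr hs hrs, mul_pos hl hbp, mul_neg_of_pos_of_neg hm has,
    mul_eq_zero_of_right l (heightAbove_left v p q),
    mul_eq_zero_of_right m (heightAbove_right v r s)]

theorem above_of_line_below (hp : 0 < orient u v p) (hq : 0 < orient u v q)
    (hr : 0 < orient u v r) (hz : 0 < orient u v z) (he : 0 < orient u v e)
    (hpe : α p < α e) (heq : α e < α q) (hqz : α q < α z) (hre : α r ≤ α e)
    (hae : 0 ≤ orient r z e) (hbe : orient p q e < 0) (hbz : orient p q z < 0) :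
    0 < orient r z q := by
  have hpq := hpe.trans heq
  have hrz := hre.trans_lt (heq.trans hqz)
  obtain ⟨l, m, hl, hm, h⟩ := exists_heightAbove_eq he hz hq heq hqz
  rw [← not_lt, ← heightAbove_pos_iff hr hz hrz, not_lt] at hae
  rw [← heightAbove_pos_iff hp hq hpq] at hbe hbz
  rw [← heightAbove_neg_iff hr hz hrz]
  linarith [h p q hp hq hpq, h r z hr hz hrz, mul_pos hl hbe, mul_pos hm hbz,
    mul_nonpos_of_nonneg_of_nonpos hl.le hae, heightAbove_right v p q,
    mul_eq_zero_of_right m (heightAbove_right v r z)]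

theorem above_of_left_below (hp : 0 < orient u v p) (hq : 0 < orient u v q)
    (hr : 0 < orient u v r) (hs : 0 < orient u v s) (hpq : α p < α q)
    (hrq : α r < α q) (hqs : α q < α s) (hbr : orient p q r < 0)
    (hbq : orient r s q < 0) : 0 < orient p q s := by
  obtain ⟨l, m, hl, hm, h⟩ := exists_heightAbove_eq hr hs hq hrq hqs
  rw [← heightAbove_pos_iff hp hq hpq] at hbr
  rw [← heightAbove_pos_iff hr hs (hrq.trans hqs)] at hbq
  rw [← heightAbove_neg_iff hp hq hpq]
  refine neg_of_mul_neg_right ?_ hm.le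
  linarith [h p q hp hq hpq, mul_pos hl hbr, heightAbove_right v p q]

theorem heightAbove_lt_of_left_above (hp : 0 < orient u v p) (hq : 0 < orient u v q)
    (hr : 0 < orient u v r) (hs : 0 < orient u v s) (he : 0 < orient u v e) (hpq : α p < α q)
    (hre : α r < α e) (hes : α e < α s) (har : 0 < orient p q r) (has : 0 ≤ orient p q s) :
    heightAbove v e p q < heightAbove v e r s := by
  obtain ⟨l, m, hl, hm, h⟩ := exists_heightAbove_eq hr hs he hre hes
  rw [← heightAbove_neg_iff hp hq hpq] at har
  rw [← not_lt, ← heightAbove_pos_iff hp hq hpq, not_lt] at has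
  linarith [h p q hp hq hpq, mul_neg_of_pos_of_neg hl har,
    mul_nonpos_of_nonneg_of_nonpos hm.le has]

theorem heightAbove_lt_of_right_above (hp : 0 < orient u v p) (hq : 0 < orient u v q)
    (hr : 0 < orient u v r) (hs : 0 < orient u v s) (he : 0 < orient u v e) (hpq : α p < α q)
    (hre : α r < α e) (hes : α e < α s) (har : 0 ≤ orient p q r) (has : 0 < orient p q s) :
    heightAbove v e p q < heightAbove v e r s := by
  obtain ⟨l, m, hl, hm, h⟩ := exists_heightAbove_eq hr hs he hre hes
  rw [← heightAbove_neg_iff hp hq hpq] at has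
  rw [← not_lt, ← heightAbove_pos_iff hp hq hpq, not_lt] at har
  linarith [h p q hp hq hpq, mul_neg_of_pos_of_neg hm has,
    mul_nonpos_of_nonneg_of_nonpos hl.le har]

theorem heightAbove_lt_of_right_below (hp : 0 < orient u v p) (hq : 0 < orient u v q)
    (hr : 0 < orient u v r) (hs : 0 < orient u v s) (he : 0 < orient u v e) (hpq : α p < α q)
    (hre : α r < α e) (heq : α e < α q) (hqs : α q < α s) (har : 0 ≤ orient p q r)
    (hbq : orient r s q < 0) : heightAbove v e p q < heightAbove v e r s := by
  have hrs := hre.trans (heq.trans hqs)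
  obtain ⟨l, m, hl, hm, h⟩ := exists_heightAbove_eq hr hq he hre heq
  rw [← not_lt, ← heightAbove_pos_iff hp hq hpq, not_lt] at har
  rw [← heightAbove_pos_iff hr hs hrs] at hbq
  linarith [h p q hp hq hpq, h r s hr hs hrs, mul_nonpos_of_nonneg_of_nonpos hl.le har,
    mul_pos hm hbq, mul_eq_zero_of_right m (heightAbove_right v p q),
    mul_eq_zero_of_right l (heightAbove_left v r s)]

theorem below_of_left_above (hp : 0 < orient u v p) (hq : 0 < orient u v q)
    (hr : 0 < orient u v r) (hs : 0 < orient u v s) (he : 0 < orient u v e) (hpq : α p < α q)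
    (hre : α r < α e) (heq : α e < α q) (hqs : α q < α s) (har : 0 ≤ orient p q r)
    (hbq : orient r s q < 0) (hbe : orient p q e < 0) : orient r s e < 0 := by
  rw [← heightAbove_pos_iff hp hq hpq] at hbe
  rw [← heightAbove_pos_iff hr hs (hre.trans (heq.trans hqs))]
  exact hbe.trans (heightAbove_lt_of_right_below hp hq hr hs he hpq hre heq hqs har hbq)

theorem heightAbove_replace_left_lt (hp : 0 < orient u v p) (hq : 0 < orient u v q)
    (hz : 0 < orient u v z) (he : 0 < orient u v e) (hpq : α p < α q) (hze : α z < α e)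
    (heq : α e < α q) (hbz : orient p q z < 0) :
    heightAbove v e z q < heightAbove v e p q := by
  obtain ⟨l, m, hl, hm, h⟩ := exists_heightAbove_eq hz hq he hze heq
  rw [← heightAbove_pos_iff hp hq hpq] at hbz
  linarith [h p q hp hq hpq, mul_pos hl hbz, mul_eq_zero_of_right m (heightAbove_right v p q)]

theorem heightAbove_replace_right_lt (hp : 0 < orient u v p) (hq : 0 < orient u v q)
    (hz : 0 < orient u v z) (he : 0 < orient u v e) (hpq : α p < α q) (hpe : α p < α e)
    (hez : α e < α z) (hbz : orient p q z < 0) :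
    heightAbove v e p z < heightAbove v e p q := by
  obtain ⟨l, m, hl, hm, h⟩ := exists_heightAbove_eq hp hz he hpe hez
  rw [← heightAbove_pos_iff hp hq hpq] at hbz
  linarith [h p q hp hq hpq, mul_pos hm hbz, mul_eq_zero_of_right l (heightAbove_left v p q)]

end Chart

/-! ### Families of finite sets with a symmetric distribution of the number of blocks -/

section BlockSymmetric

variable {β : Type*} {𝒜 ℬ : Finset (Finset β)} {N M : ℤ}

/-- The distributions of `#π` and of `N - #π` over the members `π` of `𝒜` agree. Testing against
all functions lets disjoint unions and products be handled by manipulating sums. -/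
def BlockSymmetric (𝒜 : Finset (Finset β)) (N : ℤ) : Prop :=
  ∀ f : ℤ → ℤ, ∑ π ∈ 𝒜, f π.card = ∑ π ∈ 𝒜, f (N - π.card)

theorem BlockSymmetric.union [DecidableEq β] (hA : BlockSymmetric 𝒜 N) (hB : BlockSymmetric ℬ N)
    (h : Disjoint 𝒜 ℬ) : BlockSymmetric (𝒜 ∪ ℬ) N := fun f => by
  rw [Finset.sum_union h, Finset.sum_union h, hA f, hB f]

theorem BlockSymmetric.biUnion [DecidableEq β] {ι : Type*} {I : Finset ι}
    {𝒜 : ι → Finset (Finset β)} (h : ∀ i ∈ I, BlockSymmetric (𝒜 i) N)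
    (hd : (I : Set ι).PairwiseDisjoint 𝒜) : BlockSymmetric (I.biUnion 𝒜) N := fun f => by
  rw [Finset.sum_biUnion hd, Finset.sum_biUnion hd]
  exact Finset.sum_congr rfl fun i hi => h i hi f

theorem BlockSymmetric.sdiff [DecidableEq β] (hA : BlockSymmetric 𝒜 N)
    (hB : BlockSymmetric ℬ N) (h : ℬ ⊆ 𝒜) : BlockSymmetric (𝒜 \ ℬ) N := fun f => by
  have hf := Finset.sum_sdiff (f := fun π => f (π.card : ℤ)) h
  have hf' := Finset.sum_sdiff (f := fun π => f (N - π.card : ℤ)) h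
  linarith [hA f, hB f]

theorem BlockSymmetric.of_bijOn (hB : BlockSymmetric ℬ N) (i : Finset β → Finset β)
    (hi : Set.BijOn i 𝒜 ℬ) (hc : ∀ π ∈ 𝒜, (i π).card = π.card) : BlockSymmetric 𝒜 N := by
  have transport (g : ℤ → ℤ) : ∑ π ∈ 𝒜, g π.card = ∑ π ∈ ℬ, g π.card :=
    Finset.sum_nbij i hi.mapsTo hi.injOn hi.surjOn fun π h => by rw [hc π h]
  intro f
  rw [transport f, transport fun x => f (N - x)]
  exact hB f

open scoped FinsetFamily

theorem sum_sups_card [DecidableEq β] (h : ∀ α ∈ 𝒜, ∀ γ ∈ ℬ, Disjoint α γ) (g : ℤ → ℤ) :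
    ∑ π ∈ 𝒜 ⊻ ℬ, g π.card = ∑ α ∈ 𝒜, ∑ γ ∈ ℬ, g (α.card + γ.card) := by
  have subset_of_eq {α α' γ γ' : Finset β} (hd : Disjoint α γ') (he : α ∪ γ = α' ∪ γ') :
      α ⊆ α' := hd.left_le_of_le_sup_right (Finset.subset_union_left.trans he.le)
  have inj : Set.InjOn (Function.uncurry (· ⊔ ·))
      ((𝒜 ×ˢ ℬ : Finset (Finset β × Finset β)) : Set (Finset β × Finset β)) := by
    rintro ⟨α, γ⟩ hx ⟨α', γ'⟩ hx' (he : α ∪ γ = α' ∪ γ')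
    obtain ⟨hα, hγ⟩ := Finset.mem_product.1 hx
    obtain ⟨hα', hγ'⟩ := Finset.mem_product.1 hx'
    have hd := h α hα γ' hγ'
    have hd' := h α' hα' γ hγ
    have he' : γ ∪ α = γ' ∪ α' := by rw [Finset.union_comm, he, Finset.union_comm]
    exact Prod.ext ((subset_of_eq hd he).antisymm (subset_of_eq hd' he.symm))
      ((subset_of_eq hd'.symm he').antisymm (subset_of_eq hd.symm he'.symm))
  rw [← Finset.sum_product', ← Finset.image_sup_product, Finset.sum_image inj]
  refine Finset.sum_congr rfl fun x hx => ?_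
  obtain ⟨hα, hγ⟩ := Finset.mem_product.1 hx
  rw [Function.uncurry, Finset.sup_eq_union, Finset.card_union_of_disjoint (h _ hα _ hγ),
    Nat.cast_add]

theorem BlockSymmetric.sups [DecidableEq β] (hA : BlockSymmetric 𝒜 N) (hB : BlockSymmetric ℬ M)
    (h : ∀ α ∈ 𝒜, ∀ γ ∈ ℬ, Disjoint α γ) : BlockSymmetric (𝒜 ⊻ ℬ) (N + M) := by
  intro f
  rw [sum_sups_card h f, sum_sups_card h fun x => f (N + M - x)]
  calc ∑ α ∈ 𝒜, ∑ γ ∈ ℬ, f (α.card + γ.card)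
      = ∑ γ ∈ ℬ, ∑ α ∈ 𝒜, f (α.card + γ.card) := Finset.sum_comm
    _ = ∑ γ ∈ ℬ, ∑ α ∈ 𝒜, f (N - α.card + γ.card) :=
        Finset.sum_congr rfl fun γ _ => hA fun x => f (x + γ.card)
    _ = ∑ α ∈ 𝒜, ∑ γ ∈ ℬ, f (N - α.card + γ.card) := Finset.sum_comm
    _ = ∑ α ∈ 𝒜, ∑ γ ∈ ℬ, f (N - α.card + (M - γ.card)) :=
        Finset.sum_congr rfl fun α _ => hB fun x => f (N - α.card + x)
    _ = ∑ α ∈ 𝒜, ∑ γ ∈ ℬ, f (N + M - (α.card + γ.card)) := by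
        simp only [sub_add_sub_comm]

theorem blockSymmetric_iff_card_eq {n : ℕ} (hn : ∀ π ∈ 𝒜, π.card ∈ Finset.Icc 1 n) :
    BlockSymmetric 𝒜 (n + 1) ↔ ∀ i ∈ Finset.Icc 1 n,
      (𝒜.filter fun π => π.card = i).card = (𝒜.filter fun π => π.card = n + 1 - i).card := by
  constructor
  · intro h i hi
    have hsum := h fun x => if x = i then 1 else 0
    rw [Finset.sum_boole, Finset.sum_boole, Nat.cast_inj] at hsum
    rw [Finset.mem_Icc] at hi
    convert hsum using 4 <;> omega
  · intro h f
    have fiberwise (g : ℤ → ℤ) : ∑ π ∈ 𝒜, g π.card =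
        ∑ i ∈ Finset.Icc 1 n, ((𝒜.filter fun π => π.card = i).card : ℤ) * g i := by
      rw [← Finset.sum_fiberwise_of_maps_to hn]
      refine Finset.sum_congr rfl fun i _ => ?_
      rw [← nsmul_eq_mul, ← Finset.sum_const]
      exact Finset.sum_congr rfl fun π hπ => by rw [(Finset.mem_filter.1 hπ).2]
    rw [fiberwise f, fiberwise fun x => f (n + 1 - x)]
    refine Finset.sum_nbij' (n + 1 - ·) (n + 1 - ·) ?_ ?_ ?_ ?_ fun i hi => ?_
    iterate 4 simp only [Finset.mem_Icc]; omega
    rw [h i hi, Nat.cast_sub (by rw [Finset.mem_Icc] at hi; omega)]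
    simp

end BlockSymmetric

/-! ### Noncrossing families -/

/-- The family `π` is a noncrossing partition of `X`. Unlike a `Finpartition X`, it can be compared
with partitions of other point sets. -/
structure IsNCFamily (X : Finset ℂ) (π : Finset (Finset ℂ)) : Prop where
  nonempty : ∀ E ∈ π, E.Nonempty
  subset : ∀ E ∈ π, E ⊆ X
  cover : ∀ z ∈ X, ∃ E ∈ π, z ∈ E
  disjoint : ∀ E ∈ π, ∀ E' ∈ π, E ≠ E' →
    Disjoint (convexHull ℝ (E : Set ℂ)) (convexHull ℝ (E' : Set ℂ))

theorem IsNCFamily.eq_of_mem {X : Finset ℂ} {π : Finset (Finset ℂ)} (h : IsNCFamily X π)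
    {E E' : Finset ℂ} (hE : E ∈ π) (hE' : E' ∈ π) {z : ℂ} (hz : z ∈ E) (hz' : z ∈ E') :
    E = E' := by
  by_contra hne
  exact Set.disjoint_left.1 (h.disjoint E hE E' hE' hne)
    (subset_convexHull ℝ _ hz) (subset_convexHull ℝ _ hz')

theorem IsNCFamily.not_crosses {X : Finset ℂ} {π : Finset (Finset ℂ)} (h : IsNCFamily X π)
    {E E' : Finset ℂ} (hE : E ∈ π) (hE' : E' ∈ π) (hne : E ≠ E') {p q r s : ℂ} (hp : p ∈ E)
    (hq : q ∈ E) (hr : r ∈ E') (hs : s ∈ E') : ¬ Crosses p q r s := fun hc =>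
  hc.not_disjoint_convexHull (A := (E : Set ℂ)) (B := (E' : Set ℂ)) hp hq hr hs
    (h.disjoint E hE E' hE' hne)

theorem IsNCFamily.disjoint_of_disjoint {X Y : Finset ℂ} {π σ : Finset (Finset ℂ)}
    (hπ : IsNCFamily X π) (hσ : IsNCFamily Y σ) (h : Disjoint X Y) : Disjoint π σ :=
  Finset.disjoint_left.2 fun E hE hE' => (hπ.nonempty E hE).ne_empty <|
    Finset.disjoint_self_iff_empty E |>.1 (h.mono (hπ.subset E hE) (hσ.subset E hE'))

open Classical in
/-- All noncrossing partitions of `X`. -/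
def ncFamilies (X : Finset ℂ) : Finset (Finset (Finset ℂ)) :=
  X.powerset.powerset.filter (IsNCFamily X)

theorem mem_ncFamilies {X : Finset ℂ} {π : Finset (Finset ℂ)} :
    π ∈ ncFamilies X ↔ IsNCFamily X π := by
  simp only [ncFamilies, Finset.mem_filter, Finset.mem_powerset, and_iff_right_iff_imp]
  exact fun h E hE => Finset.mem_powerset.2 (h.subset E hE)

/-- The traces on `Y` of the members of `π`. -/
def trace (π : Finset (Finset ℂ)) (Y : Finset ℂ) : Finset (Finset ℂ) :=
  (π.image (· ∩ Y)).erase ∅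

theorem mem_trace {π : Finset (Finset ℂ)} {Y A : Finset ℂ} :
    A ∈ trace π Y ↔ A.Nonempty ∧ ∃ E ∈ π, E ∩ Y = A := by
  simp only [trace, Finset.mem_erase, Finset.mem_image, Finset.nonempty_iff_ne_empty]

theorem IsNCFamily.trace {X Y : Finset ℂ} {π : Finset (Finset ℂ)} (h : IsNCFamily X π)
    (hY : Y ⊆ X) : IsNCFamily Y (trace π Y) := by
  refine ⟨fun A hA => (mem_trace.1 hA).1, fun A hA => ?_, fun z hz => ?_,
    fun A hA A' hA' hne => ?_⟩
  · obtain ⟨-, E, -, rfl⟩ := mem_trace.1 hA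
    exact Finset.inter_subset_right
  · obtain ⟨E, hE, hzE⟩ := h.cover z (hY hz)
    have hz' := Finset.mem_inter.2 ⟨hzE, hz⟩
    exact ⟨E ∩ Y, mem_trace.2 ⟨⟨z, hz'⟩, E, hE, rfl⟩, hz'⟩
  · obtain ⟨-, E, hE, rfl⟩ := mem_trace.1 hA
    obtain ⟨-, E', hE', rfl⟩ := mem_trace.1 hA'
    exact (h.disjoint E hE E' hE' fun h => hne (by rw [h])).mono
      (convexHull_mono (by simp)) (convexHull_mono (by simp))

/-- Some block contains both points of the pair `k` and lies to the left of it. -/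
def Pinned (π : Finset (Finset ℂ)) (k : ℂ × ℂ) : Prop :=
  ∃ E ∈ π, k.1 ∈ E ∧ k.2 ∈ E ∧ ∀ z ∈ E, 0 ≤ orient k.1 k.2 z

open Classical in
/-- The noncrossing partitions of `X` that are pinned at all pairs of the list `K`. -/
def pinnedFamilies (X : Finset ℂ) (K : List (ℂ × ℂ)) : Finset (Finset (Finset ℂ)) :=
  (ncFamilies X).filter fun π => ∀ k ∈ K, Pinned π k

theorem mem_pinnedFamilies {X : Finset ℂ} {K : List (ℂ × ℂ)} {π : Finset (Finset ℂ)} :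
    π ∈ pinnedFamilies X K ↔ IsNCFamily X π ∧ ∀ k ∈ K, Pinned π k := by
  simp only [pinnedFamilies, Finset.mem_filter, mem_ncFamilies]

@[simp] theorem pinnedFamilies_nil (X : Finset ℂ) : pinnedFamilies X [] = ncFamilies X := by
  simp [pinnedFamilies]

/-! ### Intervals of partitions as sets of families -/

theorem isNCFamily_parts {P : Finset ℂ} {π : Finpartition P} (h : IsNoncrossing π) :
    IsNCFamily P π.parts :=
  ⟨fun _ hE => π.nonempty_of_mem_parts hE, fun _ hE => π.subset hE, fun _ hz => π.exists_mem hz, h⟩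

theorem IsNCFamily.exists_finpartition {P : Finset ℂ} {σ : Finset (Finset ℂ)}
    (h : IsNCFamily P σ) : ∃ π : Finpartition P, IsNoncrossing π ∧ π.parts = σ := by
  let π : Finpartition P := Finpartition.ofExistsUnique σ h.subset
    (fun z hz => by
      obtain ⟨E, hE, hzE⟩ := h.cover z hz
      exact ⟨E, ⟨hE, hzE⟩, fun E' hE' => h.eq_of_mem hE'.1 hE hE'.2 hzE⟩)
    (fun he => by simpa using h.nonempty ∅ he)
  exact ⟨π, h.disjoint, rfl⟩

theorem exists_mem_NCIcc_top_parts_eq_iff {P : Finset ℂ} {x : Finpartition P}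
    {σ : Finset (Finset ℂ)} : (∃ π ∈ NCIcc x ⊤, π.parts = σ) ↔
      IsNCFamily P σ ∧ ∀ A ∈ x.parts, ∃ E ∈ σ, A ⊆ E := by
  constructor
  · rintro ⟨π, ⟨h, hx, -⟩, rfl⟩
    exact ⟨isNCFamily_parts h, fun A hA => hx hA⟩
  · rintro ⟨h, hx⟩
    obtain ⟨π, hπ, rfl⟩ := h.exists_finpartition
    exact ⟨π, ⟨hπ, fun A hA => hx A hA, le_top⟩, rfl⟩

theorem rankNumber_eq_card {P : Finset ℂ} {x y : Finpartition P} {𝒜 : Finset (Finset (Finset ℂ))}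
    (h𝒜 : ∀ σ, σ ∈ 𝒜 ↔ ∃ π ∈ NCIcc x y, π.parts = σ) {i k : ℕ}
    (hik : i + k = x.parts.card) :
    rankNumber x y k = (𝒜.filter fun σ => σ.card = i).card := by
  have rank_eq_iff (π : Finpartition P) :
      rank π = rank x + k ↔ π.parts.card = i := by
    have := π.card_parts_le_card
    have := x.card_parts_le_card
    unfold rank
    omega
  rw [rankNumber, ← Set.ncard_image_of_injective _ (fun _ _ => Finpartition.ext),
    ← Set.ncard_coe_finset]
  congr 1
  ext σ
  simp only [Set.mem_image, Set.mem_sep_iff, Finset.coe_filter, h𝒜, rank_eq_iff]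
  constructor
  · rintro ⟨π, ⟨hπ, hk⟩, rfl⟩
    exact ⟨⟨π, hπ, rfl⟩, hk⟩
  · rintro ⟨⟨π, hπ, rfl⟩, hk⟩
    exact ⟨π, ⟨hπ, hk⟩, rfl⟩

theorem card_parts_top {P : Finset ℂ} (hP : P.Nonempty) :
    (⊤ : Finpartition P).parts.card = 1 :=
  (Finset.card_le_card (Finpartition.parts_top_subset P)).antisymm
    (Finpartition.parts_nonempty (⊤ : Finpartition P) hP.ne_empty).card_pos

theorem intervalRankSymmetric_top_iff {P : Finset ℂ} (hP : P.Nonempty) {x : Finpartition P}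
    {𝒜 : Finset (Finset (Finset ℂ))} (h𝒜 : ∀ σ, σ ∈ 𝒜 ↔ ∃ π ∈ NCIcc x ⊤, π.parts = σ) :
    IntervalRankSymmetric x ⊤ ↔ BlockSymmetric 𝒜 (x.parts.card + 1) := by
  have hx : x.parts.card ≤ P.card := x.card_parts_le_card
  have hpos : 1 ≤ x.parts.card := (x.parts_nonempty hP.ne_empty).card_pos
  have hrank : rank (⊤ : Finpartition P) - rank x = x.parts.card - 1 := by
    rw [rank, rank, card_parts_top hP]
    omega
  have hn : ∀ σ ∈ 𝒜, σ.card ∈ Finset.Icc 1 x.parts.card := by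
    intro σ hσ
    obtain ⟨π, ⟨-, hxπ, -⟩, rfl⟩ := (h𝒜 σ).1 hσ
    exact Finset.mem_Icc.2
      ⟨(π.parts_nonempty hP.ne_empty).card_pos, Finpartition.card_mono hxπ⟩
  rw [blockSymmetric_iff_card_eq hn, IntervalRankSymmetric, hrank]
  simp only [Finset.mem_Icc]
  constructor
  · intro h i hi
    rw [← rankNumber_eq_card h𝒜 (k := x.parts.card - i) (by omega), h _ (by omega)]
    exact rankNumber_eq_card h𝒜 (by omega)
  · intro h k hk
    rw [rankNumber_eq_card h𝒜 (i := x.parts.card - k) (by omega), h _ (by omega)]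
    exact (rankNumber_eq_card h𝒜 (by omega)).symm

theorem NCRankSymmetric.blockSymmetric {Q : Finset ℂ} (hQ : Q.Nonempty) (h : NCRankSymmetric Q) :
    BlockSymmetric (ncFamilies Q) (Q.card + 1) := by
  rw [← Finpartition.card_bot, ← intervalRankSymmetric_top_iff hQ]
  · exact h
  · intro σ
    rw [exists_mem_NCIcc_top_parts_eq_iff, mem_ncFamilies]
    refine ⟨fun hσ => ⟨hσ, fun A hA => ?_⟩, And.left⟩
    obtain ⟨z, hz, rfl⟩ := Finpartition.mem_bot_iff.1 hA
    simpa using hσ.cover z hz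

theorem card_parts_linePartition {P : Finset ℂ} {u v : ℂ} (hu : u ∈ P) (hv : v ∈ P) (huv : u ≠ v) :
    (linePartition hu hv).parts.card + 1 = P.card := by
  have hsub : {u, v} ⊆ P := by simp [Finset.insert_subset_iff, hu, hv]
  have := Finset.card_sdiff_add_card_eq_card hsub
  rw [Finset.card_pair huv] at this
  rw [linePartition, Finpartition.card_extend, Finpartition.card_bot]
  exact this

theorem intervalRankSymmetric_linePartition {P : Finset ℂ} {u v : ℂ} (hu : u ∈ P) (hv : v ∈ P)
    (huv : u ≠ v) {𝒜 : Finset (Finset (Finset ℂ))}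
    (h𝒜 : ∀ σ, σ ∈ 𝒜 ↔ IsNCFamily P σ ∧ ∃ E ∈ σ, u ∈ E ∧ v ∈ E)
    (h : BlockSymmetric 𝒜 P.card) : IntervalRankSymmetric (linePartition hu hv) ⊤ := by
  rw [← card_parts_linePartition hu hv huv, Nat.cast_add_one] at h
  refine (intervalRankSymmetric_top_iff ⟨u, hu⟩ fun σ => ?_).2 h
  rw [h𝒜, exists_mem_NCIcc_top_parts_eq_iff]
  refine and_congr_right fun hσ => ⟨?_, fun hA => ?_⟩
  · rintro ⟨E, hE, huE, hvE⟩ A hA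
    rcases (mem_linePartition hu hv A).1 hA with rfl | ⟨w, hw, -, -, rfl⟩
    · exact ⟨E, hE, by simp [Finset.insert_subset_iff, huE, hvE]⟩
    · simpa using hσ.cover w hw
  · simpa [Finset.insert_subset_iff] using hA {u, v} ((mem_linePartition hu hv _).2 (Or.inl rfl))

/-! ### Anchored configurations and saturated subsets -/

/-- A configuration in general position, to the left of the directed line from `u` to `v`, with
Property `Δ₁` relative to that line. -/
structure IsAnchored (P : Finset ℂ) (u v : ℂ) : Prop where
  gp : GeneralPosition P
  left_mem : u ∈ P
  right_mem : v ∈ P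
  ne : u ≠ v
  pos : ∀ z ∈ P, z ≠ u → z ≠ v → 0 < orient u v z
  rel : PropertyDeltaOneRel P u v

/-- The points of `P` strictly to the left of the directed line from `u` to `v`: those that are
visible in the projective chart of this line. -/
def chartPoints (P : Finset ℂ) (u v : ℂ) : Finset ℂ := P.filter fun z => 0 < orient u v z

/-- `B` attains the bound of Property `Δ₁` relative to the line through `u` and `v`. -/
structure IsSaturated (P : Finset ℂ) (u v : ℂ) (B : Finset ℂ) : Prop where
  subset : B ⊆ P
  left_mem : u ∈ B
  right_mem : v ∈ B
  card_eq : 2 * (interiorPoints B B).card + 2 = B.card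

/-- `e` lies below the segment from `x` to `y` in the chart. -/
structure Covers (u v x y e : ℂ) : Prop where
  pos : 0 < orient u v y
  lt_left : absc u v x < absc u v e
  lt_right : absc u v e < absc u v y
  below : orient x y e < 0

/-- The segment `pq` covers the vertex `e` of `B`. -/
structure IsCovering (P B : Finset ℂ) (u v p q e : ℂ) : Prop where
  left_mem : p ∈ chartPoints P u v
  right_mem : q ∈ chartPoints P u v
  mem : e ∈ chartPoints P u v
  vertex_mem : e ∈ B
  not_interior : e ∉ interiorPoints B B
  covers : Covers u v p q e

section Saturated

variable {P B : Finset ℂ} {u v p q e z : ℂ}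

theorem mem_chartPoints : z ∈ chartPoints P u v ↔ z ∈ P ∧ 0 < orient u v z := by
  simp only [chartPoints, Finset.mem_filter]

theorem ne_of_mem_chartPoints (hz : z ∈ chartPoints P u v) : z ≠ u ∧ z ≠ v := by
  have := (mem_chartPoints.1 hz).2
  constructor <;> rintro rfl <;> simp at this

theorem IsAnchored.mem_chartPoints (hP : IsAnchored P u v) (hz : z ∈ P) (hu : z ≠ u)
    (hv : z ≠ v) : z ∈ chartPoints P u v :=
  NCConfig.mem_chartPoints.2 ⟨hz, hP.pos z hz hu hv⟩

theorem IsAnchored.orient_ne_zero (hP : IsAnchored P u v) {r : ℂ} (hp : p ∈ chartPoints P u v)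
    (hq : q ∈ chartPoints P u v) (hr : r ∈ chartPoints P u v) (hpq : p ≠ q) (hpr : p ≠ r)
    (hqr : q ≠ r) : orient p q r ≠ 0 :=
  hP.gp.orient_ne_zero (NCConfig.mem_chartPoints.1 hp).1 (NCConfig.mem_chartPoints.1 hq).1
    (NCConfig.mem_chartPoints.1 hr).1 hpq hpr hqr

theorem IsAnchored.absc_ne (hP : IsAnchored P u v) (hp : p ∈ chartPoints P u v)
    (hq : q ∈ chartPoints P u v) (hpq : p ≠ q) : absc u v p ≠ absc u v q := by
  intro h
  obtain ⟨hpP, hp0⟩ := NCConfig.mem_chartPoints.1 hp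
  obtain ⟨hqP, hq0⟩ := NCConfig.mem_chartPoints.1 hq
  have hpq' := (orient_right_neg_iff hp0 hq0).not.2 h.not_lt
  have hqp := (orient_right_neg_iff hq0 hp0).not.2 h.symm.not_lt
  rw [orient_swap_left] at hqp
  exact hP.gp.orient_ne_zero hpP hqP hP.right_mem hpq (ne_of_mem_chartPoints hp).2
    (ne_of_mem_chartPoints hq).2 (by linarith)

theorem mem_interiorPoints {A : Finset ℂ} :
    z ∈ interiorPoints P A ↔ z ∈ P ∧ z ∈ interior (convexHull ℝ (A : Set ℂ)) := by
  simp only [interiorPoints, Finset.mem_filter]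

theorem interiorPoints_self_mono {A : Finset ℂ} (h : A ⊆ B) :
    interiorPoints A A ⊆ interiorPoints B B := fun z hz => by
  rw [mem_interiorPoints] at hz ⊢
  exact ⟨h hz.1, interior_mono (convexHull_mono (Finset.coe_subset.2 h)) hz.2⟩

theorem Covers.mem_interior (h : Covers u v p q e) (hp : p ∈ chartPoints P u v)
    (he : e ∈ chartPoints P u v) {A : Set ℂ} (hpA : p ∈ A) (hqA : q ∈ A) (hvA : v ∈ A) :
    e ∈ interior (convexHull ℝ A) :=
  mem_interior_of_below (mem_chartPoints.1 hp).2 h.pos (mem_chartPoints.1 he).2 h.lt_left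
    h.lt_right h.below hpA hqA hvA

theorem IsSaturated.two_mul_card_le (hP : IsAnchored P u v) (hB : IsSaturated P u v B)
    {T I : Finset ℂ} (hT : T ⊆ P) (hI : I ⊆ interiorPoints (B ∪ T) (B ∪ T))
    (hnew : Disjoint (interiorPoints B B) I) : 2 * I.card ≤ (T \ B).card := by
  have hrel := hP.rel (B ∪ T) (Finset.union_subset hB.subset hT)
    (Finset.mem_union_left _ hB.left_mem) (Finset.mem_union_left _ hB.right_mem)
  have hint := Finset.card_le_card
    (Finset.union_subset (interiorPoints_self_mono Finset.subset_union_left) hI)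
  rw [Finset.card_union_of_disjoint hnew] at hint
  have hcard : (B ∪ T).card = B.card + (T \ B).card := by
    rw [← Finset.card_union_of_disjoint Finset.disjoint_sdiff, Finset.union_sdiff_self_eq_union]
  have hsat := hB.card_eq
  omega

theorem IsSaturated.not_two_interior (hP : IsAnchored P u v) (hB : IsSaturated P u v B)
    {T : Finset ℂ} (hT : T ⊆ P) (hcard : T.card ≤ 3) {i j : ℂ} (hij : i ≠ j)
    (hi : i ∉ interiorPoints B B) (hj : j ∉ interiorPoints B B)
    (hi' : i ∈ interiorPoints (B ∪ T) (B ∪ T)) (hj' : j ∈ interiorPoints (B ∪ T) (B ∪ T)) :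
    False := by
  have h := hB.two_mul_card_le hP hT (I := {i, j})
    (Finset.insert_subset hi' (Finset.singleton_subset_iff.2 hj')) (by simp [hi, hj])
  have hle := Finset.card_le_card (Finset.sdiff_subset (s := T) (t := B))
  rw [Finset.card_pair hij] at h
  omega

theorem IsSaturated.not_covers (hP : IsAnchored P u v) (hB : IsSaturated P u v B)
    (hp : p ∈ chartPoints P u v) (hq : q ∈ P) (hpq : p ∈ B ∨ q ∈ B) (heB : e ∈ B)
    (he' : e ∉ interiorPoints B B) (he : e ∈ chartPoints P u v) : ¬ Covers u v p q e := by
  intro h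
  obtain ⟨t, ht, hpt, hqt⟩ : ∃ t ∈ P, p ∈ B ∪ {t} ∧ q ∈ B ∪ {t} := by
    rcases hpq with hp' | hq'
    · exact ⟨q, hq, by simp [hp'], by simp⟩
    · exact ⟨p, (mem_chartPoints.1 hp).1, by simp, by simp [hq']⟩
  have hcard := hB.two_mul_card_le hP (T := {t}) (I := {e}) (by simpa using ht)
    (Finset.singleton_subset_iff.2 <| mem_interiorPoints.2 ⟨by simp [heB],
      h.mem_interior hp he (by simpa using hpt) (by simpa using hqt) (by simp [hB.right_mem])⟩)
    (by simpa using he')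
  have hle := Finset.card_le_card (Finset.sdiff_subset (s := {t}) (t := B))
  rw [Finset.card_singleton] at hcard hle
  omega

namespace IsCovering

theorem lt (h : IsCovering P B u v p q e) : absc u v p < absc u v q :=
  h.covers.lt_left.trans h.covers.lt_right

theorem ne (h : IsCovering P B u v p q e) : p ≠ q := fun hpq => (hpq ▸ h.lt).false

theorem left_notMem (hP : IsAnchored P u v) (hB : IsSaturated P u v B)
    (h : IsCovering P B u v p q e) : p ∉ B := fun hp =>
  hB.not_covers hP h.left_mem (mem_chartPoints.1 h.right_mem).1 (Or.inl hp) h.vertex_mem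
    h.not_interior h.mem h.covers

theorem right_notMem (hP : IsAnchored P u v) (hB : IsSaturated P u v B)
    (h : IsCovering P B u v p q e) : q ∉ B := fun hq =>
  hB.not_covers hP h.left_mem (mem_chartPoints.1 h.right_mem).1 (Or.inr hq) h.vertex_mem
    h.not_interior h.mem h.covers

theorem left_ne (hP : IsAnchored P u v) (hB : IsSaturated P u v B)
    (h : IsCovering P B u v p q e) : p ≠ e := fun h' => h.left_notMem hP hB (h' ▸ h.vertex_mem)

theorem right_ne (hP : IsAnchored P u v) (hB : IsSaturated P u v B)
    (h : IsCovering P B u v p q e) : q ≠ e := fun h' => h.right_notMem hP hB (h' ▸ h.vertex_mem)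

theorem pair_subset (h : IsCovering P B u v p q e) : ({p, q} : Finset ℂ) ⊆ P := by
  simp [Finset.insert_subset_iff, (mem_chartPoints.1 h.left_mem).1,
    (mem_chartPoints.1 h.right_mem).1]

theorem below_anchor (h : IsCovering P B u v p q e) : orient p q v < 0 :=
  (orient_right_neg_iff (mem_chartPoints.1 h.left_mem).2 (mem_chartPoints.1 h.right_mem).2).2
    h.lt

theorem mem_interiorPoints (hB : IsSaturated P u v B) (h : IsCovering P B u v p q e)
    {T : Finset ℂ} (hp : p ∈ T) (hq : q ∈ T) : e ∈ interiorPoints (B ∪ T) (B ∪ T) :=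
  NCConfig.mem_interiorPoints.2 ⟨Finset.mem_union_left _ h.vertex_mem,
    h.covers.mem_interior h.left_mem h.mem (by simp [hp]) (by simp [hq]) (by simp [hB.right_mem])⟩

theorem card_union_pair (hP : IsAnchored P u v) (hB : IsSaturated P u v B)
    (h : IsCovering P B u v p q e) : (B ∪ {p, q}).card = B.card + 2 := by
  rw [Finset.card_union_of_disjoint, Finset.card_pair h.ne]
  simp [h.left_notMem hP hB, h.right_notMem hP hB]

theorem interiorPoints_eq (hP : IsAnchored P u v) (hB : IsSaturated P u v B)
    (h : IsCovering P B u v p q e) :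
    interiorPoints (B ∪ {p, q}) (B ∪ {p, q}) = insert e (interiorPoints B B) := by
  symm
  apply Finset.eq_of_subset_of_card_le
  · exact Finset.insert_subset (h.mem_interiorPoints hB (by simp) (by simp))
      (interiorPoints_self_mono Finset.subset_union_left)
  · have hrel := hP.rel (B ∪ {p, q}) (Finset.union_subset hB.subset h.pair_subset)
      (Finset.mem_union_left _ hB.left_mem) (Finset.mem_union_left _ hB.right_mem)
    rw [h.card_union_pair hP hB, ← hB.card_eq] at hrel
    rw [Finset.card_insert_of_notMem h.not_interior]
    omega

theorem isSaturated (hP : IsAnchored P u v) (hB : IsSaturated P u v B)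
    (h : IsCovering P B u v p q e) : IsSaturated P u v (B ∪ {p, q}) where
  subset := Finset.union_subset hB.subset h.pair_subset
  left_mem := Finset.mem_union_left _ hB.left_mem
  right_mem := Finset.mem_union_left _ hB.right_mem
  card_eq := by
    rw [h.interiorPoints_eq hP hB, h.card_union_pair hP hB, ← hB.card_eq,
      Finset.card_insert_of_notMem h.not_interior]
    omega

theorem left_notMem_interiorPoints (hP : IsAnchored P u v) (hB : IsSaturated P u v B)
    (h : IsCovering P B u v p q e) : p ∉ interiorPoints (B ∪ {p, q}) (B ∪ {p, q}) := by
  rw [h.interiorPoints_eq hP hB, Finset.mem_insert, not_or]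
  exact ⟨h.left_ne hP hB,
    fun hp => h.left_notMem hP hB (NCConfig.mem_interiorPoints.1 hp).1⟩

theorem right_notMem_interiorPoints (hP : IsAnchored P u v) (hB : IsSaturated P u v B)
    (h : IsCovering P B u v p q e) : q ∉ interiorPoints (B ∪ {p, q}) (B ∪ {p, q}) := by
  rw [h.interiorPoints_eq hP hB, Finset.mem_insert, not_or]
  exact ⟨h.right_ne hP hB,
    fun hq => h.right_notMem hP hB (NCConfig.mem_interiorPoints.1 hq).1⟩

theorem notMem_interior (hP : IsAnchored P u v) (hB : IsSaturated P u v B)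
    (h : IsCovering P B u v p q e) (hz : z ∈ P) {i : ℂ} (hi : i ∈ ({z, p, q} : Finset ℂ))
    (hiB : i ∉ B) : i ∉ interior (convexHull ℝ ((B ∪ {z, p, q} : Finset ℂ) : Set ℂ)) := by
  intro hint
  have hie : i ≠ e := fun hie => hiB (hie ▸ h.vertex_mem)
  exact hB.not_two_interior hP (Finset.insert_subset hz h.pair_subset) Finset.card_le_three
    hie (fun h' => hiB (NCConfig.mem_interiorPoints.1 h').1)
    h.not_interior (NCConfig.mem_interiorPoints.2 ⟨Finset.mem_union_right _ hi, hint⟩)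
    (h.mem_interiorPoints hB (by simp) (by simp))

theorem pos_of_above (hP : IsAnchored P u v) (h : IsCovering P B u v p q e)
    (hz : z ∈ chartPoints P u v) (ha : 0 ≤ orient p q z) (hzp : z ≠ p) (hzq : z ≠ q) :
    0 < orient p q z :=
  lt_of_le_of_ne ha
    (hP.orient_ne_zero h.left_mem h.right_mem hz h.ne hzp.symm hzq.symm).symm

theorem between_of_above (hP : IsAnchored P u v) (hB : IsSaturated P u v B)
    (h : IsCovering P B u v p q e) (hz : z ∈ chartPoints P u v) (ha : 0 < orient p q z) :
    absc u v p < absc u v z ∧ absc u v z < absc u v q := by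
  have hzp : z ≠ p := by rintro rfl; simp at ha
  have hzq : z ≠ q := by rintro rfl; simp at ha
  obtain ⟨hzP, hz0⟩ := mem_chartPoints.1 hz
  have hp0 := (mem_chartPoints.1 h.left_mem).2
  have hq0 := (mem_chartPoints.1 h.right_mem).2
  constructor
  · by_contra! hle
    have hlt := lt_of_le_of_ne hle (hP.absc_ne hz h.left_mem hzp)
    refine h.notMem_interior hP hB hzP (i := p) (by simp) (h.left_notMem hP hB)
      (mem_interior_of_below hz0 hq0 hp0 hlt h.lt ?_ (by simp) (by simp) (by simp [hB.right_mem]))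
    rwa [← orient_rotate, orient_swap_left, neg_lt_zero]
  · by_contra! hle
    have hlt := lt_of_le_of_ne hle (hP.absc_ne hz h.right_mem hzq).symm
    refine h.notMem_interior hP hB hzP (i := q) (by simp) (h.right_notMem hP hB)
      (mem_interior_of_below hp0 hz0 hq0 h.lt hlt ?_ (by simp) (by simp) (by simp [hB.right_mem]))
    rwa [orient_swap_right, neg_lt_zero]

theorem le_of_above (hP : IsAnchored P u v) (hB : IsSaturated P u v B)
    (h : IsCovering P B u v p q e) (hz : z ∈ chartPoints P u v) (ha : 0 ≤ orient p q z) :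
    absc u v p ≤ absc u v z ∧ absc u v z ≤ absc u v q := by
  by_cases hzp : z = p
  · subst hzp
    exact ⟨le_rfl, h.lt.le⟩
  by_cases hzq : z = q
  · subst hzq
    exact ⟨h.lt.le, le_rfl⟩
  exact (h.between_of_above hP hB hz (h.pos_of_above hP hz ha hzp hzq)).imp le_of_lt le_of_lt

theorem mem_of_below (hP : IsAnchored P u v) (hB : IsSaturated P u v B)
    (h : IsCovering P B u v p q e) (hz : z ∈ chartPoints P u v) (hb : orient p q z < 0)
    (hpz : absc u v p < absc u v z) (hzq : absc u v z < absc u v q) : z ∈ B := by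
  by_contra hzB
  obtain ⟨hzP, hz0⟩ := mem_chartPoints.1 hz
  exact h.notMem_interior hP hB hzP (by simp) hzB
    (mem_interior_of_below (mem_chartPoints.1 h.left_mem).2 (mem_chartPoints.1 h.right_mem).2
      hz0 hpz hzq hb (by simp) (by simp) (by simp [hB.right_mem]))

theorem below_of_mem (hP : IsAnchored P u v) (hB : IsSaturated P u v B)
    (h : IsCovering P B u v p q e) (hzB : z ∈ B) (hz : z ∈ chartPoints P u v) :
    orient p q z < 0 := by
  have hzp : z ≠ p := fun h' => h.left_notMem hP hB (h' ▸ hzB)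
  have hzq : z ≠ q := fun h' => h.right_notMem hP hB (h' ▸ hzB)
  refine lt_of_le_of_ne (not_lt.1 fun ha => ?_)
    (hP.orient_ne_zero h.left_mem h.right_mem hz h.ne hzp.symm hzq.symm)
  have hze : z ≠ e := fun hze => ha.not_gt (hze ▸ h.covers.below)
  have hz0 := (mem_chartPoints.1 hz).2
  have hp0 := (mem_chartPoints.1 h.left_mem).2
  have hq0 := (mem_chartPoints.1 h.right_mem).2
  have he0 := (mem_chartPoints.1 h.mem).2
  rcases lt_or_gt_of_ne (hP.absc_ne hz h.mem hze) with hlt | hlt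
  · exact hB.not_covers hP hz (mem_chartPoints.1 h.right_mem).1 (Or.inl hzB) h.vertex_mem
      h.not_interior h.mem ⟨hq0, hlt, h.covers.lt_right,
        below_of_ends_above hp0 hq0 hz0 hq0 he0 h.lt hlt h.covers.lt_right ha.le (by simp)
          h.covers.below⟩
  · exact hB.not_covers hP h.left_mem (mem_chartPoints.1 hz).1 (Or.inr hzB) h.vertex_mem
      h.not_interior h.mem ⟨hz0, h.covers.lt_left, hlt,
        below_of_ends_above hp0 hq0 hp0 hz0 he0 h.lt h.covers.lt_left hlt (by simp) ha.le
          h.covers.below⟩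

theorem eq_or_eq_of_above (hP : IsAnchored P u v) (hB : IsSaturated P u v B)
    (h : IsCovering P B u v p q e) (hz : z ∈ chartPoints P u v) (ha : 0 ≤ orient p q z)
    (hzB : z ∈ B ∪ {p, q}) : z = p ∨ z = q := by
  rcases Finset.mem_union.1 hzB with hzB | hzpq
  · exact absurd (h.below_of_mem hP hB hzB hz) ha.not_gt
  · simpa using hzpq

end IsCovering

theorem mem_of_mem_union_of_below (hzB : z ∈ B ∪ {p, q}) (hb : orient p q z < 0) : z ∈ B := by
  refine (Finset.mem_union.1 hzB).resolve_right fun hzpq => ?_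
  rcases Finset.mem_insert.1 hzpq with rfl | hzq
  · simp at hb
  · simp [Finset.mem_singleton.1 hzq] at hb

end Saturated

/-! ### Chains of pinned parts -/

/-- The points of `X` weakly to the left of the directed line through the pair `k`. -/
def upper (X : Finset ℂ) (k : ℂ × ℂ) : Finset ℂ := X.filter fun z => 0 ≤ orient k.1 k.2 z

/-- The points of `X` strictly to the right of the directed line through the pair `k`. -/
def lower (X : Finset ℂ) (k : ℂ × ℂ) : Finset ℂ := X.filter fun z => orient k.1 k.2 z < 0

theorem mem_upper {X : Finset ℂ} {k : ℂ × ℂ} {z : ℂ} :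
    z ∈ upper X k ↔ z ∈ X ∧ 0 ≤ orient k.1 k.2 z := by simp only [upper, Finset.mem_filter]

theorem mem_lower {X : Finset ℂ} {k : ℂ × ℂ} {z : ℂ} :
    z ∈ lower X k ↔ z ∈ X ∧ orient k.1 k.2 z < 0 := by simp only [lower, Finset.mem_filter]

theorem lower_subset (X : Finset ℂ) (k : ℂ × ℂ) : lower X k ⊆ X := Finset.filter_subset _ _

theorem upper_subset (X : Finset ℂ) (k : ℂ × ℂ) : upper X k ⊆ X := Finset.filter_subset _ _

theorem upper_union_lower (X : Finset ℂ) (k : ℂ × ℂ) : upper X k ∪ lower X k = X := by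
  ext z
  rw [Finset.mem_union, mem_upper, mem_lower, ← and_or_left]
  exact and_iff_left (le_or_gt _ _)

theorem disjoint_lower_upper (X : Finset ℂ) (k : ℂ × ℂ) : Disjoint (lower X k) (upper X k) :=
  Finset.disjoint_left.2 fun _ hl hu => (mem_lower.1 hl).2.not_ge (mem_upper.1 hu).2

theorem lower_union_upper (X Z : Finset ℂ) (k : ℂ × ℂ) :
    lower (X ∪ upper Z k) k = lower X k := by
  ext z
  simp only [mem_lower, Finset.mem_union, mem_upper, and_congr_left_iff, or_iff_left_iff_imp]
  exact fun hb ha => absurd ha.2 hb.not_ge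

theorem Pinned.trace {Y : Finset ℂ} {π : Finset (Finset ℂ)} {k : ℂ × ℂ} (h : Pinned π k)
    (hfst : k.1 ∈ Y) (hsnd : k.2 ∈ Y) : Pinned (trace π Y) k := by
  obtain ⟨E, hE, hfE, hsE, hleft⟩ := h
  have hf := Finset.mem_inter.2 ⟨hfE, hfst⟩
  exact ⟨E ∩ Y, mem_trace.2 ⟨⟨k.1, hf⟩, E, hE, rfl⟩, hf, Finset.mem_inter.2 ⟨hsE, hsnd⟩,
    fun z hz => hleft z (Finset.mem_of_mem_inter_left hz)⟩

theorem trace_mem_pinnedFamilies {X Y : Finset ℂ} {π : Finset (Finset ℂ)} (hπ : IsNCFamily X π)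
    (hYX : Y ⊆ X) {K : List (ℂ × ℂ)} (hK : ∀ k ∈ K, Pinned π k)
    (hKY : ∀ k ∈ K, k.1 ∈ Y ∧ k.2 ∈ Y) : trace π Y ∈ pinnedFamilies Y K :=
  mem_pinnedFamilies.2 ⟨hπ.trace hYX, fun k hk => (hK k hk).trace (hKY k hk).1 (hKY k hk).2⟩

/-- The part of `X` above the pair `k` hangs off the vertex `k.1` of the saturated set `B`. -/
structure IsLink (P B : Finset ℂ) (u v : ℂ) (k : ℂ × ℂ) (X : Finset ℂ) : Prop where
  fst_mem : k.1 ∈ X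
  fst_mem_saturated : k.1 ∈ B
  snd_mem : k.2 ∈ X
  snd_mem_saturated : k.2 ∈ B
  lt : absc u v k.1 < absc u v k.2
  not_interior : k.1 ∉ interiorPoints B B
  between : ∀ z ∈ upper X k, absc u v k.1 ≤ absc u v z ∧ absc u v z ≤ absc u v k.2
  eq_of_mem : ∀ z ∈ upper X k, z ∈ B → z = k.1 ∨ z = k.2
  left : ∀ z ∈ lower X k, absc u v z < absc u v k.1 ∨ z ∈ B
  left_or_crosses : ∀ x ∈ lower X k, ∀ y ∈ upper X k, y ≠ k.1 → y ≠ k.2 →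
    absc u v x < absc u v k.1 ∨ Crosses k.1 k.2 x y

/-- Cutting `X` along the successive pairs of the list, each time keeping the part below the pair,
detaches one link after the other. -/
def IsChain (P B : Finset ℂ) (u v : ℂ) : List (ℂ × ℂ) → Finset ℂ → Prop
  | [], X => X ⊆ chartPoints P u v ∧ ∃ x ∈ X, x ∈ B
  | k :: K, X => X ⊆ chartPoints P u v ∧ IsLink P B u v k X ∧ IsChain P B u v K (lower X k)

namespace IsChain

variable {P B B' X X' : Finset ℂ} {u v : ℂ} {K : List (ℂ × ℂ)}

theorem subset (h : IsChain P B u v K X) : X ⊆ chartPoints P u v := by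
  cases K with
  | nil => exact h.1
  | cons k K => exact h.1

theorem nonempty (h : IsChain P B u v K X) : X.Nonempty := by
  cases K with
  | nil => exact h.2.imp fun x hx => hx.1
  | cons k K => exact ⟨_, h.2.1.fst_mem⟩

theorem mem (h : IsChain P B u v K X) : ∀ k ∈ K, k.1 ∈ X ∧ k.2 ∈ X := by
  induction K generalizing X with
  | nil => simp
  | cons k K ih =>
    intro k' hk'
    rcases List.mem_cons.1 hk' with rfl | hk'
    · exact ⟨h.2.1.fst_mem, h.2.1.snd_mem⟩
    · exact (ih h.2.2 k' hk').imp (lower_subset _ _ ·) (lower_subset _ _ ·)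

theorem notMem_interiorPoints (h : IsChain P B u v K X) : ∀ k ∈ K, k.1 ∉ interiorPoints B B := by
  induction K generalizing X with
  | nil => simp
  | cons k K ih => exact List.forall_mem_cons.2 ⟨h.2.1.not_interior, ih h.2.2⟩

theorem mono (h : IsChain P B u v K X) (hX : X' ⊆ X) (hXB : ∀ z ∈ X, z ∈ B → z ∈ X')
    (hBB : B ⊆ B') (hB' : ∀ z ∈ X', z ∈ B' → z ∈ B)
    (hK : ∀ k ∈ K, k.1 ∉ interiorPoints B' B') : IsChain P B' u v K X' := by
  induction K generalizing X X' with
  | nil =>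
    obtain ⟨hsub, x, hx, hxB⟩ := h
    exact ⟨hX.trans hsub, x, hXB x hx hxB, hBB hxB⟩
  | cons k K ih =>
    obtain ⟨hsub, hlink, hchain⟩ := h
    rw [List.forall_mem_cons] at hK
    have hl : lower X' k ⊆ lower X k := Finset.filter_subset_filter _ hX
    have hu : upper X' k ⊆ upper X k := Finset.filter_subset_filter _ hX
    refine ⟨hX.trans hsub, ?_, ih hchain hl (fun z hz hzB => ?_)
      (fun z hz => hB' z (lower_subset _ _ hz)) hK.2⟩
    · exact
        { fst_mem := hXB _ hlink.fst_mem hlink.fst_mem_saturated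
          fst_mem_saturated := hBB hlink.fst_mem_saturated
          snd_mem := hXB _ hlink.snd_mem hlink.snd_mem_saturated
          snd_mem_saturated := hBB hlink.snd_mem_saturated
          lt := hlink.lt
          not_interior := hK.1
          between := fun z hz => hlink.between z (hu hz)
          eq_of_mem := fun z hz hzB =>
            hlink.eq_of_mem z (hu hz) (hB' z (upper_subset _ _ hz) hzB)
          left := fun z hz => (hlink.left z (hl hz)).imp_right fun h => hBB h
          left_or_crosses := fun x hx y hy => hlink.left_or_crosses x (hl hx) y (hu hy) }
    · rw [mem_lower] at hz ⊢
      exact ⟨hXB z hz.1 hzB, hz.2⟩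

end IsChain

/-! ### Gluing a pinned part to a chain -/

/-- A chain `X` and a part `Z` pinned at `k`, which meet at the vertex `e` of `B`: roughly, `X` lies
to the left of `e` and `Z` to the right of it. This is the invariant of the recursion in which `X`
swallows the part of `Z` above a connection. -/
structure IsGlue (P B : Finset ℂ) (u v : ℂ) (X Z : Finset ℂ) (K : List (ℂ × ℂ)) (k : ℂ × ℂ)
    (e : ℂ) : Prop where
  chain : IsChain P B u v K X
  subset : ∀ z ∈ Z, z ∈ chartPoints P u v ∨ z = v
  disj : Disjoint X Z
  fst_chart : k.1 ∈ chartPoints P u v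
  fst_mem : k.1 ∈ Z
  fst_mem_saturated : k.1 ∈ B
  snd_mem : k.2 ∈ Z
  snd_mem_saturated : k.2 ∈ B
  ne : k.1 ≠ k.2
  nonneg : ∀ z ∈ Z, 0 ≤ orient k.1 k.2 z
  eq_of_mem : ∀ z ∈ Z, z ∈ B → z = k.1 ∨ z = k.2
  vertex_chart : e ∈ chartPoints P u v
  vertex_mem : e ∈ B
  not_interior : e ∉ interiorPoints B B
  vertex_ne : ∀ k' ∈ K, k'.1 ≠ e
  left : ∀ z ∈ X, absc u v z ≤ absc u v e ∨ z ∈ B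
  right : ∀ z ∈ Z, z = k.1 ∨ z = k.2 ∨ absc u v e < absc u v z
  fst_le : absc u v k.1 ≤ absc u v e
  above : ∀ z ∈ Z, z ≠ k.1 → z ≠ k.2 → 0 ≤ orient k.1 z e
  sep : ∀ π ∈ pinnedFamilies X K, ∀ E ∈ π,
    Disjoint (convexHull ℝ (E : Set ℂ)) (convexHull ℝ (Z : Set ℂ))

theorem IsCovering.crosses_of_right_mem {P B : Finset ℂ} {u v p q e x y : ℂ}
    (hP : IsAnchored P u v) (hB : IsSaturated P u v B) (h : IsCovering P B u v p q e)
    (hx : x ∈ chartPoints P u v) (hxB : x ∈ B) (hqx : absc u v q < absc u v x)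
    (hbx : orient p q x < 0) (hy : y ∈ chartPoints P u v) (hay : 0 < orient p q y) :
    Crosses p q x y := by
  obtain ⟨hpy, hyq⟩ := h.between_of_above hP hB hy hay
  have hx0 := (mem_chartPoints.1 hx).2
  refine crosses_of_right (mem_chartPoints.1 h.left_mem).2 (mem_chartPoints.1 h.right_mem).2 hx0
    (mem_chartPoints.1 hy).2 hpy hyq hqx hbx hay ?_
  by_contra! hneg
  have hxq : x ≠ q := by rintro rfl; exact hqx.false
  have hyq' : y ≠ q := by rintro rfl; exact hyq.false
  have hyx : y ≠ x := by rintro rfl; exact lt_asymm hyq hqx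
  exact (h.isSaturated hP hB).not_covers hP hy (mem_chartPoints.1 hx).1
    (Or.inr (Finset.mem_union_left _ hxB)) (by simp) (h.right_notMem_interiorPoints hP hB)
    h.right_mem
    ⟨hx0, hyq, hqx, lt_of_le_of_ne hneg (hP.orient_ne_zero hy hx h.right_mem hyx hyq' hxq)⟩

namespace IsGlue

variable {P B : Finset ℂ} {u v : ℂ} {X Z : Finset ℂ} {K : List (ℂ × ℂ)} {k : ℂ × ℂ}
  {e p q x y z : ℂ}

theorem mem_chartPoints (hG : IsGlue P B u v X Z K k e) (hB : IsSaturated P u v B)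
    (hz : z ∈ Z) (hzf : z ≠ k.1) (hzs : z ≠ k.2) : z ∈ chartPoints P u v := by
  rcases hG.subset z hz with h | rfl
  · exact h
  · exact ((hG.eq_of_mem z hz hB.right_mem).elim hzf hzs).elim

theorem lt_of_mem (hG : IsGlue P B u v X Z K k e) (hz : z ∈ Z) (hzf : z ≠ k.1)
    (hzs : z ≠ k.2) : absc u v e < absc u v z :=
  ((hG.right z hz).resolve_left hzf).resolve_left hzs

theorem isCovering (hG : IsGlue P B u v X Z K k e) (hp : p ∈ X) (hq : q ∈ Z)
    (h : Covers u v p q e) : IsCovering P B u v p q e where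
  left_mem := hG.chain.subset hp
  right_mem := by
    rcases hG.subset q hq with hq | rfl
    · exact hq
    · simpa using h.pos
  mem := hG.vertex_chart
  vertex_mem := hG.vertex_mem
  not_interior := hG.not_interior
  covers := h

theorem fst_below (hP : IsAnchored P u v) (hB : IsSaturated P u v B)
    (hG : IsGlue P B u v X Z K k e) (h : IsCovering P B u v p q e) : orient p q k.1 < 0 :=
  h.below_of_mem hP hB hG.fst_mem_saturated hG.fst_chart

theorem snd_below (hP : IsAnchored P u v) (hB : IsSaturated P u v B)
    (hG : IsGlue P B u v X Z K k e) (h : IsCovering P B u v p q e) : orient p q k.2 < 0 := by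
  rcases hG.subset _ hG.snd_mem with hk | hk
  · exact h.below_of_mem hP hB hG.snd_mem_saturated hk
  · exact hk ▸ h.below_anchor

theorem ne_of_above (hP : IsAnchored P u v) (hB : IsSaturated P u v B)
    (hG : IsGlue P B u v X Z K k e) (h : IsCovering P B u v p q e) (ha : 0 ≤ orient p q z) :
    z ≠ k.1 ∧ z ≠ k.2 := by
  constructor <;> rintro rfl
  · exact (hG.fst_below hP hB h).not_ge ha
  · exact (hG.snd_below hP hB h).not_ge ha

theorem mem_chartPoints_of_above (hP : IsAnchored P u v) (hB : IsSaturated P u v B)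
    (hG : IsGlue P B u v X Z K k e) (h : IsCovering P B u v p q e)
    (hz : z ∈ X ∪ upper Z (p, q)) : z ∈ chartPoints P u v := by
  rcases Finset.mem_union.1 hz with hz | hz
  · exact hG.chain.subset hz
  · obtain ⟨hzZ, ha⟩ := mem_upper.1 hz
    obtain ⟨hzf, hzs⟩ := hG.ne_of_above hP hB h ha
    exact hG.mem_chartPoints hB hzZ hzf hzs

theorem left_or_crosses (hP : IsAnchored P u v) (hB : IsSaturated P u v B)
    (hG : IsGlue P B u v X Z K k e) (h : IsCovering P B u v p q e) (hx : x ∈ X)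
    (hbx : orient p q x < 0) (hy : y ∈ chartPoints P u v) (hay : 0 < orient p q y) :
    absc u v x < absc u v p ∨ Crosses p q x y := by
  have hx' := hG.chain.subset hx
  have hxp : x ≠ p := by rintro rfl; simp at hbx
  have hxq : x ≠ q := by rintro rfl; simp at hbx
  have hxy : x ≠ y := by rintro rfl; exact lt_asymm hbx hay
  rcases lt_or_gt_of_ne (hP.absc_ne hx' h.left_mem hxp) with hlt | hpx
  · exact Or.inl hlt
  right
  rcases lt_or_gt_of_ne (hP.absc_ne hx' h.right_mem hxq) with hlt | hqx
  · obtain ⟨hpy, hyq⟩ := h.between_of_above hP hB hy hay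
    exact crosses_of_between (NCConfig.mem_chartPoints.1 h.left_mem).2
      (NCConfig.mem_chartPoints.1 h.right_mem).2 (NCConfig.mem_chartPoints.1 hx').2
      (NCConfig.mem_chartPoints.1 hy).2 hpx hlt hpy hyq (hP.absc_ne hx' hy hxy) hbx hay
  · have hxB : x ∈ B := (hG.left x hx).resolve_left (h.covers.lt_right.trans hqx).not_ge
    exact h.crosses_of_right_mem hP hB hx' hxB hqx hbx hy hay

theorem crosses (hP : IsAnchored P u v) (hB : IsSaturated P u v B)
    (hG : IsGlue P B u v X Z K k e) (h : IsCovering P B u v p q e) (hx : x ∈ X)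
    (hbx : orient p q x < 0) (hy : y ∈ Z) (hay : 0 < orient p q y) : Crosses p q x y := by
  obtain ⟨hyf, hys⟩ := hG.ne_of_above hP hB h hay.le
  have hy' := hG.mem_chartPoints hB hy hyf hys
  have hey := hG.lt_of_mem hy hyf hys
  refine (hG.left_or_crosses hP hB h hx hbx hy' hay).elim (fun hxp => ?_) id
  obtain ⟨hpy, hyq⟩ := h.between_of_above hP hB hy' hay
  obtain ⟨hxP, hx0⟩ := NCConfig.mem_chartPoints.1 (hG.chain.subset hx)
  obtain ⟨hyP, hy0⟩ := NCConfig.mem_chartPoints.1 hy'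
  obtain ⟨hpP, hp0⟩ := NCConfig.mem_chartPoints.1 h.left_mem
  have hq0 := (NCConfig.mem_chartPoints.1 h.right_mem).2
  have he0 := (NCConfig.mem_chartPoints.1 h.mem).2
  have hxp' : x ≠ p := by rintro rfl; exact hxp.false
  have hyp : y ≠ p := by rintro rfl; exact hpy.false
  have hxy : x ≠ y := by rintro rfl; exact lt_asymm hbx hay
  rcases lt_or_gt_of_ne (hP.orient_ne_zero (hG.chain.subset hx) hy' h.left_mem hxy hxp' hyp)
    with hbp | hap
  swap
  · exact crosses_of_left hp0 hq0 hx0 hy0 hxp hpy hyq hbx hay hap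
  -- Otherwise the segment `xy` passes above both `p` and `e`, which adds too many internal points.
  have hbe := below_of_line_above hp0 hq0 hx0 hy0 he0 hxp h.covers.lt_left hey h.lt hbp hay
    h.covers.below
  have hpB := h.left_notMem hP hB
  refine (hB.not_two_interior hP (T := {x, y, p}) ?_ Finset.card_le_three (h.left_ne hP hB)
    (fun hp => hpB (mem_interiorPoints.1 hp).1) h.not_interior
    (mem_interiorPoints.2 ⟨by simp, mem_interior_of_below hx0 hy0 hp0 hxp hpy hbp
      (by simp) (by simp) (by simp [hB.right_mem])⟩)
    (mem_interiorPoints.2 ⟨by simp [h.vertex_mem], mem_interior_of_below hx0 hy0 he0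
      (hxp.trans h.covers.lt_left) hey hbe (by simp) (by simp) (by simp [hB.right_mem])⟩)).elim
  simp [Finset.insert_subset_iff, hxP, hyP, hpP]

theorem isLink_absorb (hP : IsAnchored P u v) (hB : IsSaturated P u v B)
    (hG : IsGlue P B u v X Z K k e) (h : IsCovering P B u v p q e) (hp : p ∈ X) (hq : q ∈ Z) :
    IsLink P (B ∪ {p, q}) u v (p, q) (X ∪ upper Z (p, q)) where
  fst_mem := Finset.mem_union_left _ hp
  fst_mem_saturated := by simp
  snd_mem := Finset.mem_union_right _ (mem_upper.2 ⟨hq, by simp⟩)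
  snd_mem_saturated := by simp
  lt := h.lt
  not_interior := h.left_notMem_interiorPoints hP hB
  between := fun z hz => by
    obtain ⟨hz, ha⟩ := mem_upper.1 hz
    exact h.le_of_above hP hB (hG.mem_chartPoints_of_above hP hB h hz) ha
  eq_of_mem := fun z hz => by
    obtain ⟨hz, ha⟩ := mem_upper.1 hz
    exact h.eq_or_eq_of_above hP hB (hG.mem_chartPoints_of_above hP hB h hz) ha
  left := fun z hz => by
    rw [lower_union_upper] at hz
    obtain ⟨hzX, hb⟩ := mem_lower.1 hz
    have hz' := hG.chain.subset hzX
    have hzp : z ≠ p := by rintro rfl; simp at hb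
    rcases hG.left z hzX with hze | hzB
    · exact (lt_or_gt_of_ne (hP.absc_ne hz' h.left_mem hzp)).imp_right fun hpz =>
        Finset.mem_union_left _ (h.mem_of_below hP hB hz' hb hpz (hze.trans_lt h.covers.lt_right))
    · exact Or.inr (Finset.mem_union_left _ hzB)
  left_or_crosses := fun x hx y hy hyp hyq => by
    rw [lower_union_upper] at hx
    obtain ⟨hx, hbx⟩ := mem_lower.1 hx
    obtain ⟨hy, hay⟩ := mem_upper.1 hy
    have hy' := hG.mem_chartPoints_of_above hP hB h hy
    exact hG.left_or_crosses hP hB h hx hbx hy' (h.pos_of_above hP hy' hay hyp hyq)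

theorem isChain_absorb (hP : IsAnchored P u v) (hB : IsSaturated P u v B)
    (hG : IsGlue P B u v X Z K k e) (h : IsCovering P B u v p q e) (hp : p ∈ X) (hq : q ∈ Z) :
    IsChain P (B ∪ {p, q}) u v ((p, q) :: K) (X ∪ upper Z (p, q)) := by
  refine ⟨fun z hz => hG.mem_chartPoints_of_above hP hB h hz, hG.isLink_absorb hP hB h hp hq, ?_⟩
  rw [lower_union_upper]
  refine hG.chain.mono (lower_subset _ _)
    (fun z hz hzB => mem_lower.2 ⟨hz, h.below_of_mem hP hB hzB (hG.chain.subset hz)⟩)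
    Finset.subset_union_left
    (fun z hz hzB => mem_of_mem_union_of_below hzB (mem_lower.1 hz).2) fun k' hk' => ?_
  rw [h.interiorPoints_eq hP hB, Finset.mem_insert, not_or]
  exact ⟨hG.vertex_ne k' hk', hG.chain.notMem_interiorPoints k' hk'⟩

theorem lt_of_mem_lower (hP : IsAnchored P u v) (hB : IsSaturated P u v B)
    (hG : IsGlue P B u v X Z K k e) (h : IsCovering P B u v p q e) (hz : z ∈ lower Z (p, q))
    (hzf : z ≠ k.1) (hzs : z ≠ k.2) : absc u v q < absc u v z := by
  obtain ⟨hzZ, hb⟩ := mem_lower.1 hz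
  have hz' := hG.mem_chartPoints hB hzZ hzf hzs
  have hzq : z ≠ q := by rintro rfl; simp at hb
  refine lt_of_le_of_ne (not_lt.1 fun hlt => ?_) (hP.absc_ne hz' h.right_mem hzq).symm
  have hzB := h.mem_of_below hP hB hz' hb (h.covers.lt_left.trans (hG.lt_of_mem hzZ hzf hzs)) hlt
  exact (hG.eq_of_mem z hzZ hzB).elim hzf hzs

theorem disjoint_convexHull_absorb (hP : IsAnchored P u v) (hB : IsSaturated P u v B)
    (hG : IsGlue P B u v X Z K k e) (h : IsCovering P B u v p q e)
    {π : Finset (Finset ℂ)} (hπ : π ∈ pinnedFamilies (X ∪ upper Z (p, q)) ((p, q) :: K))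
    {E : Finset ℂ} (hE : E ∈ π) :
    Disjoint (convexHull ℝ (E : Set ℂ)) (convexHull ℝ (lower Z (p, q) : Set ℂ)) := by
  rw [mem_pinnedFamilies, List.forall_mem_cons] at hπ
  obtain ⟨hπ, ⟨D, hD, hpD, hqD, hleft⟩, hK⟩ := hπ
  by_cases hEX : E ⊆ X
  · have htr := trace_mem_pinnedFamilies hπ Finset.subset_union_left hK hG.chain.mem
    have hEt : E ∈ trace π X :=
      mem_trace.2 ⟨hπ.nonempty E hE, E, hE, Finset.inter_eq_left.2 hEX⟩
    exact (hG.sep _ htr E hEt).mono_right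
      (convexHull_mono (Finset.coe_subset.2 (lower_subset _ _)))
  by_cases hEu : ∀ z ∈ E, 0 ≤ orient p q z
  · exact disjoint_convexHull_of_orient (p := p) (q := q) hEu fun z hz => (mem_lower.1 hz).2
  exfalso
  push Not at hEu
  obtain ⟨x, hxE, hbx⟩ := hEu
  obtain ⟨y, hyE, hyX⟩ := Finset.not_subset.1 hEX
  have hDE : D ≠ E := by
    rintro rfl
    exact (hleft x hxE).not_gt hbx
  have hxX : x ∈ X := (Finset.mem_union.1 (hπ.subset E hE hxE)).resolve_right
    fun hx => (mem_upper.1 hx).2.not_gt hbx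
  have hyU := hπ.subset E hE hyE
  obtain ⟨hyZ, hay⟩ := mem_upper.1 ((Finset.mem_union.1 hyU).resolve_left hyX)
  have hyq : y ≠ q := fun hyq => hDE (hπ.eq_of_mem hD hE hqD (hyq ▸ hyE))
  have hyp : y ≠ p := fun hyp => hDE (hπ.eq_of_mem hD hE hpD (hyp ▸ hyE))
  exact hπ.not_crosses hD hE hDE hpD hqD hxE hyE <| hG.crosses hP hB h hxX hbx hyZ <|
    h.pos_of_above hP (hG.mem_chartPoints_of_above hP hB h hyU) hay hyp hyq

theorem above_of_mem_lower (hP : IsAnchored P u v) (hB : IsSaturated P u v B)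
    (hG : IsGlue P B u v X Z K k e) (h : IsCovering P B u v p q e) (hz : z ∈ lower Z (p, q))
    (hzf : z ≠ k.1) (hzs : z ≠ k.2) : 0 < orient k.1 z q := by
  obtain ⟨hzZ, hb⟩ := mem_lower.1 hz
  exact above_of_line_below (NCConfig.mem_chartPoints.1 h.left_mem).2
    (NCConfig.mem_chartPoints.1 h.right_mem).2 (NCConfig.mem_chartPoints.1 hG.fst_chart).2
    (NCConfig.mem_chartPoints.1 (hG.mem_chartPoints hB hzZ hzf hzs)).2
    (NCConfig.mem_chartPoints.1 h.mem).2 h.covers.lt_left h.covers.lt_right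
    (hG.lt_of_mem_lower hP hB h hz hzf hzs) hG.fst_le (hG.above z hzZ hzf hzs)
    h.covers.below hb

theorem isGlue_absorb (hP : IsAnchored P u v) (hB : IsSaturated P u v B)
    (hG : IsGlue P B u v X Z K k e) (hp : p ∈ X) (hq : q ∈ Z) (hc : Covers u v p q e) :
    IsGlue P (B ∪ {p, q}) u v (X ∪ upper Z (p, q)) (lower Z (p, q)) ((p, q) :: K) k q := by
  have h := hG.isCovering hp hq hc
  exact
    { chain := hG.isChain_absorb hP hB h hp hq
      subset := fun z hz => hG.subset z (lower_subset _ _ hz)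
      disj := Finset.disjoint_union_left.2
        ⟨hG.disj.mono_right (lower_subset _ _), (disjoint_lower_upper _ _).symm⟩
      fst_chart := hG.fst_chart
      fst_mem := mem_lower.2 ⟨hG.fst_mem, hG.fst_below hP hB h⟩
      fst_mem_saturated := Finset.mem_union_left _ hG.fst_mem_saturated
      snd_mem := mem_lower.2 ⟨hG.snd_mem, hG.snd_below hP hB h⟩
      snd_mem_saturated := Finset.mem_union_left _ hG.snd_mem_saturated
      ne := hG.ne
      nonneg := fun z hz => hG.nonneg z (lower_subset _ _ hz)
      eq_of_mem := fun z hz hzB =>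
        hG.eq_of_mem z (lower_subset _ _ hz) (mem_of_mem_union_of_below hzB (mem_lower.1 hz).2)
      vertex_chart := h.right_mem
      vertex_mem := by simp
      not_interior := h.right_notMem_interiorPoints hP hB
      vertex_ne := List.forall_mem_cons.2 ⟨h.ne, fun k' hk' hkq =>
        Finset.disjoint_left.1 hG.disj (hkq ▸ (hG.chain.mem k' hk').1) hq⟩
      left := fun z hz => by
        rcases Finset.mem_union.1 hz with hzX | hzU
        · exact (hG.left z hzX).imp (fun hze => hze.trans h.covers.lt_right.le)
            fun hzB => Finset.mem_union_left _ hzB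
        · exact Or.inl (h.le_of_above hP hB (hG.mem_chartPoints_of_above hP hB h hz)
            (mem_upper.1 hzU).2).2
      right := fun z hz => or_iff_not_imp_left.2 fun hzf => or_iff_not_imp_left.2 fun hzs =>
        hG.lt_of_mem_lower hP hB h hz hzf hzs
      fst_le := hG.fst_le.trans h.covers.lt_right.le
      above := fun z hz hzf hzs => (hG.above_of_mem_lower hP hB h hz hzf hzs).le
      sep := fun π hπ E hE => hG.disjoint_convexHull_absorb hP hB h hπ hE }

end IsGlue

/-! ### Splitting glued families at the lowest connection -/

/-- The points `x` and `y` lie in a common block of `π`. -/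
def Connects (π : Finset (Finset ℂ)) (x y : ℂ) : Prop := ∃ E ∈ π, x ∈ E ∧ y ∈ E

open Classical in
/-- The pinned noncrossing families of `X ∪ Z` in which all connections between `X` and `Z` cover
the point `e`. -/
def gluedFamilies (u v : ℂ) (X Z : Finset ℂ) (K : List (ℂ × ℂ)) (k : ℂ × ℂ) (e : ℂ) :
    Finset (Finset (Finset ℂ)) :=
  (pinnedFamilies (X ∪ Z) (k :: K)).filter fun π =>
    ∀ x ∈ X, ∀ y ∈ Z, Connects π x y → Covers u v x y e

/-- The glued families whose lowest connection between `X` and `Z` is the pair `x`. -/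
def splitFamilies (u v : ℂ) (X Z : Finset ℂ) (K : List (ℂ × ℂ)) (k x : ℂ × ℂ) :
    Finset (Finset (Finset ℂ)) :=
  gluedFamilies u v (X ∪ upper Z x) (lower Z x) (x :: K) k x.2

theorem mem_gluedFamilies {u v : ℂ} {X Z : Finset ℂ} {K : List (ℂ × ℂ)} {k : ℂ × ℂ} {e : ℂ}
    {π : Finset (Finset ℂ)} : π ∈ gluedFamilies u v X Z K k e ↔ IsNCFamily (X ∪ Z) π ∧
      (∀ k' ∈ k :: K, Pinned π k') ∧ ∀ x ∈ X, ∀ y ∈ Z, Connects π x y → Covers u v x y e := by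
  simp only [gluedFamilies, Finset.mem_filter, mem_pinnedFamilies, and_assoc]

theorem mem_splitFamilies {u v : ℂ} {X Z : Finset ℂ} {K : List (ℂ × ℂ)} {k : ℂ × ℂ} {p q : ℂ}
    {π : Finset (Finset ℂ)} : π ∈ splitFamilies u v X Z K k (p, q) ↔ IsNCFamily (X ∪ Z) π ∧
      (∀ k' ∈ k :: K, Pinned π k') ∧ Pinned π (p, q) ∧
        ∀ x ∈ X ∪ upper Z (p, q), ∀ y ∈ lower Z (p, q), Connects π x y → Covers u v x y q := by
  rw [splitFamilies, mem_gluedFamilies, Finset.union_assoc, upper_union_lower]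
  simp only [List.forall_mem_cons]
  tauto

namespace IsGlue

variable {P B : Finset ℂ} {u v : ℂ} {X Z : Finset ℂ} {K : List (ℂ × ℂ)} {k : ℂ × ℂ}
  {e p q p' q' x y : ℂ} {π : Finset (Finset ℂ)} {D E : Finset ℂ}

theorem lt_vertex_of_above (hP : IsAnchored P u v) (hB : IsSaturated P u v B)
    (hG : IsGlue P B u v X Z K k e) (h : IsCovering P B u v p q e) (hx : x ∈ X)
    (ha : 0 ≤ orient p q x) : absc u v x < absc u v e := by
  have hx' := hG.chain.subset hx
  have hxB : x ∉ B := fun hxB => (h.below_of_mem hP hB hxB hx').not_ge ha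
  have hxe : x ≠ e := fun hxe => hxB (hxe ▸ h.vertex_mem)
  exact lt_of_le_of_ne ((hG.left x hx).resolve_right hxB) (hP.absc_ne hx' h.mem hxe)

theorem covers_of_above (hP : IsAnchored P u v) (hB : IsSaturated P u v B)
    (hG : IsGlue P B u v X Z K k e) (h : IsCovering P B u v p q e) (hx : x ∈ X) (hy : y ∈ Z)
    (hax : 0 ≤ orient p q x) (hay : 0 ≤ orient p q y) : Covers u v x y e := by
  obtain ⟨hyf, hys⟩ := hG.ne_of_above hP hB h hay
  have hy0 := (NCConfig.mem_chartPoints.1 (hG.mem_chartPoints hB hy hyf hys)).2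
  have hxe := hG.lt_vertex_of_above hP hB h hx hax
  have hey := hG.lt_of_mem hy hyf hys
  exact ⟨hy0, hxe, hey, below_of_ends_above (NCConfig.mem_chartPoints.1 h.left_mem).2
    (NCConfig.mem_chartPoints.1 h.right_mem).2
    (NCConfig.mem_chartPoints.1 (hG.chain.subset hx)).2 hy0
    (NCConfig.mem_chartPoints.1 h.mem).2 h.lt hxe hey hax hay h.covers.below⟩

theorem covers_of_covers_right (hP : IsAnchored P u v) (hB : IsSaturated P u v B)
    (hG : IsGlue P B u v X Z K k e) (h : IsCovering P B u v p q e) (hx : x ∈ X)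
    (hax : 0 ≤ orient p q x) (hc : Covers u v x y q) : Covers u v x y e := by
  have hxe := hG.lt_vertex_of_above hP hB h hx hax
  exact ⟨hc.pos, hxe, h.covers.lt_right.trans hc.lt_right,
    below_of_left_above (NCConfig.mem_chartPoints.1 h.left_mem).2
      (NCConfig.mem_chartPoints.1 h.right_mem).2
      (NCConfig.mem_chartPoints.1 (hG.chain.subset hx)).2 hc.pos
      (NCConfig.mem_chartPoints.1 h.mem).2 h.lt hxe h.covers.lt_right hc.lt_right hax hc.below
      h.covers.below⟩

theorem not_covers_right_of_below (hG : IsGlue P B u v X Z K k e)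
    (h : IsCovering P B u v p q e) (hx : x ∈ X) (hbx : orient p q x < 0)
    (hby : orient p q y < 0) : ¬ Covers u v x y q := fun hc =>
  lt_asymm hby <| above_of_left_below (NCConfig.mem_chartPoints.1 h.left_mem).2
    (NCConfig.mem_chartPoints.1 h.right_mem).2
    (NCConfig.mem_chartPoints.1 (hG.chain.subset hx)).2 hc.pos h.lt hc.lt_left hc.lt_right hbx
    hc.below

theorem splitFamilies_subset (hP : IsAnchored P u v) (hB : IsSaturated P u v B)
    (hG : IsGlue P B u v X Z K k e) (hp : p ∈ X) (hq : q ∈ Z) (hc : Covers u v p q e) :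
    splitFamilies u v X Z K k (p, q) ⊆ gluedFamilies u v X Z K k e := by
  intro σ hσ'
  have h := hG.isCovering hp hq hc
  obtain ⟨hσ, hpin, ⟨D, hD, hpD, hqD, hDa⟩, hcov⟩ := mem_splitFamilies.1 hσ'
  refine mem_gluedFamilies.2 ⟨hσ, hpin, fun x hx y hy hxy => ?_⟩
  have hcov' : orient p q y < 0 → Covers u v x y q := fun hby =>
    hcov x (Finset.mem_union_left _ hx) y (mem_lower.2 ⟨hy, hby⟩) hxy
  obtain ⟨E, hE, hxE, hyE⟩ := hxy
  rcases le_or_gt 0 (orient p q x) with hax | hbx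
  · rcases le_or_gt 0 (orient p q y) with hay | hby
    · exact hG.covers_of_above hP hB h hx hy hax hay
    · exact hG.covers_of_covers_right hP hB h hx hax (hcov' hby)
  exfalso
  have hDE : D ≠ E := by
    rintro rfl
    exact hbx.not_ge (hDa x hxE)
  rcases le_or_gt 0 (orient p q y) with hay | hby
  · have hyp : y ≠ p := by rintro rfl; exact hDE (hσ.eq_of_mem hD hE hpD hyE)
    have hyq : y ≠ q := by rintro rfl; exact hDE (hσ.eq_of_mem hD hE hqD hyE)
    have hy' := hG.mem_chartPoints_of_above hP hB h
      (Finset.mem_union_right _ (mem_upper.2 ⟨hy, hay⟩))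
    exact hσ.not_crosses hD hE hDE hpD hqD hxE hyE
      (hG.crosses hP hB h hx hbx hy (h.pos_of_above hP hy' hay hyp hyq))
  · exact hG.not_covers_right_of_below h hx hbx hby (hcov' hby)

theorem eq_of_mem_block (hP : IsAnchored P u v) (hG : IsGlue P B u v X Z K k e)
    (h : IsCovering P B u v p q e) (h' : IsCovering P B u v p' q' e)
    (hp : p ∈ X) (hq : q ∈ Z) (hp' : p' ∈ X) (hq' : q' ∈ Z)
    (hap : 0 ≤ orient p q p') (haq : 0 ≤ orient p q q')
    (hle : heightAbove v e p' q' ≤ heightAbove v e p q) : p' = p ∧ q' = q := by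
  have hXZ : ∀ {a b : ℂ}, a ∈ X → b ∈ Z → a ≠ b := fun ha hb => by
    rintro rfl
    exact Finset.disjoint_left.1 hG.disj ha hb
  have hp0 := (NCConfig.mem_chartPoints.1 h.left_mem).2
  have hq0 := (NCConfig.mem_chartPoints.1 h.right_mem).2
  have hp0' := (NCConfig.mem_chartPoints.1 h'.left_mem).2
  have hq0' := (NCConfig.mem_chartPoints.1 h'.right_mem).2
  have he0 := (NCConfig.mem_chartPoints.1 h.mem).2
  constructor <;> by_contra hne <;> refine hle.not_gt ?_
  · exact heightAbove_lt_of_left_above hp0 hq0 hp0' hq0' he0 h.lt h'.covers.lt_left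
      h'.covers.lt_right (h.pos_of_above hP h'.left_mem hap hne (hXZ hp' hq)) haq
  · exact heightAbove_lt_of_right_above hp0 hq0 hp0' hq0' he0 h.lt h'.covers.lt_left
      h'.covers.lt_right hap (h.pos_of_above hP h'.right_mem haq (hXZ hp hq').symm hne)

theorem heightAbove_lt_of_mem_splitFamilies (hP : IsAnchored P u v) (hB : IsSaturated P u v B)
    (hG : IsGlue P B u v X Z K k e) (h : IsCovering P B u v p q e)
    (h' : IsCovering P B u v p' q' e) (hp' : p' ∈ X) (hq' : q' ∈ Z)
    (hπ : π ∈ splitFamilies u v X Z K k (p, q)) (hD : D ∈ π) (hE : E ∈ π) (hDE : D ≠ E)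
    (hpD : p ∈ D) (hqD : q ∈ D) (hpE : p' ∈ E) (hqE : q' ∈ E) :
    heightAbove v e p q < heightAbove v e p' q' := by
  obtain ⟨hπ, -, -, hcov⟩ := mem_splitFamilies.1 hπ
  have hDE' : ∀ {a b : ℂ}, a ∈ D → b ∈ E → b ≠ a := fun ha hb => by
    rintro rfl
    exact hDE (hπ.eq_of_mem hD hE ha hb)
  have hc : orient p q q' < 0 → Covers u v p' q' q := fun hb =>
    hcov p' (Finset.mem_union_left _ hp') q' (mem_lower.2 ⟨hq', hb⟩) ⟨E, hE, hpE, hqE⟩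
  have hp0 := (NCConfig.mem_chartPoints.1 h.left_mem).2
  have hq0 := (NCConfig.mem_chartPoints.1 h.right_mem).2
  have hp0' := (NCConfig.mem_chartPoints.1 h'.left_mem).2
  have hq0' := (NCConfig.mem_chartPoints.1 h'.right_mem).2
  have he0 := (NCConfig.mem_chartPoints.1 h.mem).2
  rcases lt_or_ge (orient p q p') 0 with hbp | hap
  · rcases lt_or_ge (orient p q q') 0 with hbq | haq
    · exact absurd (hc hbq) (hG.not_covers_right_of_below h hp' hbp hbq)
    · exact absurd (hG.crosses hP hB h hp' hbp hq'
        (h.pos_of_above hP h'.right_mem haq (hDE' hpD hqE) (hDE' hqD hqE)))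
        (hπ.not_crosses hD hE hDE hpD hqD hpE hqE)
  · rcases lt_or_ge (orient p q q') 0 with hbq | haq
    · exact heightAbove_lt_of_right_below hp0 hq0 hp0' hq0' he0 h.lt h'.covers.lt_left
        h.covers.lt_right (hc hbq).lt_right hap (hc hbq).below
    · exact heightAbove_lt_of_left_above hp0 hq0 hp0' hq0' he0 h.lt h'.covers.lt_left
        h'.covers.lt_right
        (h.pos_of_above hP h'.left_mem hap (hDE' hpD hpE) (hDE' hqD hpE)) haq

theorem splitFamilies_unique (hP : IsAnchored P u v) (hB : IsSaturated P u v B)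
    (hG : IsGlue P B u v X Z K k e) (hp : p ∈ X) (hq : q ∈ Z) (hc : Covers u v p q e)
    (hp' : p' ∈ X) (hq' : q' ∈ Z) (hc' : Covers u v p' q' e)
    (hπ : π ∈ splitFamilies u v X Z K k (p, q)) (hπ' : π ∈ splitFamilies u v X Z K k (p', q'))
    (hle : heightAbove v e p' q' ≤ heightAbove v e p q) : p' = p ∧ q' = q := by
  have h := hG.isCovering hp hq hc
  have h' := hG.isCovering hp' hq' hc'
  obtain ⟨-, -, ⟨D, hD, hpD, hqD, hDa⟩, -⟩ := mem_splitFamilies.1 hπ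
  obtain ⟨-, -, ⟨E, hE, hpE, hqE, -⟩, -⟩ := mem_splitFamilies.1 hπ'
  by_cases hDE : D = E
  · subst hDE
    exact hG.eq_of_mem_block hP h h' hp hq hp' hq' (hDa p' hpE) (hDa q' hqE) hle
  · exact absurd hle (hG.heightAbove_lt_of_mem_splitFamilies hP hB h h' hp' hq' hπ hD hE hDE
      hpD hqD hpE hqE).not_ge

theorem pinned_of_lowest (hG : IsGlue P B u v X Z K k e) (h : IsCovering P B u v p q e)
    (hp : p ∈ X) (hq : q ∈ Z) (hπ : π ∈ gluedFamilies u v X Z K k e)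
    (hmin : ∀ x ∈ X, ∀ y ∈ Z, Connects π x y → heightAbove v e p q ≤ heightAbove v e x y)
    (hpq : Connects π p q) : Pinned π (p, q) := by
  obtain ⟨hπ, -, hcov⟩ := mem_gluedFamilies.1 hπ
  obtain ⟨D, hD, hpD, hqD⟩ := hpq
  have hp0 := (NCConfig.mem_chartPoints.1 h.left_mem).2
  have hq0 := (NCConfig.mem_chartPoints.1 h.right_mem).2
  have he0 := (NCConfig.mem_chartPoints.1 h.mem).2
  refine ⟨D, hD, hpD, hqD, fun z hzD => not_lt.1 fun hbz => ?_⟩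
  rcases Finset.mem_union.1 (hπ.subset D hD hzD) with hz | hz
  · have hzq : Connects π z q := ⟨D, hD, hzD, hqD⟩
    have hc := hcov z hz q hq hzq
    exact (hmin z hz q hq hzq).not_gt <| heightAbove_replace_left_lt hp0 hq0
      (NCConfig.mem_chartPoints.1 (hG.chain.subset hz)).2 he0 h.lt hc.lt_left hc.lt_right hbz
  · have hpz : Connects π p z := ⟨D, hD, hpD, hzD⟩
    have hc := hcov p hp z hz hpz
    exact (hmin p hp z hz hpz).not_gt <|
      heightAbove_replace_right_lt hp0 hq0 hc.pos he0 h.lt hc.lt_left hc.lt_right hbz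

theorem covers_right_of_left_mem (hP : IsAnchored P u v) (hB : IsSaturated P u v B)
    (hG : IsGlue P B u v X Z K k e) (h : IsCovering P B u v p q e) (hq : q ∈ Z)
    (hπ : IsNCFamily (X ∪ Z) π) (hD : D ∈ π) (hE : E ∈ π) (hDE : D ≠ E) (hpD : p ∈ D)
    (hqD : q ∈ D) (hxE : x ∈ E) (hyE : y ∈ E) (hx : x ∈ X) (hy : y ∈ lower Z (p, q))
    (hc : Covers u v x y e) (hmin : heightAbove v e p q ≤ heightAbove v e x y) :
    Covers u v x y q := by
  obtain ⟨hyZ, hby⟩ := mem_lower.1 hy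
  have hx' := hG.chain.subset hx
  have hy' := (hG.isCovering hx hyZ hc).right_mem
  have hyB : y ∉ B := (hG.isCovering hx hyZ hc).right_notMem hP hB
  have hqy := hG.lt_of_mem_lower hP hB h hy (fun hyf => hyB (hyf ▸ hG.fst_mem_saturated))
    (fun hys => hyB (hys ▸ hG.snd_mem_saturated))
  refine ⟨hc.pos, hc.lt_left.trans h.covers.lt_right, hqy, not_le.1 fun hneg => ?_⟩
  have hxq : x ≠ q := by rintro rfl; exact Finset.disjoint_left.1 hG.disj hx hq
  have hxy : x ≠ y := by rintro rfl; exact Finset.disjoint_left.1 hG.disj hx hyZ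
  have hyq : y ≠ q := by rintro rfl; exact hqy.false
  have hpos := lt_of_le_of_ne hneg (hP.orient_ne_zero hx' hy' h.right_mem hxy hxq hyq).symm
  exact hπ.not_crosses hD hE hDE hpD hqD hyE hxE <| crosses_of_heightAbove_le
    (NCConfig.mem_chartPoints.1 h.left_mem).2 (NCConfig.mem_chartPoints.1 h.right_mem).2
    (NCConfig.mem_chartPoints.1 hx').2 hc.pos (NCConfig.mem_chartPoints.1 h.mem).2
    h.covers.lt_left h.covers.lt_right hc.lt_left hqy hby hpos hmin

theorem notMem_of_fst_mem (hP : IsAnchored P u v) (hB : IsSaturated P u v B)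
    (hG : IsGlue P B u v X Z K k e) (h : IsCovering P B u v p q e)
    (hπ : IsNCFamily (X ∪ Z) π) (hD : D ∈ π) (hE : E ∈ π) (hDE : D ≠ E) (hpD : p ∈ D)
    (hqD : q ∈ D) (hk : k.1 ∈ E) (hx : x ∈ Z) (hax : 0 < orient p q x) : x ∉ E := by
  intro hxE
  obtain ⟨hxf, hxs⟩ := hG.ne_of_above hP hB h hax.le
  have hx' := hG.mem_chartPoints hB hx hxf hxs
  exact hπ.not_crosses hD hE hDE hpD hqD hk hxE <| crosses_of_above_vertex
    (NCConfig.mem_chartPoints.1 h.left_mem).2 (NCConfig.mem_chartPoints.1 h.right_mem).2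
    (NCConfig.mem_chartPoints.1 hG.fst_chart).2 (NCConfig.mem_chartPoints.1 hx').2
    (NCConfig.mem_chartPoints.1 h.mem).2 h.covers.lt_left hG.fst_le (hG.lt_of_mem hx hxf hxs)
    (h.between_of_above hP hB hx' hax).2 (hG.above x hx hxf hxs) h.covers.below
    (hG.fst_below hP hB h) hax

theorem covers_right_of_above (hP : IsAnchored P u v) (hB : IsSaturated P u v B)
    (hG : IsGlue P B u v X Z K k e) (h : IsCovering P B u v p q e)
    (hπ : IsNCFamily (X ∪ Z) π) (hk : Pinned π k) (hD : D ∈ π) (hE : E ∈ π) (hDE : D ≠ E)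
    (hpD : p ∈ D) (hqD : q ∈ D) (hxE : x ∈ E) (hyE : y ∈ E) (hx : x ∈ Z)
    (hax : 0 < orient p q x) (hy : y ∈ lower Z (p, q)) : Covers u v x y q := by
  obtain ⟨hyZ, hby⟩ := mem_lower.1 hy
  obtain ⟨F, hF, hfF, hsF, -⟩ := hk
  have hfE : k.1 ∉ E := fun hfE => hG.notMem_of_fst_mem hP hB h hπ hD hE hDE hpD hqD hfE hx hax hxE
  have hyf : y ≠ k.1 := by rintro rfl; exact hfE hyE
  have hys : y ≠ k.2 := by rintro rfl; exact hfE (hπ.eq_of_mem hF hE hsF hyE ▸ hfF)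
  have hx' := hG.mem_chartPoints_of_above hP hB h
    (Finset.mem_union_right _ (mem_upper.2 ⟨hx, hax.le⟩))
  have hy' := hG.mem_chartPoints hB hyZ hyf hys
  have hqy := hG.lt_of_mem_lower hP hB h hy hyf hys
  obtain ⟨hpx, hxq⟩ := h.between_of_above hP hB hx' hax
  have hy0 := (NCConfig.mem_chartPoints.1 hy').2
  refine ⟨hy0, hxq, hqy, not_le.1 fun hneg => ?_⟩
  have hxq' : x ≠ q := by rintro rfl; exact hxq.false
  have hyq' : y ≠ q := by rintro rfl; exact hqy.false
  have hxy : x ≠ y := by rintro rfl; exact lt_asymm hby hax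
  have hpos := lt_of_le_of_ne hneg (hP.orient_ne_zero hx' hy' h.right_mem hxy hxq' hyq').symm
  exact hπ.not_crosses hD hE hDE hpD hqD hyE hxE <|
    crosses_of_right (NCConfig.mem_chartPoints.1 h.left_mem).2
      (NCConfig.mem_chartPoints.1 h.right_mem).2 hy0 (NCConfig.mem_chartPoints.1 hx').2 hpx hxq
      hqy hby hax hpos

theorem mem_splitFamilies_of_lowest (hP : IsAnchored P u v) (hB : IsSaturated P u v B)
    (hG : IsGlue P B u v X Z K k e) (hp : p ∈ X) (hq : q ∈ Z)
    (hπ : π ∈ gluedFamilies u v X Z K k e) (hpq : Connects π p q)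
    (hmin : ∀ x ∈ X, ∀ y ∈ Z, Connects π x y → heightAbove v e p q ≤ heightAbove v e x y) :
    π ∈ splitFamilies u v X Z K k (p, q) := by
  obtain ⟨hπ', hpin, hcov⟩ := mem_gluedFamilies.1 hπ
  have h := hG.isCovering hp hq (hcov p hp q hq hpq)
  have hpinned := hG.pinned_of_lowest h hp hq hπ hmin hpq
  refine mem_splitFamilies.2 ⟨hπ', hpin, hpinned, ?_⟩
  rintro x hx y hy ⟨E, hE, hxE, hyE⟩
  obtain ⟨D, hD, hpD, hqD, hDa⟩ := hpinned
  obtain ⟨hyZ, hby⟩ := mem_lower.1 hy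
  have hDE : D ≠ E := by
    rintro rfl
    exact hby.not_ge (hDa y hyE)
  by_cases hxX : x ∈ X
  · have hxy : Connects π x y := ⟨E, hE, hxE, hyE⟩
    exact hG.covers_right_of_left_mem hP hB h hq hπ' hD hE hDE hpD hqD hxE hyE hxX hy
      (hcov x hxX y hyZ hxy) (hmin x hxX y hyZ hxy)
  · obtain ⟨hxZ, hax⟩ := mem_upper.1 ((Finset.mem_union.1 hx).resolve_left hxX)
    have hxp : x ≠ p := by rintro rfl; exact hxX hp
    have hxq : x ≠ q := by rintro rfl; exact hDE (hπ'.eq_of_mem hD hE hqD hxE)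
    have hpos := h.pos_of_above hP (hG.mem_chartPoints_of_above hP hB h hx) hax hxp hxq
    exact hG.covers_right_of_above hP hB h hπ' (hpin k List.mem_cons_self) hD hE hDE hpD hqD hxE
      hyE hxZ hpos hy

theorem exists_mem_splitFamilies (hP : IsAnchored P u v) (hB : IsSaturated P u v B)
    (hG : IsGlue P B u v X Z K k e) (hπ : π ∈ gluedFamilies u v X Z K k e)
    (hxy : ∃ x ∈ X, ∃ y ∈ Z, Connects π x y) :
    ∃ p ∈ X, ∃ q ∈ Z, Covers u v p q e ∧ π ∈ splitFamilies u v X Z K k (p, q) := by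
  classical
  obtain ⟨x, hx, y, hy, hxy⟩ := hxy
  obtain ⟨⟨p, q⟩, hpq, hmin⟩ := Finset.exists_min_image
    ((X ×ˢ Z).filter fun x => Connects π x.1 x.2) (fun x => heightAbove v e x.1 x.2)
    ⟨(x, y), Finset.mem_filter.2 ⟨Finset.mk_mem_product hx hy, hxy⟩⟩
  obtain ⟨hXZ, hpq⟩ := Finset.mem_filter.1 hpq
  obtain ⟨hp, hq⟩ := Finset.mem_product.1 hXZ
  refine ⟨p, hp, q, hq, (mem_gluedFamilies.1 hπ).2.2 p hp q hq hpq,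
    hG.mem_splitFamilies_of_lowest hP hB hp hq hπ hpq fun x hx y hy hxy =>
      hmin (x, y) (Finset.mem_filter.2 ⟨Finset.mk_mem_product hx hy, hxy⟩)⟩

end IsGlue

/-! ### Symmetry of glued families -/

theorem notMem_interior_of_orient_nonneg {c d z : ℂ} {S : Set ℂ} (hcd : c ≠ d)
    (hS : ∀ y ∈ S, 0 ≤ orient c d y) (hz : orient c d z = 0) :
    z ∉ interior (convexHull ℝ S) := by
  intro h
  have hsub : convexHull ℝ S ⊆ {y | 0 ≤ orient c d y} :=
    convexHull_min hS (convex_preimage_orient c d (convex_Ici 0))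
  have hcont : Continuous fun t : ℝ => z - t • (Complex.I * (d - c)) := by fun_prop
  have hnear : ∀ᶠ t in nhds (0 : ℝ), 0 ≤ orient c d (z - t • (Complex.I * (d - c))) :=
    (hcont.tendsto' 0 z (by simp)).eventually
      (Filter.mem_of_superset (mem_interior_iff_mem_nhds.1 h) hsub)
  obtain ⟨t, ht, hpos⟩ :=
    ((hnear.filter_mono nhdsWithin_le_nhds).and (self_mem_nhdsWithin (s := Set.Ioi 0))).exists
  have hformula : orient c d (z - t • (Complex.I * (d - c))) =
      orient c d z - t * Complex.normSq (d - c) := by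
    simp only [orient, Complex.normSq_apply, Complex.sub_re, Complex.sub_im, Complex.real_smul,
      Complex.mul_re, Complex.mul_im, Complex.ofReal_re, Complex.ofReal_im, Complex.I_re,
      Complex.I_im]
    ring
  rw [hformula, hz] at ht
  have := mul_pos hpos (Complex.normSq_pos.2 (sub_ne_zero.2 hcd.symm))
  linarith

theorem card_upper_add_card_lower (X : Finset ℂ) (k : ℂ × ℂ) :
    (upper X k).card + (lower X k).card = X.card := by
  rw [← Finset.card_union_of_disjoint (disjoint_lower_upper X k).symm, upper_union_lower]

section Unmixed

variable {X Z E : Finset ℂ} {x : ℂ} {π α γ : Finset (Finset ℂ)}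

theorem inter_eq_of_not_connects (hπ : IsNCFamily (X ∪ Z) π)
    (h : ∀ x ∈ X, ∀ y ∈ Z, ¬ Connects π x y) (hE : E ∈ π) (hxE : x ∈ E) (hx : x ∈ X) :
    E ∩ X = E :=
  Finset.inter_eq_left.2 fun y hy => (Finset.mem_union.1 (hπ.subset E hE hy)).resolve_right
    fun hyZ => h x hx y hyZ ⟨E, hE, hxE, hy⟩

theorem trace_subset_of_not_connects (hπ : IsNCFamily (X ∪ Z) π)
    (h : ∀ x ∈ X, ∀ y ∈ Z, ¬ Connects π x y) : trace π X ⊆ π := by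
  intro A hA
  obtain ⟨⟨x, hx⟩, E, hE, rfl⟩ := mem_trace.1 hA
  obtain ⟨hxE, hx⟩ := Finset.mem_inter.1 hx
  rwa [inter_eq_of_not_connects hπ h hE hxE hx]

theorem trace_union_trace (hπ : IsNCFamily (X ∪ Z) π)
    (h : ∀ x ∈ X, ∀ y ∈ Z, ¬ Connects π x y) : trace π X ∪ trace π Z = π := by
  have hπ' : IsNCFamily (Z ∪ X) π := by rwa [Finset.union_comm]
  have h' : ∀ y ∈ Z, ∀ x ∈ X, ¬ Connects π y x := fun y hy x hx ⟨E, hE, hyE, hxE⟩ =>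
    h x hx y hy ⟨E, hE, hxE, hyE⟩
  refine (Finset.union_subset (trace_subset_of_not_connects hπ h)
    (trace_subset_of_not_connects hπ' h')).antisymm fun E hE => ?_
  obtain ⟨x, hxE⟩ := hπ.nonempty E hE
  refine Finset.mem_union.2 ((Finset.mem_union.1 (hπ.subset E hE hxE)).imp (fun hx => ?_)
    fun hx => ?_)
  · have hEX := inter_eq_of_not_connects hπ h hE hxE hx
    exact mem_trace.2 ⟨⟨x, hxE⟩, E, hE, hEX⟩
  · have hEZ := inter_eq_of_not_connects hπ' h' hE hxE hx
    exact mem_trace.2 ⟨⟨x, hxE⟩, E, hE, hEZ⟩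

theorem IsNCFamily.union (hα : IsNCFamily X α) (hγ : IsNCFamily Z γ)
    (hsep : ∀ E ∈ α, ∀ E' ∈ γ, Disjoint (convexHull ℝ (E : Set ℂ)) (convexHull ℝ (E' : Set ℂ))) :
    IsNCFamily (X ∪ Z) (α ∪ γ) where
  nonempty E hE := (Finset.mem_union.1 hE).elim (hα.nonempty E) (hγ.nonempty E)
  subset E hE := (Finset.mem_union.1 hE).elim
    (fun h => (hα.subset E h).trans Finset.subset_union_left)
    (fun h => (hγ.subset E h).trans Finset.subset_union_right)
  cover z hz := (Finset.mem_union.1 hz).elim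
    (fun h => (hα.cover z h).imp fun _ => And.imp_left (Finset.mem_union_left _))
    (fun h => (hγ.cover z h).imp fun _ => And.imp_left (Finset.mem_union_right _))
  disjoint E hE E' hE' hne := by
    rcases Finset.mem_union.1 hE with hE | hE <;> rcases Finset.mem_union.1 hE' with hE' | hE'
    · exact hα.disjoint E hE E' hE' hne
    · exact hsep E hE E' hE'
    · exact (hsep E' hE' E hE).symm
    · exact hγ.disjoint E hE E' hE' hne

theorem not_connects_union (hα : IsNCFamily X α) (hγ : IsNCFamily Z γ) (h : Disjoint X Z) :
    ∀ x ∈ X, ∀ y ∈ Z, ¬ Connects (α ∪ γ) x y := by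
  rintro x hx y hy ⟨E, hE, hxE, hyE⟩
  rcases Finset.mem_union.1 hE with hE | hE
  · exact Finset.disjoint_left.1 h (hα.subset E hE hyE) hy
  · exact Finset.disjoint_left.1 h hx (hγ.subset E hE hxE)

theorem Pinned.mono {k : ℂ × ℂ} (h : Pinned α k) (hαπ : α ⊆ π) : Pinned π k := by
  obtain ⟨E, hE, h⟩ := h
  exact ⟨E, hαπ hE, h⟩

end Unmixed

section Glue

variable {P B : Finset ℂ} {u v : ℂ} {X Z : Finset ℂ} {K : List (ℂ × ℂ)} {k : ℂ × ℂ} {e : ℂ}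
  {π : Finset (Finset ℂ)}

open scoped FinsetFamily in
open Classical in
theorem IsGlue.filter_not_connects (hG : IsGlue P B u v X Z K k e) :
    (gluedFamilies u v X Z K k e).filter (fun π => ∀ x ∈ X, ∀ y ∈ Z, ¬ Connects π x y) =
      pinnedFamilies X K ⊻ pinnedFamilies Z [k] := by
  ext π
  rw [Finset.mem_filter, mem_gluedFamilies, Finset.mem_sups]
  constructor
  · rintro ⟨⟨hπ, hpin, -⟩, h⟩
    rw [List.forall_mem_cons] at hpin
    exact ⟨_, trace_mem_pinnedFamilies hπ Finset.subset_union_left hpin.2 hG.chain.mem,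
      _, trace_mem_pinnedFamilies hπ Finset.subset_union_right
        (List.forall_mem_singleton.2 hpin.1)
        (List.forall_mem_singleton.2 ⟨hG.fst_mem, hG.snd_mem⟩), trace_union_trace hπ h⟩
  · rintro ⟨α, hα, γ, hγ, rfl⟩
    obtain ⟨hα', hαK⟩ := mem_pinnedFamilies.1 hα
    obtain ⟨hγ', hγk⟩ := mem_pinnedFamilies.1 hγ
    have hnot := not_connects_union hα' hγ' hG.disj
    exact ⟨⟨hα'.union hγ' fun E hE E' hE' => (hG.sep α hα E hE).mono_right
          (convexHull_mono (Finset.coe_subset.2 (hγ'.subset E' hE'))),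
        List.forall_mem_cons.2 ⟨(List.forall_mem_singleton.1 hγk).mono Finset.subset_union_right,
          fun k' hk' => (hαK k' hk').mono Finset.subset_union_left⟩,
        fun x hx y hy hxy => (hnot x hx y hy hxy).elim⟩, hnot⟩

theorem IsGlue.left_ssubset (hP : IsAnchored P u v) (hG : IsGlue P B u v X Z K k e) : X ⊂ P :=
  (Finset.ssubset_iff_of_subset fun _ hz => (NCConfig.mem_chartPoints.1 (hG.chain.subset hz)).1).2
    ⟨u, hP.left_mem, fun h => (ne_of_mem_chartPoints (hG.chain.subset h)).1 rfl⟩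

theorem IsGlue.right_ssubset (hP : IsAnchored P u v) (hG : IsGlue P B u v X Z K k e) :
    Z ⊂ P := by
  refine (Finset.ssubset_iff_of_subset fun z hz => ?_).2 ⟨u, hP.left_mem, fun h => ?_⟩
  · rcases hG.subset z hz with hz | rfl
    · exact (NCConfig.mem_chartPoints.1 hz).1
    · exact hP.right_mem
  · exact (hG.subset u h).elim (fun h => (ne_of_mem_chartPoints h).1 rfl) hP.ne

theorem IsGlue.propertyDeltaOneRel (hP : IsAnchored P u v) (hB : IsSaturated P u v B)
    (hG : IsGlue P B u v X Z K k e) : PropertyDeltaOneRel Z k.1 k.2 := by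
  intro T hT hfst hsnd
  have hpair : {k.1, k.2} ⊆ T := Finset.insert_subset hfst (Finset.singleton_subset_iff.2 hsnd)
  have hpairB : {k.1, k.2} ⊆ B := Finset.insert_subset hG.fst_mem_saturated
    (Finset.singleton_subset_iff.2 hG.snd_mem_saturated)
  have hsub : T \ {k.1, k.2} ⊆ P :=
    Finset.sdiff_subset.trans (hT.trans (hG.right_ssubset hP).subset)
  have hTB : T ⊆ B ∪ T \ {k.1, k.2} :=
    (Finset.union_sdiff_of_subset hpair).ge.trans (Finset.union_subset_union_left hpairB)
  have hdisj : Disjoint (interiorPoints B B) (interiorPoints T T) := by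
    refine Finset.disjoint_left.2 fun z hzB hzT => ?_
    obtain ⟨hzT, hzi⟩ := mem_interiorPoints.1 hzT
    refine notMem_interior_of_orient_nonneg hG.ne (fun y hy => hG.nonneg y (hT hy)) ?_ hzi
    rcases hG.eq_of_mem z (hT hzT) (mem_interiorPoints.1 hzB).1 with rfl | rfl <;> simp
  have hcount := hB.two_mul_card_le hP hsub (interiorPoints_self_mono hTB) hdisj
  have hcard : (T \ {k.1, k.2}).card = T.card - 2 := by
    rw [Finset.card_sdiff_of_subset hpair, Finset.card_pair hG.ne]
  have hle := Finset.card_le_card (Finset.sdiff_subset (s := T \ {k.1, k.2}) (t := B))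
  omega

theorem IsChain.isGlue (hP : IsAnchored P u v) (h : IsChain P B u v (k :: K) X) :
    IsGlue P B u v (lower X k) (upper X k) K k k.1 := by
  obtain ⟨hX, hL, hK⟩ := h
  have hup : ∀ z ∈ upper X k, z ∈ chartPoints P u v := fun z hz => hX (upper_subset X k hz)
  exact
    { chain := hK
      subset := fun z hz => Or.inl (hup z hz)
      disj := disjoint_lower_upper X k
      fst_chart := hX hL.fst_mem
      fst_mem := mem_upper.2 ⟨hL.fst_mem, by simp⟩
      fst_mem_saturated := hL.fst_mem_saturated
      snd_mem := mem_upper.2 ⟨hL.snd_mem, by simp⟩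
      snd_mem_saturated := hL.snd_mem_saturated
      ne := fun h => hL.lt.ne (by rw [h])
      nonneg := fun z hz => (mem_upper.1 hz).2
      eq_of_mem := hL.eq_of_mem
      vertex_chart := hX hL.fst_mem
      vertex_mem := hL.fst_mem_saturated
      not_interior := hL.not_interior
      vertex_ne := fun k' hk' he => by simpa [he] using (mem_lower.1 (hK.mem k' hk').1).2
      left := fun z hz => (hL.left z hz).imp_left le_of_lt
      right := fun z hz => or_iff_not_imp_left.2 fun hzk => Or.inr <|
        lt_of_le_of_ne (hL.between z hz).1 (hP.absc_ne (hX hL.fst_mem) (hup z hz) (Ne.symm hzk))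
      fst_le := le_rfl
      above := fun z _ _ _ => by simp
      sep := fun π hπ E hE => (disjoint_convexHull_of_orient
        (fun z hz => (mem_upper.1 hz).2)
        fun z hz => (mem_lower.1 ((mem_pinnedFamilies.1 hπ).1.subset E hE hz)).2).symm }

theorem Pinned.not_crosses (hpin : Pinned π k) (hπ : IsNCFamily X π) {x y : ℂ}
    (hx : orient k.1 k.2 x < 0) (hxy : Connects π x y) :
    y ≠ k.1 ∧ y ≠ k.2 ∧ ¬ Crosses k.1 k.2 x y := by
  obtain ⟨D, hD, hfD, hsD, hleft⟩ := hpin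
  obtain ⟨E, hE, hxE, hyE⟩ := hxy
  have hDE : D ≠ E := fun h => hx.not_ge (hleft x (h ▸ hxE))
  refine ⟨?_, ?_, hπ.not_crosses hD hE hDE hfD hsD hxE hyE⟩
  · rintro rfl
    exact hDE (hπ.eq_of_mem hD hE hfD hyE)
  · rintro rfl
    exact hDE (hπ.eq_of_mem hD hE hsD hyE)

theorem IsChain.covers_of_connects (hP : IsAnchored P u v) (h : IsChain P B u v (k :: K) X)
    (hπ : IsNCFamily X π) (hpin : Pinned π k) {x y : ℂ} (hx : x ∈ lower X k) (hy : y ∈ upper X k)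
    (hxy : Connects π x y) : Covers u v x y k.1 := by
  obtain ⟨hX, hL, -⟩ := h
  obtain ⟨hyf, hys, hnc⟩ := hpin.not_crosses hπ (mem_lower.1 hx).2 hxy
  have hxk := (hL.left_or_crosses x hx y hy hyf hys).resolve_right hnc
  have hx' := hX (lower_subset X k hx)
  have hy' := hX (upper_subset X k hy)
  have hf := hX hL.fst_mem
  have hs := hX hL.snd_mem
  have hky := lt_of_le_of_ne (hL.between y hy).1 (hP.absc_ne hf hy' hyf.symm)
  have hyk := lt_of_le_of_ne (hL.between y hy).2 (hP.absc_ne hy' hs hys)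
  have hxf : x ≠ k.1 := fun h => hxk.ne (by rw [h])
  have hxy : x ≠ y := fun h => (hxk.trans hky).ne (by rw [h])
  have hkk : k.1 ≠ k.2 := fun h => hL.lt.ne (by rw [h])
  have hay := lt_of_le_of_ne (mem_upper.1 hy).2
    (hP.orient_ne_zero hf hs hy' hkk hyf.symm hys.symm).symm
  have hy0 := (mem_chartPoints.1 hy').2
  refine ⟨hy0, hxk, hky, lt_of_not_ge fun hneg => hnc ?_⟩
  exact crosses_of_left (mem_chartPoints.1 hf).2 (mem_chartPoints.1 hs).2
    (mem_chartPoints.1 hx').2 hy0 hxk hky hyk (mem_lower.1 hx).2 hay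
    (lt_of_le_of_ne hneg (hP.orient_ne_zero hx' hy' hf hxy hxf hyf).symm)

theorem IsChain.pinnedFamilies_eq (hP : IsAnchored P u v) (h : IsChain P B u v (k :: K) X) :
    pinnedFamilies X (k :: K) = gluedFamilies u v (lower X k) (upper X k) K k k.1 := by
  ext π
  rw [mem_pinnedFamilies, mem_gluedFamilies, Finset.union_comm, upper_union_lower, ← and_assoc]
  exact (and_iff_left_of_imp fun ⟨hπ, hpin⟩ x hx y hy =>
    h.covers_of_connects hP hπ (hpin k List.mem_cons_self) hx hy).symm

open Classical in
/-- The pairs of a point of `X` and a point of `Z` whose segment covers `e`: the candidates for the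
lowest connection between `X` and `Z` in a glued family. -/
def coveringPairs (u v : ℂ) (X Z : Finset ℂ) (e : ℂ) : Finset (ℂ × ℂ) :=
  (X ×ˢ Z).filter fun x => Covers u v x.1 x.2 e

theorem mem_coveringPairs {p q : ℂ} :
    (p, q) ∈ coveringPairs u v X Z e ↔ p ∈ X ∧ q ∈ Z ∧ Covers u v p q e := by
  simp only [coveringPairs, Finset.mem_filter, Finset.mem_product, and_assoc]

theorem connects_of_mem_splitFamilies {x : ℂ × ℂ} (hπ : π ∈ splitFamilies u v X Z K k x) :
    Connects π x.1 x.2 := by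
  obtain ⟨-, -, ⟨E, hE, hfst, hsnd, -⟩, -⟩ := mem_splitFamilies.1 hπ
  exact ⟨E, hE, hfst, hsnd⟩

open Classical in
theorem IsGlue.gluedFamilies_eq_union (hP : IsAnchored P u v) (hB : IsSaturated P u v B)
    (hG : IsGlue P B u v X Z K k e) :
    gluedFamilies u v X Z K k e =
      (gluedFamilies u v X Z K k e).filter (fun π => ∀ x ∈ X, ∀ y ∈ Z, ¬ Connects π x y) ∪
        (coveringPairs u v X Z e).biUnion (splitFamilies u v X Z K k) := by
  refine Finset.Subset.antisymm (fun π hπ => ?_)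
    (Finset.union_subset (Finset.filter_subset _ _) (Finset.biUnion_subset.2 ?_))
  · refine Finset.mem_union.2 (or_iff_not_imp_left.2 fun hmixed => ?_)
    simp only [Finset.mem_filter, hπ, true_and, not_forall, not_not, exists_prop] at hmixed
    obtain ⟨p, hp, q, hq, hc, hπ⟩ := hG.exists_mem_splitFamilies hP hB hπ hmixed
    exact Finset.mem_biUnion.2 ⟨(p, q), mem_coveringPairs.2 ⟨hp, hq, hc⟩, hπ⟩
  · rintro ⟨p, q⟩ hpq
    obtain ⟨hp, hq, hc⟩ := mem_coveringPairs.1 hpq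
    exact hG.splitFamilies_subset hP hB hp hq hc

open Classical in
theorem disjoint_filter_not_connects_biUnion :
    Disjoint ((gluedFamilies u v X Z K k e).filter fun π => ∀ x ∈ X, ∀ y ∈ Z, ¬ Connects π x y)
      ((coveringPairs u v X Z e).biUnion (splitFamilies u v X Z K k)) := by
  refine Finset.disjoint_left.2 fun π hπ hπ' => ?_
  obtain ⟨⟨p, q⟩, hpq, hπ'⟩ := Finset.mem_biUnion.1 hπ'
  obtain ⟨hp, hq, -⟩ := mem_coveringPairs.1 hpq
  exact (Finset.mem_filter.1 hπ).2 p hp q hq (connects_of_mem_splitFamilies hπ')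

theorem IsGlue.pairwiseDisjoint_splitFamilies (hP : IsAnchored P u v) (hB : IsSaturated P u v B)
    (hG : IsGlue P B u v X Z K k e) :
    (coveringPairs u v X Z e : Set (ℂ × ℂ)).PairwiseDisjoint (splitFamilies u v X Z K k) := by
  rintro ⟨p, q⟩ hpq ⟨p', q'⟩ hpq' hne
  obtain ⟨hp, hq, hc⟩ := mem_coveringPairs.1 hpq
  obtain ⟨hp', hq', hc'⟩ := mem_coveringPairs.1 hpq'
  refine Finset.disjoint_left.2 fun π hπ hπ' => hne ?_
  rcases le_total (heightAbove v e p' q') (heightAbove v e p q) with hle | hle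
  · obtain ⟨rfl, rfl⟩ := hG.splitFamilies_unique hP hB hp hq hc hp' hq' hc' hπ hπ' hle
    rfl
  · obtain ⟨rfl, rfl⟩ := hG.splitFamilies_unique hP hB hp' hq' hc' hp hq hc hπ' hπ hle
    rfl

theorem IsGlue.blockSymmetric_of_splitFamilies (hP : IsAnchored P u v)
    (hB : IsSaturated P u v B) (hG : IsGlue P B u v X Z K k e)
    (hX : BlockSymmetric (pinnedFamilies X K) (X.card + 1))
    (hZ : BlockSymmetric (pinnedFamilies Z [k]) Z.card)
    (hsplit : ∀ x ∈ coveringPairs u v X Z e,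
      BlockSymmetric (splitFamilies u v X Z K k x) (X.card + Z.card + 1)) :
    BlockSymmetric (gluedFamilies u v X Z K k e) (X.card + Z.card + 1) := by
  classical
  have hunmixed := hX.sups hZ fun α hα γ hγ =>
    (mem_pinnedFamilies.1 hα).1.disjoint_of_disjoint (mem_pinnedFamilies.1 hγ).1 hG.disj
  rw [← hG.filter_not_connects, add_right_comm] at hunmixed
  rw [hG.gluedFamilies_eq_union hP hB]
  exact hunmixed.union (.biUnion hsplit (hG.pairwiseDisjoint_splitFamilies hP hB))
    disjoint_filter_not_connects_biUnion

end Glue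

theorem IsGlue.blockSymmetric {P B X Z : Finset ℂ} {u v e : ℂ} {K : List (ℂ × ℂ)} {k : ℂ × ℂ}
    (hP : IsAnchored P u v) (hB : IsSaturated P u v B) (hG : IsGlue P B u v X Z K k e)
    (hnc : ∀ Y ⊂ P, Y.Nonempty → BlockSymmetric (ncFamilies Y) (Y.card + 1))
    (hpin : ∀ Y ⊂ P, ∀ c ∈ Y, ∀ d ∈ Y, c ≠ d → (∀ z ∈ Y, 0 ≤ orient c d z) →
      PropertyDeltaOneRel Y c d → BlockSymmetric (pinnedFamilies Y [(c, d)]) Y.card) :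
    BlockSymmetric (gluedFamilies u v X Z K k e) (X.card + Z.card + 1) := by
  have hZ := hpin Z (hG.right_ssubset hP) k.1 hG.fst_mem k.2 hG.snd_mem hG.ne hG.nonneg
    (hG.propertyDeltaOneRel hP hB)
  have hX : BlockSymmetric (pinnedFamilies X K) (X.card + 1) := by
    cases K with
    | nil =>
      rw [pinnedFamilies_nil]
      exact hnc X (hG.left_ssubset hP) hG.chain.nonempty
    | cons k' K =>
      have hcard := card_upper_add_card_lower X k'
      have := (Finset.card_pos.2 ⟨k.1, hG.fst_mem⟩ : 0 < Z.card)
      rw [hG.chain.pinnedFamilies_eq hP, ← hcard, add_comm (upper X k').card, Nat.cast_add]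
      exact IsGlue.blockSymmetric hP hB (hG.chain.isGlue hP) hnc hpin
  refine hG.blockSymmetric_of_splitFamilies hP hB hX hZ fun ⟨p, q⟩ hpq => ?_
  obtain ⟨hp, hq, hc⟩ := mem_coveringPairs.1 hpq
  have hcard := card_upper_add_card_lower Z (p, q)
  have hunion : (X ∪ upper Z (p, q)).card = X.card + (upper Z (p, q)).card :=
    Finset.card_union_of_disjoint (hG.disj.mono_right (upper_subset _ _))
  have := (Finset.card_pos.2 ⟨q, mem_upper.2 ⟨hq, by simp⟩⟩ : 0 < (upper Z (p, q)).card)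
  rw [← hcard, Nat.cast_add, ← add_assoc, ← Nat.cast_add X.card, ← hunion]
  exact IsGlue.blockSymmetric hP ((hG.isCovering hp hq hc).isSaturated hP hB)
    (hG.isGlue_absorb hP hB hp hq hc) hnc hpin
termination_by (X.card + Z.card, Z.card)
decreasing_by
  all_goals simp only [Prod.lex_def]
  all_goals omega

/-! ### Partitions pinned at an apex -/

open Classical in
/-- The points `w` for which the triangle `u, v, w` has a point of `P` in its interior. -/
def apexes (P : Finset ℂ) (u v : ℂ) : Finset ℂ :=
  (chartPoints P u v).filter fun w =>
    ∃ x ∈ P, 0 < orient u v x ∧ 0 < orient v w x ∧ 0 < orient w u x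

section Apex

variable {P : Finset ℂ} {u v w x y z : ℂ}

theorem mem_apexes : w ∈ apexes P u v ↔ w ∈ chartPoints P u v ∧
    ∃ x ∈ P, 0 < orient u v x ∧ 0 < orient v w x ∧ 0 < orient w u x := by
  simp only [apexes, Finset.mem_filter]

theorem IsAnchored.isSaturated_pair (hP : IsAnchored P u v) : IsSaturated P u v {u, v} := by
  have hs : ({u, v} : Finset ℂ) ⊆ P :=
    Finset.insert_subset hP.left_mem (Finset.singleton_subset_iff.2 hP.right_mem)
  have h := hP.rel {u, v} hs (by simp) (by simp)
  rw [Finset.card_pair hP.ne] at h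
  refine ⟨hs, by simp, by simp, ?_⟩
  rw [Finset.card_pair hP.ne]
  omega

theorem IsAnchored.eq_of_mem_triangle {t : ℂ} (hP : IsAnchored P u v) (ht : t ∈ P)
    (hy : y ∈ chartPoints P u v) (hvy : 0 < orient v t y) (hyu : 0 < orient t u y)
    (hz : z ∈ chartPoints P u v) (hvz : 0 < orient v t z) (hzu : 0 < orient t u z) : y = z := by
  by_contra hne
  obtain ⟨hyP, hy0⟩ := NCConfig.mem_chartPoints.1 hy
  obtain ⟨hzP, hz0⟩ := NCConfig.mem_chartPoints.1 hz
  have hT : ({t, y, z} : Finset ℂ) ⊆ P := by simp [Finset.insert_subset_iff, ht, hyP, hzP]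
  have hpair {x : ℂ} (hx : x ∈ chartPoints P u v) : x ∉ interiorPoints {u, v} {u, v} := fun h => by
    simpa [ne_of_mem_chartPoints hx] using (mem_interiorPoints.1 h).1
  refine hP.isSaturated_pair.not_two_interior hP hT Finset.card_le_three hne (hpair hy) (hpair hz)
    (mem_interiorPoints.2 ⟨by simp, ?_⟩) (mem_interiorPoints.2 ⟨by simp, ?_⟩)
  · exact mem_interior_triangle (by simp) (by simp) (by simp) hy0 hvy hyu
  · exact mem_interior_triangle (by simp) (by simp) (by simp) hz0 hvz hzu

theorem IsAnchored.interiorPoints_triangle (hP : IsAnchored P u v) (hw : w ∈ chartPoints P u v)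
    (hx : x ∈ P) (h₁ : 0 < orient u v x) (h₂ : 0 < orient v w x) (h₃ : 0 < orient w u x) :
    IsSaturated P u v {u, v, w, x} ∧ interiorPoints {u, v, w, x} {u, v, w, x} = {x} := by
  obtain ⟨hwu, hwv⟩ := ne_of_mem_chartPoints hw
  obtain ⟨hxu, hxv⟩ := ne_of_mem_chartPoints (NCConfig.mem_chartPoints.2 ⟨hx, h₁⟩)
  have hwx : w ≠ x := by rintro rfl; simp at h₂
  have hs : ({u, v, w, x} : Finset ℂ) ⊆ P := by
    simp [Finset.insert_subset_iff, hP.left_mem, hP.right_mem,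
      (NCConfig.mem_chartPoints.1 hw).1, hx]
  have hc : ({u, v, w, x} : Finset ℂ).card = 4 :=
    Finset.card_eq_succ.2 ⟨u, {v, w, x}, by simp [hP.ne, hwu.symm, hxu.symm], rfl,
      Finset.card_eq_three.2 ⟨v, w, x, hwv.symm, hxv.symm, hwx, rfl⟩⟩
  have hrel := hP.rel _ hs (by simp) (by simp)
  rw [hc] at hrel
  have hxi : {x} ⊆ interiorPoints {u, v, w, x} {u, v, w, x} :=
    Finset.singleton_subset_iff.2 <| mem_interiorPoints.2
      ⟨by simp, mem_interior_triangle (by simp) (by simp) (by simp) h₁ h₂ h₃⟩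
  have he := Finset.eq_of_subset_of_card_le hxi (by simpa using hrel)
  exact ⟨⟨hs, by simp, by simp, by rw [← he, hc]; simp⟩, he.symm⟩

theorem IsAnchored.absc_lt_of_mem_lower (hP : IsAnchored P u v) (hw : w ∈ chartPoints P u v)
    (hz : z ∈ lower (P.erase u) (w, v)) : z ∈ chartPoints P u v ∧ absc u v z < absc u v w := by
  obtain ⟨hzP, hwvz⟩ := mem_lower.1 hz
  have hzv : z ≠ v := by rintro rfl; simp at hwvz
  have hzc := hP.mem_chartPoints (Finset.mem_of_mem_erase hzP) (Finset.ne_of_mem_erase hzP) hzv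
  refine ⟨hzc, (orient_right_neg_iff (NCConfig.mem_chartPoints.1 hzc).2
    (NCConfig.mem_chartPoints.1 hw).2).1 ?_⟩
  rwa [← orient_rotate]

theorem IsAnchored.absc_lt_of_mem_upper (hP : IsAnchored P u v) (hw : w ∈ chartPoints P u v)
    (hz : z ∈ upper (P.erase u) (w, v)) (hzw : z ≠ w) (hzv : z ≠ v) :
    z ∈ chartPoints P u v ∧ 0 < orient w v z ∧ absc u v w < absc u v z := by
  obtain ⟨hzP, hwvz⟩ := mem_upper.1 hz
  have hzc := hP.mem_chartPoints (Finset.mem_of_mem_erase hzP) (Finset.ne_of_mem_erase hzP) hzv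
  have hpos : 0 < orient w v z := hP.gp.orient_pos (NCConfig.mem_chartPoints.1 hw).1 hP.right_mem
    (Finset.mem_of_mem_erase hzP) (ne_of_mem_chartPoints hw).2 hzw.symm hzv.symm hwvz
  refine ⟨hzc, hpos, (orient_right_neg_iff (NCConfig.mem_chartPoints.1 hw).2
    (NCConfig.mem_chartPoints.1 hzc).2).1 ?_⟩
  rwa [orient_swap_right, neg_neg_iff_pos]

theorem IsAnchored.isGlue {B : Finset ℂ} (hP : IsAnchored P u v) (hw : w ∈ chartPoints P u v)
    (hmeet : ∃ z ∈ lower (P.erase u) (w, v), z ∈ B) (hwB : w ∈ B) (hvB : v ∈ B)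
    (hint : w ∉ interiorPoints B B)
    (hB : ∀ z ∈ upper (P.erase u) (w, v), z ∈ B → z = w ∨ z = v) :
    IsGlue P B u v (lower (P.erase u) (w, v)) (upper (P.erase u) (w, v)) [] (w, v) w where
  chain := ⟨fun z hz => (hP.absc_lt_of_mem_lower hw hz).1, hmeet⟩
  subset := fun z hz => or_iff_not_imp_right.2 <|
    hP.mem_chartPoints (Finset.mem_of_mem_erase (mem_upper.1 hz).1)
      (Finset.ne_of_mem_erase (mem_upper.1 hz).1)
  disj := disjoint_lower_upper _ _
  fst_chart := hw
  fst_mem := mem_upper.2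
    ⟨by simp [(NCConfig.mem_chartPoints.1 hw).1, (ne_of_mem_chartPoints hw).1], by simp⟩
  fst_mem_saturated := hwB
  snd_mem := mem_upper.2 ⟨by simp [hP.right_mem, hP.ne.symm], by simp⟩
  snd_mem_saturated := hvB
  ne := (ne_of_mem_chartPoints hw).2
  nonneg := fun z hz => (mem_upper.1 hz).2
  eq_of_mem := hB
  vertex_chart := hw
  vertex_mem := hwB
  not_interior := hint
  vertex_ne := by simp
  left := fun z hz => Or.inl (hP.absc_lt_of_mem_lower hw hz).2.le
  right := fun z hz => or_iff_not_imp_left.2 fun hzw => or_iff_not_imp_left.2 fun hzv =>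
    (hP.absc_lt_of_mem_upper hw hz hzw hzv).2.2
  fst_le := le_rfl
  above := fun z _ _ _ => by simp
  sep := fun π hπ E hE => (disjoint_convexHull_of_orient (fun z hz => (mem_upper.1 hz).2)
    fun z hz => (mem_lower.1 ((mem_pinnedFamilies.1 hπ).1.subset E hE hz)).2).symm

theorem IsAnchored.exists_isGlue (hP : IsAnchored P u v) (hw : w ∈ apexes P u v) :
    ∃ B, IsSaturated P u v B ∧
      IsGlue P B u v (lower (P.erase u) (w, v)) (upper (P.erase u) (w, v)) [] (w, v) w := by
  obtain ⟨hw, x, hx, h₁, h₂, h₃⟩ := mem_apexes.1 hw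
  have hxu := (ne_of_mem_chartPoints (NCConfig.mem_chartPoints.2 ⟨hx, h₁⟩)).1
  have hwx : w ≠ x := by rintro rfl; simp at h₂
  have hwvx : orient w v x < 0 := by rwa [orient_swap_left, neg_lt_zero]
  obtain ⟨hsat, hint⟩ := hP.interiorPoints_triangle hw hx h₁ h₂ h₃
  refine ⟨{u, v, w, x}, hsat, hP.isGlue hw ⟨x, mem_lower.2 ⟨by simp [hx, hxu], hwvx⟩, by simp⟩
    (by simp) (by simp) (by rw [hint]; simpa using hwx) fun z hz hzB => ?_⟩
  obtain ⟨hzP, hwvz⟩ := mem_upper.1 hz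
  have hzx : z ≠ x := fun h => (h ▸ hwvz).not_gt hwvx
  simpa [Finset.ne_of_mem_erase hzP, hzx, or_comm] using hzB

theorem IsAnchored.covers_of_connects (hP : IsAnchored P u v) (hw : w ∈ chartPoints P u v)
    {π : Finset (Finset ℂ)} (hπ : IsNCFamily (P.erase u) π) (hpin : Pinned π (w, v))
    (hx : x ∈ lower (P.erase u) (w, v)) (hy : y ∈ upper (P.erase u) (w, v))
    (hxy : Connects π x y) : Covers u v x y w := by
  obtain ⟨hyw, hyv, hnc⟩ := hpin.not_crosses hπ (mem_lower.1 hx).2 hxy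
  obtain ⟨hxc, hxw⟩ := hP.absc_lt_of_mem_lower hw hx
  obtain ⟨hyc, hwvy, hwy⟩ := hP.absc_lt_of_mem_upper hw hy hyw hyv
  have hx0 := (NCConfig.mem_chartPoints.1 hxc).2
  have hy0 := (NCConfig.mem_chartPoints.1 hyc).2
  have hxw' : x ≠ w := fun h => hxw.ne (by rw [h])
  have hxy' : x ≠ y := fun h => (hxw.trans hwy).ne (by rw [h])
  refine ⟨hy0, hxw, hwy, lt_of_not_ge fun hneg => hnc ⟨(mem_lower.1 hx).2, hwvy, ?_⟩⟩
  exact mul_neg_of_pos_of_neg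
    (lt_of_le_of_ne hneg (hP.orient_ne_zero hxc hyc hw hxy' hxw' hyw).symm)
    ((orient_right_neg_iff hx0 hy0).2 (hxw.trans hwy))

theorem IsAnchored.pinnedFamilies_eq (hP : IsAnchored P u v) (hw : w ∈ chartPoints P u v) :
    pinnedFamilies (P.erase u) [(w, v)] =
      gluedFamilies u v (lower (P.erase u) (w, v)) (upper (P.erase u) (w, v)) [] (w, v) w := by
  ext π
  rw [mem_pinnedFamilies, mem_gluedFamilies, Finset.union_comm, upper_union_lower, ← and_assoc]
  exact (and_iff_left_of_imp fun ⟨hπ, hpin⟩ x hx y hy =>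
    hP.covers_of_connects hw hπ (hpin (w, v) List.mem_cons_self) hx hy).symm

theorem IsAnchored.disjoint_pinnedFamilies (hP : IsAnchored P u v) {w' : ℂ}
    (hw : w ∈ chartPoints P u v) (hw' : w' ∈ chartPoints P u v) (hne : w ≠ w') {X : Finset ℂ} :
    Disjoint (pinnedFamilies X [(w, v)]) (pinnedFamilies X [(w', v)]) := by
  rw [Finset.disjoint_left]
  intro π hπ hπ'
  obtain ⟨hπ, hpin⟩ := mem_pinnedFamilies.1 hπ
  obtain ⟨D, hD, hwD, hvD, hleft⟩ := hpin (w, v) List.mem_cons_self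
  obtain ⟨D', hD', hwD', hvD', hleft'⟩ := (mem_pinnedFamilies.1 hπ').2 (w', v) List.mem_cons_self
  obtain rfl := hπ.eq_of_mem hD hD' hvD hvD'
  have hnonneg : 0 ≤ orient w v w' := hleft w' hwD'
  have hnonneg' : 0 ≤ orient w' v w := hleft' w hwD
  have hswap : orient w' v w = -orient w v w' := by rw [orient_swap_left, orient_rotate]
  exact hP.gp.orient_ne_zero (NCConfig.mem_chartPoints.1 hw).1 hP.right_mem
    (NCConfig.mem_chartPoints.1 hw').1 (ne_of_mem_chartPoints hw).2 hne
    (ne_of_mem_chartPoints hw').2.symm (by linarith)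

end Apex

/-! ### Moving an end of the boundary edge -/

theorem exists_forall_orient_nonneg {S : Finset ℂ} (hS : S.Nonempty) {u v : ℂ}
    (h : ∀ z ∈ S, 0 < orient u v z) : ∃ t ∈ S, ∀ z ∈ S, 0 ≤ orient t u z := by
  -- Reflecting `v` in `u` makes `u` the point at infinity of the chart.
  have hreflect (z : ℂ) : orient (2 * u - v) u z = orient u v z := by
    simp only [orient, Complex.sub_re, Complex.sub_im, Complex.mul_re, Complex.mul_im,
      Complex.re_ofNat, Complex.im_ofNat]
    ring
  simp only [← hreflect] at h
  obtain ⟨t, ht, hmin⟩ := S.exists_min_image (absc (2 * u - v) u) hS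
  refine ⟨t, ht, fun z hz => not_lt.1 fun hneg => (hmin z hz).not_gt ?_⟩
  rwa [← orient_right_neg_iff (h z hz) (h t ht), ← orient_rotate]

theorem disjoint_convexHull_insert {F C : Finset ℂ} {p q r s : ℂ}
    (h : Disjoint (convexHull ℝ (F : Set ℂ)) (convexHull ℝ (C : Set ℂ)))
    (hp : p ∈ F) (hq : q ∈ F) (hr : r ∈ C) (hc : Crosses p q r s) :
    Disjoint (convexHull ℝ (insert s F : Set ℂ)) (convexHull ℝ (C : Set ℂ)) := by
  obtain ⟨f, a, b, ha, hab, hb⟩ := geometric_hahn_banach_compact_closed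
    (convex_convexHull ℝ (F : Set ℂ)) (F.finite_toSet.isCompact_convexHull (𝕜 := ℝ))
    (convex_convexHull ℝ (C : Set ℂ)) (C.finite_toSet.isClosed_convexHull (𝕜 := ℝ)) h
  have hF : ∀ z ∈ F, f z < a := fun z hz => ha z (subset_convexHull ℝ _ hz)
  have hC : ∀ z ∈ C, a < f z := fun z hz => hab.trans (hb z (subset_convexHull ℝ _ hz))
  have hle : Convex ℝ {z | f z ≤ a} := convex_halfSpace_le f.toLinearMap.isLinear a
  have hlt : Convex ℝ {z | f z < a} := convex_halfSpace_lt f.toLinearMap.isLinear a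
  have hgt : Convex ℝ {z | a < f z} := convex_halfSpace_gt f.toLinearMap.isLinear a
  rcases le_or_gt (f s) a with hs | hs
  · refine Set.disjoint_of_subset (convexHull_min ?_ hle) (convexHull_min hC hgt)
      (Set.disjoint_left.2 fun z (h : f z ≤ a) => not_lt.2 h)
    exact Set.insert_subset hs fun z hz => (hF z hz).le
  · refine absurd ?_ (hc.not_disjoint_convexHull (A := {p, q}) (B := {r, s})
      (by simp) (by simp) (by simp) (by simp))
    refine Set.disjoint_of_subset (convexHull_min ?_ hlt) (convexHull_min ?_ hgt)
      (Set.disjoint_left.2 fun z (h : f z < a) => not_lt_of_gt h)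
    · exact Set.insert_subset (hF p hp) (Set.singleton_subset_iff.2 (hF q hq))
    · exact Set.insert_subset (hC r hr) (Set.singleton_subset_iff.2 hs)

section Erase

variable {P F C : Finset ℂ} {u v t z : ℂ} {σ : Finset (Finset ℂ)}

theorem IsAnchored.crosses_of_forall_orient_nonneg (hP : IsAnchored P u v) (hF : F ⊆ P.erase u)
    (htF : t ∈ F) (htv : t ≠ v) (htu : ∀ x ∈ F, 0 ≤ orient t u x)
    (hpin : t ∈ apexes P u v → ∃ x ∈ F, orient t v x < 0) (hz : z ∈ chartPoints P u v)
    (hzF : z ∉ F) (htz : 0 ≤ orient t u z) : Crosses v t z u := by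
  have hchart {x} (hx : x ∈ F) (hxv : x ≠ v) : x ∈ chartPoints P u v :=
    hP.mem_chartPoints (Finset.mem_of_mem_erase (hF hx)) (Finset.ne_of_mem_erase (hF hx)) hxv
  have htc := hchart htF htv
  obtain ⟨htP, ht0⟩ := NCConfig.mem_chartPoints.1 htc
  obtain ⟨hzP, hz0⟩ := NCConfig.mem_chartPoints.1 hz
  have htz' : t ≠ z := fun h => hzF (h ▸ htF)
  have htu' {x} (hx : x ∈ chartPoints P u v) (htx : t ≠ x) (h : 0 ≤ orient t u x) :
      0 < orient t u x :=
    hP.gp.orient_pos htP hP.left_mem (NCConfig.mem_chartPoints.1 hx).1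
      (ne_of_mem_chartPoints htc).1 htx (ne_of_mem_chartPoints hx).1.symm h
  have htuz := htu' hz htz' htz
  refine ⟨lt_of_not_ge fun hvtz => ?_, by rwa [← orient_rotate] at ht0, ?_⟩
  · have hvtz := hP.gp.orient_pos hP.right_mem htP hzP htv.symm
      (ne_of_mem_chartPoints hz).2.symm htz' hvtz
    obtain ⟨x, hxF, hx⟩ := hpin (mem_apexes.2 ⟨htc, z, hzP, hz0, hvtz, htuz⟩)
    have hxv : x ≠ v := by rintro rfl; simp at hx
    have hxt : t ≠ x := by rintro rfl; simp at hx
    have hxc := hchart hxF hxv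
    refine hzF (hP.eq_of_mem_triangle htP hxc ?_ (htu' hxc hxt (htu x hxF)) hz hvtz htuz ▸ hxF)
    rwa [orient_swap_left, neg_pos]
  · rw [← orient_rotate z u v, ← orient_rotate z u t, orient_swap_left t u z]
    exact mul_neg_of_pos_of_neg hz0 (neg_neg_of_pos htuz)

theorem IsAnchored.disjoint_insert (hP : IsAnchored P u v) (hσ : IsNCFamily (P.erase u) σ)
    (hpin : ∀ w ∈ apexes P u v, ¬ Pinned σ (w, v)) (hF : F ∈ σ) (hC : C ∈ σ) (hvF : v ∈ F)
    (hFC : F ≠ C) :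
    Disjoint (convexHull ℝ (insert u F : Set ℂ)) (convexHull ℝ (C : Set ℂ)) := by
  have hchart {E} (hE : E ∈ σ) {z} (hz : z ∈ E) (hzv : z ≠ v) : z ∈ chartPoints P u v :=
    have hzP := hσ.subset E hE hz
    hP.mem_chartPoints (Finset.mem_of_mem_erase hzP) (Finset.ne_of_mem_erase hzP) hzv
  have hnotF {z} (hz : z ∈ C) : z ∉ F := fun hzF => hFC (hσ.eq_of_mem hF hC hzF hz)
  have hCchart {z} (hz : z ∈ C) : z ∈ chartPoints P u v :=
    hchart hC hz fun h => hnotF hz (h ▸ hvF)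
  rcases (F.erase v).eq_empty_or_nonempty with hFv | hFv
  · have hFv : F = {v} := ((Finset.erase_eq_empty_iff F v).1 hFv).resolve_left
      (Finset.ne_empty_of_mem hvF)
    refine disjoint_convexHull_of_orient (p := v) (q := u) (by simp [hFv]) fun z hz => ?_
    rw [orient_swap_left, neg_lt_zero]
    exact (NCConfig.mem_chartPoints.1 (hCchart hz)).2
  obtain ⟨t, ht, htu⟩ := exists_forall_orient_nonneg hFv fun z hz =>
    (NCConfig.mem_chartPoints.1
      (hchart hF (Finset.mem_of_mem_erase hz) (Finset.ne_of_mem_erase hz))).2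
  obtain ⟨htv, htF⟩ := Finset.mem_erase.1 ht
  replace htu : ∀ z ∈ F, 0 ≤ orient t u z := fun z hz => by
    rcases eq_or_ne z v with rfl | hzv
    · rw [← orient_rotate]
      exact (NCConfig.mem_chartPoints.1 (hchart hF htF htv)).2.le
    · exact htu z (Finset.mem_erase.2 ⟨hzv, hz⟩)
  by_cases hall : ∀ z ∈ C, orient t u z < 0
  · exact disjoint_convexHull_of_orient (p := t) (q := u) (by simpa using htu) hall
  push Not at hall
  obtain ⟨z, hz, htz⟩ := hall
  refine disjoint_convexHull_insert (hσ.disjoint F hF C hC hFC) hvF htF hz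
    (hP.crosses_of_forall_orient_nonneg (hσ.subset F hF) htF htv htu (fun hta => ?_) (hCchart hz)
      (hnotF hz) htz)
  by_contra! h
  exact hpin t hta ⟨F, hF, htF, hvF, h⟩

end Erase

section InsertBeside

/-- The family in which the point `u` joins the block of `v`: the inverse of erasing `u`. -/
def insertBeside (u v : ℂ) (σ : Finset (Finset ℂ)) : Finset (Finset ℂ) :=
  σ.image fun F => if v ∈ F then insert u F else F

variable {P X : Finset ℂ} {u v w : ℂ} {π σ : Finset (Finset ℂ)}

theorem mem_insertBeside {E : Finset ℂ} :
    E ∈ insertBeside u v σ ↔ ∃ F ∈ σ, (if v ∈ F then insert u F else F) = E := by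
  simp only [insertBeside, Finset.mem_image]

theorem trace_insertBeside (hσ : IsNCFamily X σ) (hu : u ∉ X) :
    trace (insertBeside u v σ) X = σ := by
  have hF {F} (hF : F ∈ σ) : (if v ∈ F then insert u F else F) ∩ X = F := by
    have := Finset.inter_eq_left.2 (hσ.subset F hF)
    split_ifs
    · rwa [Finset.insert_inter_of_notMem hu]
    · exact this
  ext A
  rw [mem_trace]
  constructor
  · rintro ⟨-, E, hE, rfl⟩
    obtain ⟨F, hFσ, rfl⟩ := mem_insertBeside.1 hE
    rwa [hF hFσ]
  · exact fun hA => ⟨hσ.nonempty A hA, _, mem_insertBeside.2 ⟨A, hA, rfl⟩, hF hA⟩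

theorem trace_erase_eq_image (hπ : IsNCFamily P π) (huv : u ≠ v)
    (hE : ∃ E ∈ π, u ∈ E ∧ v ∈ E) : trace π (P.erase u) = π.image fun E => E.erase u := by
  obtain ⟨D, hD, huD, hvD⟩ := hE
  have hinter : π.image (· ∩ P.erase u) = π.image fun E => E.erase u :=
    Finset.image_congr fun E hE => by
      rw [Finset.inter_erase, Finset.inter_eq_left.2 (hπ.subset E hE)]
  rw [trace, hinter, Finset.erase_eq_of_notMem]
  simp only [Finset.mem_image, not_exists, not_and]
  rintro E hE h
  rcases (Finset.erase_eq_empty_iff E u).1 h with rfl | rfl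
  · simpa using hπ.nonempty ∅ hE
  · rw [← hπ.eq_of_mem hD hE huD (by simp)] at h
    simpa [h, huv.symm] using Finset.mem_erase.2 ⟨huv.symm, hvD⟩

theorem insertBeside_trace (hπ : IsNCFamily P π) (huv : u ≠ v)
    (hE : ∃ E ∈ π, u ∈ E ∧ v ∈ E) : insertBeside u v (trace π (P.erase u)) = π := by
  rw [trace_erase_eq_image hπ huv hE, insertBeside, Finset.image_image]
  obtain ⟨D, hD, huD, hvD⟩ := hE
  refine (Finset.image_congr fun E hE => ?_).trans Finset.image_id
  simp only [Function.comp, Finset.mem_erase, huv.symm, ne_eq, not_false_eq_true, true_and, id]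
  split_ifs with h
  · exact Finset.insert_erase (hπ.eq_of_mem hD hE hvD h ▸ huD)
  · exact Finset.erase_eq_of_notMem fun hu => h (hπ.eq_of_mem hD hE huD hu ▸ hvD)

theorem card_trace_erase (hπ : IsNCFamily P π) (huv : u ≠ v)
    (hE : ∃ E ∈ π, u ∈ E ∧ v ∈ E) : (trace π (P.erase u)).card = π.card := by
  refine (Finset.card_erase_le.trans Finset.card_image_le).antisymm ?_
  calc π.card = (insertBeside u v (trace π (P.erase u))).card := by
        rw [insertBeside_trace hπ huv hE]
    _ ≤ (trace π (P.erase u)).card := Finset.card_image_le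

theorem IsAnchored.isNCFamily_insertBeside (hP : IsAnchored P u v)
    (hσ : IsNCFamily (P.erase u) σ) (hpin : ∀ w ∈ apexes P u v, ¬ Pinned σ (w, v)) :
    IsNCFamily P (insertBeside u v σ) := by
  refine ⟨fun E hE => ?_, fun E hE => ?_, fun z hz => ?_, fun E hE E' hE' hne => ?_⟩
  · obtain ⟨F, hF, rfl⟩ := mem_insertBeside.1 hE
    split_ifs
    · exact Finset.insert_nonempty _ _
    · exact hσ.nonempty F hF
  · obtain ⟨F, hF, rfl⟩ := mem_insertBeside.1 hE
    have hFP := (hσ.subset F hF).trans (Finset.erase_subset u P)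
    split_ifs
    · exact Finset.insert_subset hP.left_mem hFP
    · exact hFP
  · rcases eq_or_ne z u with rfl | hzu
    · obtain ⟨F, hF, hvF⟩ := hσ.cover v (Finset.mem_erase.2 ⟨hP.ne.symm, hP.right_mem⟩)
      exact ⟨_, mem_insertBeside.2 ⟨F, hF, rfl⟩, by simp [hvF]⟩
    · obtain ⟨F, hF, hzF⟩ := hσ.cover z (Finset.mem_erase.2 ⟨hzu, hz⟩)
      refine ⟨_, mem_insertBeside.2 ⟨F, hF, rfl⟩, ?_⟩
      split_ifs <;> simp [hzF]
  · obtain ⟨F, hF, rfl⟩ := mem_insertBeside.1 hE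
    obtain ⟨F', hF', rfl⟩ := mem_insertBeside.1 hE'
    have hFF' : F ≠ F' := fun h => hne (by rw [h])
    split_ifs with hv hv' hv'
    · exact absurd (hσ.eq_of_mem hF hF' hv hv') hFF'
    · simpa using hP.disjoint_insert hσ hpin hF hF' hv hFF'
    · simpa using (hP.disjoint_insert hσ hpin hF' hF hv' hFF'.symm).symm
    · exact hσ.disjoint F hF F' hF' hFF'

theorem IsAnchored.pinned_iff (hP : IsAnchored P u v) (hπ : IsNCFamily P π) :
    Pinned π (u, v) ↔ ∃ E ∈ π, u ∈ E ∧ v ∈ E := by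
  refine ⟨fun ⟨E, hE, huE, hvE, _⟩ => ⟨E, hE, huE, hvE⟩,
    fun ⟨E, hE, huE, hvE⟩ => ⟨E, hE, huE, hvE, fun z hz => ?_⟩⟩
  rcases eq_or_ne z u with rfl | hzu
  · simp
  rcases eq_or_ne z v with rfl | hzv
  · simp
  exact (hP.pos z (hπ.subset E hE hz) hzu hzv).le

theorem IsAnchored.mem_pinnedFamilies (hP : IsAnchored P u v) :
    π ∈ pinnedFamilies P [(u, v)] ↔ IsNCFamily P π ∧ ∃ E ∈ π, u ∈ E ∧ v ∈ E := by
  rw [NCConfig.mem_pinnedFamilies, List.forall_mem_singleton]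
  exact and_congr_right hP.pinned_iff

theorem not_pinned_trace (hπ : IsNCFamily P π) (hE : ∃ E ∈ π, u ∈ E ∧ v ∈ E)
    (hw : w ∈ apexes P u v) : ¬ Pinned (trace π (P.erase u)) (w, v) := by
  rintro ⟨A, hA, hwA, hvA, hleft⟩
  obtain ⟨-, x, hx, huvx, hvwx, hwux⟩ := mem_apexes.1 hw
  obtain ⟨-, E, hEπ, rfl⟩ := mem_trace.1 hA
  have hxu : x ≠ u := by rintro rfl; simp at huvx
  have hxE : x ∉ E := fun hxE => by
    have hwvx : 0 ≤ orient w v x :=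
      hleft x (Finset.mem_inter.2 ⟨hxE, Finset.mem_erase.2 ⟨hxu, hx⟩⟩)
    rw [orient_swap_left] at hwvx
    linarith
  obtain ⟨D, hD, huD, hvD⟩ := hE
  obtain rfl := hπ.eq_of_mem hD hEπ hvD (Finset.mem_of_mem_inter_left hvA)
  obtain ⟨E', hE', hxE'⟩ := hπ.cover x hx
  exact Set.disjoint_left.1 (hπ.disjoint D hD E' hE' fun h => hxE (h ▸ hxE'))
    (interior_subset (mem_interior_triangle (Finset.mem_coe.2 huD) (Finset.mem_coe.2 hvD)
      (Finset.mem_coe.2 (Finset.mem_of_mem_inter_left hwA)) huvx hvwx hwux))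
    (subset_convexHull ℝ _ hxE')

theorem IsAnchored.bijOn_trace (hP : IsAnchored P u v) :
    Set.BijOn (trace · (P.erase u)) (pinnedFamilies P [(u, v)] : Set (Finset (Finset ℂ)))
      (ncFamilies (P.erase u) \
        (apexes P u v).biUnion fun w => pinnedFamilies (P.erase u) [(w, v)] :
          Finset (Finset (Finset ℂ))) := by
  have hmem {σ} : σ ∈ ncFamilies (P.erase u) \
      ((apexes P u v).biUnion fun w => pinnedFamilies (P.erase u) [(w, v)]) ↔
      IsNCFamily (P.erase u) σ ∧ ∀ w ∈ apexes P u v, ¬ Pinned σ (w, v) := by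
    simp only [Finset.mem_sdiff, mem_ncFamilies, Finset.mem_biUnion, NCConfig.mem_pinnedFamilies,
      List.forall_mem_singleton]
    grind
  refine Set.InvOn.bijOn (f' := insertBeside u v) ⟨fun π hπ => ?_, fun σ hσ => ?_⟩
    (fun π hπ => ?_) fun σ hσ => ?_
  · obtain ⟨hπ, hE⟩ := hP.mem_pinnedFamilies.1 hπ
    exact insertBeside_trace hπ hP.ne hE
  · exact trace_insertBeside (hmem.1 hσ).1 (Finset.notMem_erase u P)
  · obtain ⟨hπ, hE⟩ := hP.mem_pinnedFamilies.1 hπ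
    exact hmem.2 ⟨hπ.trace (Finset.erase_subset u P), fun w hw => not_pinned_trace hπ hE hw⟩
  · obtain ⟨hσ, hpin⟩ := hmem.1 hσ
    obtain ⟨F, hF, hvF⟩ := hσ.cover v (Finset.mem_erase.2 ⟨hP.ne.symm, hP.right_mem⟩)
    exact hP.mem_pinnedFamilies.2 ⟨hP.isNCFamily_insertBeside hσ hpin,
      _, mem_insertBeside.2 ⟨F, hF, rfl⟩, by simp [hvF], by simp [hvF]⟩

end InsertBeside

/-! ### Block symmetry of anchored configurations -/

section Anchored

variable {P : Finset ℂ} {u v y z : ℂ}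

theorem IsAnchored.blockSymmetric_biUnion_apexes (hP : IsAnchored P u v)
    (hnc : ∀ Y ⊂ P, Y.Nonempty → BlockSymmetric (ncFamilies Y) (Y.card + 1))
    (hpin : ∀ Y ⊂ P, ∀ c ∈ Y, ∀ d ∈ Y, c ≠ d → (∀ z ∈ Y, 0 ≤ orient c d z) →
      PropertyDeltaOneRel Y c d → BlockSymmetric (pinnedFamilies Y [(c, d)]) Y.card) :
    BlockSymmetric ((apexes P u v).biUnion fun w => pinnedFamilies (P.erase u) [(w, v)])
      P.card := by
  refine BlockSymmetric.biUnion (fun w hw => ?_) fun w hw w' hw' hne =>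
    hP.disjoint_pinnedFamilies (mem_apexes.1 hw).1 (mem_apexes.1 hw').1 hne
  obtain ⟨B, hB, hG⟩ := hP.exists_isGlue hw
  have hcard : (lower (P.erase u) (w, v)).card + (upper (P.erase u) (w, v)).card + 1 = P.card := by
    rw [add_comm (lower _ _).card, card_upper_add_card_lower,
      Finset.card_erase_add_one hP.left_mem]
  rw [hP.pinnedFamilies_eq (mem_apexes.1 hw).1, ← hcard]
  exact_mod_cast hG.blockSymmetric hP hB hnc hpin

theorem IsAnchored.blockSymmetric {P : Finset ℂ} {u v : ℂ} (hP : IsAnchored P u v)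
    (hsub : ∀ Q ⊂ P, NCRankSymmetric Q) : BlockSymmetric (pinnedFamilies P [(u, v)]) P.card := by
  have hnc (Y) (hY : Y ⊂ P) (hne : Y.Nonempty) : BlockSymmetric (ncFamilies Y) (Y.card + 1) :=
    (hsub Y hY).blockSymmetric hne
  have hpin (Y) (hY : Y ⊂ P) (c) (hc : c ∈ Y) (d) (hd : d ∈ Y) (hcd : c ≠ d)
      (hnonneg : ∀ z ∈ Y, 0 ≤ orient c d z) (hrel : PropertyDeltaOneRel Y c d) :
      BlockSymmetric (pinnedFamilies Y [(c, d)]) Y.card :=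
    have hgp := hP.gp.mono hY.subset
    have hY' : IsAnchored Y c d := ⟨hgp, hc, hd, hcd, fun z hz hzc hzd =>
      hgp.orient_pos hc hd hz hcd hzc.symm hzd.symm (hnonneg z hz), hrel⟩
    hY'.blockSymmetric fun Q hQ => hsub Q (hQ.trans hY)
  have herase : BlockSymmetric (ncFamilies (P.erase u)) P.card := by
    have h := hnc (P.erase u) (Finset.erase_ssubset hP.left_mem)
      ⟨v, Finset.mem_erase.2 ⟨hP.ne.symm, hP.right_mem⟩⟩
    rwa [← Nat.cast_add_one, Finset.card_erase_add_one hP.left_mem] at h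
  refine (herase.sdiff (hP.blockSymmetric_biUnion_apexes hnc hpin) ?_).of_bijOn _ hP.bijOn_trace
    fun π hπ => ?_
  · exact Finset.biUnion_subset.2 fun w _ σ hσ =>
      mem_ncFamilies.2 (NCConfig.mem_pinnedFamilies.1 hσ).1
  · obtain ⟨hπ, hE⟩ := hP.mem_pinnedFamilies.1 hπ
    exact card_trace_erase hπ hP.ne hE
termination_by P.card
decreasing_by exact Finset.card_lt_card hY

theorem IsAnchored.intervalRankSymmetric (hP : IsAnchored P u v)
    (hsub : ∀ Q ⊂ P, NCRankSymmetric Q) :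
    IntervalRankSymmetric (linePartition hP.left_mem hP.right_mem) ⊤ :=
  intervalRankSymmetric_linePartition hP.left_mem hP.right_mem hP.ne
    (fun _ => hP.mem_pinnedFamilies) (hP.blockSymmetric hsub)

theorem linePartition_comm (hu : u ∈ P) (hv : v ∈ P) :
    linePartition hu hv = linePartition hv hu := by
  ext A
  simp only [mem_linePartition, Finset.pair_comm u v, ne_eq, ← and_assoc]
  grind

theorem IsBoundaryLine.orient_nonneg (h : IsBoundaryLine P u v) (hy : y ∈ P)
    (huvy : 0 < orient u v y) (hz : z ∈ P) : 0 ≤ orient u v z := by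
  by_contra! huvz
  let m : ℂ := (1 / 2 : ℝ) • u + (1 / 2 : ℝ) • v
  have hm (p q : ℂ) : orient p q m = 1 / 2 * orient p q u + 1 / 2 * orient p q v :=
    orient_combo p q u v (by norm_num)
  have hum : m ∈ segment ℝ u v := ⟨1 / 2, 1 / 2, by norm_num, by norm_num, by norm_num, rfl⟩
  refine (h.edge hum).2 (interior_maximal ?_ (((isOpen_setOf_orient_pos v y).inter
    (isOpen_setOf_orient_pos y u)).inter ((isOpen_setOf_orient_pos z v).inter
      (isOpen_setOf_orient_pos u z))) ?_)
  · rintro x ⟨⟨hvy, hyu⟩, hzv, huz⟩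
    simp only [Set.mem_ofPred_eq] at hvy hyu hzv huz
    rcases le_total 0 (orient u v x) with hx | hx
    · exact mem_convexHull_triangle (Finset.mem_coe.2 h.left_mem) (Finset.mem_coe.2 h.right_mem)
        (Finset.mem_coe.2 hy) huvy hx hvy.le hyu.le
    · refine mem_convexHull_triangle (Finset.mem_coe.2 h.right_mem) (Finset.mem_coe.2 h.left_mem)
        (Finset.mem_coe.2 hz) ?_ ?_ huz.le hzv.le <;> rw [orient_swap_left] <;> linarith
  · simp only [Set.mem_inter_iff, Set.mem_ofPred_eq, hm, orient_self_outer, orient_self_right]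
    have := orient_rotate u v y
    have := orient_rotate y u v
    have := orient_swap_right u v z
    have := orient_rotate z v u
    have := orient_swap_left u v z
    refine ⟨⟨?_, ?_⟩, ?_, ?_⟩ <;> linarith

theorem PropertyDeltaOneRel.symm (h : PropertyDeltaOneRel P u v) : PropertyDeltaOneRel P v u :=
  fun B hB hv hu => h B hB hu hv

theorem IsBoundaryLine.isAnchored_or (hl : IsBoundaryLine P u v) (hP : GeneralPosition P)
    (hrel : PropertyDeltaOneRel P u v) : IsAnchored P u v ∨ IsAnchored P v u := by
  by_cases hpos : ∃ y ∈ P, 0 < orient u v y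
  · obtain ⟨y, hy, huvy⟩ := hpos
    exact .inl ⟨hP, hl.left_mem, hl.right_mem, hl.ne, fun z hz hzu hzv => hP.orient_pos
      hl.left_mem hl.right_mem hz hl.ne hzu.symm hzv.symm (hl.orient_nonneg hy huvy hz), hrel⟩
  · push Not at hpos
    refine .inr ⟨hP, hl.right_mem, hl.left_mem, hl.ne.symm, fun z hz hzv hzu => hP.orient_pos
      hl.right_mem hl.left_mem hz hl.ne.symm hzv.symm hzu.symm ?_, hrel.symm⟩
    rw [orient_swap_left, neg_nonneg]
    exact hpos z hz

end Anchored

end NCConfig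

end

theorem lemma5p2_general (P : Finset ℂ) (u v : ℂ)
    (hP : NCConfig.GeneralPosition P)
    (hl : NCConfig.IsBoundaryLine P u v)
    (hrel : NCConfig.PropertyDeltaOneRel P u v)
    (hsub : ∀ Q : Finset ℂ, Q ⊂ P → NCConfig.NCRankSymmetric Q) :
    NCConfig.IntervalRankSymmetric
      (NCConfig.linePartition hl.left_mem hl.right_mem) (⊤ : Finpartition P) := by
  rcases hl.isAnchored_or hP hrel with hA | hA
  · exact hA.intervalRankSymmetric hsub
  · rw [NCConfig.linePartition_comm]
    exact hA.intervalRankSymmetric hsub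

theorem lemma5p2 (P : Finset ℂ) (u v : ℂ)
    (hP : NCConfig.PropertyDelta 2 P)
    (hl : NCConfig.IsBoundaryLine P u v)
    (hrel : NCConfig.PropertyDeltaOneRel P u v)
    (hsub : ∀ Q : Finset ℂ, Q ⊂ P → NCConfig.NCRankSymmetric Q) :
    NCConfig.IntervalRankSymmetric
      (NCConfig.linePartition hl.left_mem hl.right_mem) (⊤ : Finpartition P) :=
  lemma5p2_general P u v hP.1 hl hrel hsub
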